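/- Let $G$ be a group. All algebras are over $\mathbb C$, not necessarily unital, with non-degenerate product, and $M(\cdot)$ denotes the multiplier algebra. A multiplier Hopf algebra is a pair $(A,\Delta)$ of an algebra $A$ and a homomorphism $\Delta:A\to M(A\otimes A)$ such that $\Delta(a)(1\otimes b)$ and $(a\otimes 1)\Delta(b)$ lie in $A\otimes A$ for all $a,b\in A$, such that $\Delta$ is coassociative, i.e. $(a\otimes1\otimes1)(\Delta\otimes\iota)(\Delta(b)(1\otimes c))=(\iota\otimes\Delta)((a\otimes1)\Delta(b))(1\otimes1\otimes c)$ for all $a,b,c\in A$, and such that the linear maps $a\otimes b\mapsto\Delta(a)(1\otimes b)$ and $a\otimes b\mapsto(a\otimes1)\Delta(b)$ of $A\otimes A$ are bijective. It is regular if $(A,\Delta^{\mathrm{op}})$, with $\Delta^{\mathrm{op}}$ the composition of $\Delta$ with the flip, is also a multiplier Hopf algebra. It is $G$-cograded if $A=\bigoplus_{p\in G}A_p$ for non-zero subalgebras $A_p$ with $A_pA_q=0$ for $p\neq q$ and $\Delta(A_{pq})(1\otimes A_q)=A_p\otimes A_q=(A_p\otimes1)\Delta(A_{pq})$ (linear spans)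 for all $p,q\in G$. Let $(A,\Delta)$ be a regular $G$-cograded multiplier Hopf algebra such that every $A_p$ is finite-dimensional and has an identity $1_p$. Write $A_p'$ for the dual space of $A_p$, seen as the space of the functionals on $A$ that vanish on $A_q$ for all $q\neq p$. (i) $A$ has a left integral, that is, a non-zero linear functional $\varphi$ with $(\iota\otimes\varphi)\Delta(a)=\varphi(a)1$ in $M(A)$ for all $a\in A$, and it has a right integral, that is, a non-zero linear functional $\psi$ with $(\psi\otimes\iota)\Delta(a)=\psi(a)1$ for all $a\in A$. Each of the two is unique up to a scalar. (ii) For every left integral $\varphi$, the space $\hat A=\{\varphi(\,\cdot\,a) : a\in A\}$ is equal to $A^*=\bigoplus_{p\in G}A_p'$. The pair $(A,\Delta)$ has a counit $\varepsilon$, and it has an antipode $S$ that is a bijective anti-homomorphism $A\to A$ with $S(A_p)=A_{p^{-1}}$ for all $p\in G$. The space $\hat A=A^*$ is a (usual) Hopf algebra, with the product dual to $\Delta$, that is, $(fg)(x)=(\varphi\otimes\varphi)(\Delta(x)(c\otimes d))$ for $f=\varphi(\,\cdot\,c)$ and $g=\varphi(\,\cdot\,d)$, and the coproduct dual to the product of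 $A$, that is, $(\Delta f)(x\otimes y)=f(xy)$. With $\Delta_{p,q}(x)=\Delta(x)(1_p\otimes1_q)\in A_p\otimes A_q$ for $x\in A_{pq}$, this structure is given explicitly as follows. - For $f\in A_p'$ and $g\in A_q'$, the product $fg$ is in $A_{pq}'$, and $(fg)(x)=(f\otimes g)(\Delta_{p,q}(x))$ for $x\in A_{pq}$. - The identity is the element of $A_e'$ given by the restriction of $\varepsilon$ to $A_e$, where $e$ is the identity of $G$. - For $f\in A_p'$, the coproduct $\Delta(f)$ is in $A_p'\otimes A_p'$, and $(\Delta(f))(x\otimes y)=f(xy)$ for $x,y\in A_p$. - The counit of $f\in A_p'$ is $f(1_p)$. - For $f\in A_p'$, the antipode $S(f)$ is in $A_{p^{-1}}'$, and $(S(f))(x)=f(S(x))$ for $x\in A_{p^{-1}}$. -/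

import Mathlib

open scoped TensorProduct

universe u v w

noncomputable section

namespace MultiplierHopf

/-! ### Multiplier algebras -/

section Multiplier

variable (B : Type u) [NonUnitalRing B] [Module ℂ B] [IsScalarTower ℂ B B] [SMulCommClass ℂ B B]
variable (C : Type v) [NonUnitalRing C] [Module ℂ C] [IsScalarTower ℂ C C] [SMulCommClass ℂ C C]

/-- The multiplier algebra `M(B)`: pairs `(L, R)` of linear maps of `B`, to be thought of as
`L b = m b` and `R b = b m`, with the evident compatibilities. The second factor carries the
opposite product, since `b (m n) = (b m) n`. -/
def multiplierAlgebra : Subalgebra ℂ (Module.End ℂ B × (Module.End ℂ B)ᵐᵒᵖ) where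
  carrier := {m | (∀ a b, m.1 (a * b) = m.1 a * b) ∧
    (∀ a b, m.2.unop (a * b) = a * m.2.unop b) ∧
    (∀ a b, m.2.unop a * b = a * m.1 b)}
  mul_mem' := by
    rintro m n ⟨h1, h2, h3⟩ ⟨k1, k2, k3⟩
    refine ⟨fun a b => ?_, fun a b => ?_, fun a b => ?_⟩
    · simp [h1, k1]
    · simp [h2, k2]
    · simp [h3, k3]
  add_mem' := by
    rintro m n ⟨h1, h2, h3⟩ ⟨k1, k2, k3⟩
    refine ⟨fun a b => ?_, fun a b => ?_, fun a b => ?_⟩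
    · simp [h1, k1, add_mul]
    · simp [h2, k2, mul_add]
    · simp [h3, k3, add_mul, mul_add]
  algebraMap_mem' := by
    intro r
    refine ⟨fun a b => ?_, fun a b => ?_, fun a b => ?_⟩ <;>
      simp [Module.algebraMap_end_apply, smul_mul_assoc, mul_smul_comm]

/-- `M(B)` as a type. -/
def Multiplier : Type u := multiplierAlgebra B

instance : Ring (Multiplier B) := inferInstanceAs (Ring (multiplierAlgebra B))

instance : Algebra ℂ (Multiplier B) := inferInstanceAs (Algebra ℂ (multiplierAlgebra B))

/-- The product of `B` is non-degenerate. -/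
def NondegenerateMul : Prop :=
  (∀ a : B, (∀ b, a * b = 0) → a = 0) ∧ (∀ b : B, (∀ a, a * b = 0) → b = 0)

variable {B C}

/-- `b ↦ m b`. -/
def Multiplier.left (m : Multiplier B) : B →ₗ[ℂ] B := m.1.1

/-- `b ↦ b m`. -/
def Multiplier.right (m : Multiplier B) : B →ₗ[ℂ] B := m.1.2.unop

/-- A multiplier from its two actions. -/
def Multiplier.mk (L R : B →ₗ[ℂ] B) (h1 : ∀ a b, L (a * b) = L a * b)
    (h2 : ∀ a b, R (a * b) = a * R b) (h3 : ∀ a b, R a * b = a * L b) : Multiplier B :=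
  ⟨(L, MulOpposite.op R), h1, h2, h3⟩

theorem Multiplier.ext' {m n : Multiplier B} (h1 : m.left = n.left) (h2 : m.right = n.right) :
    m = n :=
  Subtype.ext (Prod.ext h1 (MulOpposite.unop_injective h2))

theorem Multiplier.left_mul (m : Multiplier B) (a b : B) : m.left (a * b) = m.left a * b :=
  m.2.1 a b

theorem Multiplier.right_mul (m : Multiplier B) (a b : B) : m.right (a * b) = a * m.right b :=
  m.2.2.1 a b

theorem Multiplier.right_mul_eq (m : Multiplier B) (a b : B) : m.right a * b = a * m.left b :=
  m.2.2.2 a b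

/-- The canonical map `B → M(B)`. -/
def toMultiplier (b : B) : Multiplier B :=
  Multiplier.mk (LinearMap.mulLeft ℂ b) (LinearMap.mulRight ℂ b)
    (fun x y => by simp [mul_assoc]) (fun x y => by simp [mul_assoc])
    (fun x y => by simp [mul_assoc])

variable (B) in
/-- The canonical map `B → M(B)` as a linear map. -/
def toMultiplierLin : B →ₗ[ℂ] Multiplier B where
  toFun := toMultiplier
  map_smul' r b := Multiplier.ext'
    (LinearMap.ext fun x => smul_mul_assoc r b x) (LinearMap.ext fun x => mul_smul_comm r x b)
  map_add' b c := Multiplier.ext'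
    (LinearMap.ext fun x => add_mul b c x) (LinearMap.ext fun x => mul_add x b c)

/-- The multiplier `m ⊗ n` of `B ⊗ C`, for multipliers `m` of `B` and `n` of `C`. -/
def tmulMultiplier (m : Multiplier B) (n : Multiplier C) : Multiplier (B ⊗[ℂ] C) :=
  Multiplier.mk (TensorProduct.map m.left n.left) (TensorProduct.map m.right n.right)
    (fun x y => by
      induction x with
      | zero => simp
      | add x x' hx hx' => simp [add_mul, hx, hx']
      | tmul b c =>
        induction y with
        | zero => simp
        | add y y' hy hy' => simp only [mul_add, map_add, hy, hy']
        | tmul b' c' => simpa using congrArg₂ (· ⊗ₜ[ℂ] ·) (m.left_mul b b') (n.left_mul c c'))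
    (fun x y => by
      induction x with
      | zero => simp
      | add x x' hx hx' => simp [add_mul, hx, hx']
      | tmul b c =>
        induction y with
        | zero => simp
        | add y y' hy hy' => simp only [mul_add, map_add, hy, hy']
        | tmul b' c' => simpa using congrArg₂ (· ⊗ₜ[ℂ] ·) (m.right_mul b b') (n.right_mul c c'))
    (fun x y => by
      induction x with
      | zero => simp
      | add x x' hx hx' => simp [add_mul, hx, hx']
      | tmul b c =>
        induction y with
        | zero => simp
        | add y y' hy hy' => simp only [mul_add, map_add, hy, hy']
        | tmul b' c' => simpa using congrArg₂ (· ⊗ₜ[ℂ] ·) (m.right_mul_eq b b') (n.right_mul_eq c c'))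

/-- The linear map `M(B) ⊗ M(C) → M(B ⊗ C)`. -/
def tensorMultiplier : Multiplier B ⊗[ℂ] Multiplier C →ₗ[ℂ] Multiplier (B ⊗[ℂ] C) :=
  TensorProduct.lift <| LinearMap.mk₂ ℂ tmulMultiplier
    (fun m m' n => Multiplier.ext' (TensorProduct.map_add_left m.left m'.left n.left)
      (TensorProduct.map_add_left m.right m'.right n.right))
    (fun r m n => Multiplier.ext' (TensorProduct.map_smul_left r m.left n.left)
      (TensorProduct.map_smul_left r m.right n.right))
    (fun m n n' => Multiplier.ext' (TensorProduct.map_add_right m.left n.left n'.left)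
      (TensorProduct.map_add_right m.right n.right n'.right))
    (fun r m n => Multiplier.ext' (TensorProduct.map_smul_right r m.left n.left)
      (TensorProduct.map_smul_right r m.right n.right))

/-- Transport of multipliers along an isomorphism of algebras. -/
def transport (e : B ≃ₗ[ℂ] C) (he : ∀ a b, e (a * b) = e a * e b) :
    Multiplier B →ₐ[ℂ] Multiplier C where
  toFun m := Multiplier.mk (e.conj m.left) (e.conj m.right)
    (fun x y => by
      have : e.symm (x * y) = e.symm x * e.symm y := e.injective (by simp [he])
      have h := m.2.1 (e.symm x) (e.symm y)
      simp only [LinearEquiv.conj_apply_apply, this]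
      change e (m.1.1 _) = e (m.1.1 _) * y
      rw [h, he]; simp)
    (fun x y => by
      have : e.symm (x * y) = e.symm x * e.symm y := e.injective (by simp [he])
      have h := m.2.2.1 (e.symm x) (e.symm y)
      simp only [LinearEquiv.conj_apply_apply, this]
      change e (m.1.2.unop _) = x * e (m.1.2.unop _)
      rw [h, he]; simp)
    (fun x y => by
      have h := congrArg e (m.right_mul_eq (e.symm x) (e.symm y))
      rw [he, he] at h
      simpa [LinearEquiv.conj_apply_apply] using h)
  map_one' := Multiplier.ext' (LinearMap.ext fun x => e.apply_symm_apply x)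
    (LinearMap.ext fun x => e.apply_symm_apply x)
  map_zero' := Multiplier.ext' (LinearMap.ext fun _ => e.map_zero)
    (LinearMap.ext fun _ => e.map_zero)
  map_add' m n := Multiplier.ext' (LinearMap.ext fun _ => e.map_add _ _)
    (LinearMap.ext fun _ => e.map_add _ _)
  map_mul' m n := Multiplier.ext'
    (LinearMap.ext fun x => congrArg (fun z => e (m.left z))
      (e.symm_apply_apply (n.left (e.symm x))).symm)
    (LinearMap.ext fun x => congrArg (fun z => e (n.right z))
      (e.symm_apply_apply (m.right (e.symm x))).symm)
  commutes' r := Multiplier.ext'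
    (LinearMap.ext fun x => (e.map_smul r _).trans (congrArg (r • ·) (e.apply_symm_apply x)))
    (LinearMap.ext fun x => (e.map_smul r _).trans (congrArg (r • ·) (e.apply_symm_apply x)))

end Multiplier

section Hopf

variable {A : Type u} [NonUnitalRing A] [Module ℂ A] [IsScalarTower ℂ A A] [SMulCommClass ℂ A A]

variable (A) in
theorem comm_mul (x y : A ⊗[ℂ] A) : TensorProduct.comm ℂ A A (x * y) =
    TensorProduct.comm ℂ A A x * TensorProduct.comm ℂ A A y := by
  induction x with
  | zero => simp
  | add x x' hx hx' => simp [add_mul, hx, hx']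
  | tmul b c =>
    induction y with
    | zero => simp
    | add y y' hy hy' => simp [mul_add, hy, hy']
    | tmul b' c' => simp

variable (A) in
theorem assoc_mul (x y : (A ⊗[ℂ] A) ⊗[ℂ] A) : TensorProduct.assoc ℂ A A A (x * y) =
    TensorProduct.assoc ℂ A A A x * TensorProduct.assoc ℂ A A A y := by
  induction x with
  | zero => simp
  | add x x' hx hx' => simp [add_mul, hx, hx']
  | tmul b c =>
    induction y with
    | zero => simp
    | add y y' hy hy' => simp [mul_add, hy, hy']
    | tmul b' c' =>
      induction b with
      | zero => simp
      | add b d hb hd => simp_all [add_mul, TensorProduct.add_tmul]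
      | tmul b1 b2 =>
        induction b' with
        | zero => simp
        | add b' d' hb hd => simp_all [mul_add, TensorProduct.add_tmul]
        | tmul b1' b2' => simp

/-- The multiplier `a ⊗ 1` of `A ⊗ A`. -/
def fstLeg (a : A) : Multiplier (A ⊗[ℂ] A) := tmulMultiplier (toMultiplier a) 1

/-- The multiplier `1 ⊗ a` of `A ⊗ A`. -/
def sndLeg (a : A) : Multiplier (A ⊗[ℂ] A) := tmulMultiplier 1 (toMultiplier a)

/-! ### Multiplier Hopf algebras -/

/-- `Δ ⊗ ι : A ⊗ A → M(A ⊗ A ⊗ A)`. -/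
def coprodFst (Δ : A →ₙₐ[ℂ] Multiplier (A ⊗[ℂ] A)) :
    A ⊗[ℂ] A →ₗ[ℂ] Multiplier (A ⊗[ℂ] (A ⊗[ℂ] A)) :=
  (transport (TensorProduct.assoc ℂ A A A) (assoc_mul A)).toLinearMap ∘ₗ
    tensorMultiplier ∘ₗ TensorProduct.map (Δ : A →ₗ[ℂ] Multiplier (A ⊗[ℂ] A))
      (toMultiplierLin A)

/-- `ι ⊗ Δ : A ⊗ A → M(A ⊗ A ⊗ A)`. -/
def coprodSnd (Δ : A →ₙₐ[ℂ] Multiplier (A ⊗[ℂ] A)) :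
    A ⊗[ℂ] A →ₗ[ℂ] Multiplier (A ⊗[ℂ] (A ⊗[ℂ] A)) :=
  tensorMultiplier ∘ₗ TensorProduct.map (toMultiplierLin A)
    (Δ : A →ₗ[ℂ] Multiplier (A ⊗[ℂ] A))

/-- A comultiplication: the elements `Δ(a)(1 ⊗ b)` and `(a ⊗ 1)Δ(b)` lie in `A ⊗ A`, and
`(a ⊗ 1 ⊗ 1)(Δ ⊗ ι)(Δ(b)(1 ⊗ c)) = (ι ⊗ Δ)((a ⊗ 1)Δ(b))(1 ⊗ 1 ⊗ c)`. -/
structure IsComultiplication (Δ : A →ₙₐ[ℂ] Multiplier (A ⊗[ℂ] A)) : Prop where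
  mul_snd : ∀ a b : A, ∃ x : A ⊗[ℂ] A, toMultiplier x = Δ a * sndLeg b
  fst_mul : ∀ a b : A, ∃ x : A ⊗[ℂ] A, toMultiplier x = fstLeg a * Δ b
  coassoc : ∀ (a b c : A) (x y : A ⊗[ℂ] A),
    toMultiplier x = Δ b * sndLeg c → toMultiplier y = fstLeg a * Δ b →
    tmulMultiplier (toMultiplier a) (1 : Multiplier (A ⊗[ℂ] A)) * coprodFst Δ x =
      coprodSnd Δ y * tmulMultiplier (1 : Multiplier A) (sndLeg c)

/-- `(A, Δ)` is a multiplier Hopf algebra: the product of `A` is non-degenerate, `Δ` is a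
comultiplication, and the linear maps of `A ⊗ A` given by `a ⊗ b ↦ Δ(a)(1 ⊗ b)` and
`a ⊗ b ↦ (a ⊗ 1)Δ(b)` are bijective. -/
structure IsMultiplierHopfAlgebra (Δ : A →ₙₐ[ℂ] Multiplier (A ⊗[ℂ] A)) : Prop where
  nondegenerate : NondegenerateMul A
  isComultiplication : IsComultiplication Δ
  bijective_fst : ∃ T : A ⊗[ℂ] A ≃ₗ[ℂ] A ⊗[ℂ] A,
    ∀ a b, toMultiplier (T (a ⊗ₜ b)) = Δ a * sndLeg b
  bijective_snd : ∃ T : A ⊗[ℂ] A ≃ₗ[ℂ] A ⊗[ℂ] A,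
    ∀ a b, toMultiplier (T (a ⊗ₜ b)) = fstLeg a * Δ b

/-- The opposite comultiplication, `Δ` followed by the flip of `M(A ⊗ A)`. -/
def coopposite (Δ : A →ₙₐ[ℂ] Multiplier (A ⊗[ℂ] A)) : A →ₙₐ[ℂ] Multiplier (A ⊗[ℂ] A) :=
  (transport (TensorProduct.comm ℂ A A) (comm_mul A) :
    Multiplier (A ⊗[ℂ] A) →ₙₐ[ℂ] Multiplier (A ⊗[ℂ] A)).comp Δ

/-- A multiplier Hopf algebra is regular if it is one for the opposite comultiplication too. -/
structure IsRegularMultiplierHopfAlgebra (Δ : A →ₙₐ[ℂ] Multiplier (A ⊗[ℂ] A)) : Prop where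
  hopf : IsMultiplierHopfAlgebra Δ
  hopf_coopposite : IsMultiplierHopfAlgebra (coopposite Δ)

/-- `ε` is the counit: a homomorphism with `(ε ⊗ ι)(Δ(a)(1 ⊗ b)) = ab` and
`(ι ⊗ ε)((a ⊗ 1)Δ(b)) = ab`. -/
structure IsCounit (Δ : A →ₙₐ[ℂ] Multiplier (A ⊗[ℂ] A)) (ε : A →ₗ[ℂ] ℂ) : Prop where
  map_mul : ∀ a b, ε (a * b) = ε a * ε b
  counit_left : ∀ (a b : A) (x : A ⊗[ℂ] A), toMultiplier x = Δ a * sndLeg b →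
    TensorProduct.lid ℂ A (TensorProduct.map ε LinearMap.id x) = a * b
  counit_right : ∀ (a b : A) (x : A ⊗[ℂ] A), toMultiplier x = fstLeg a * Δ b →
    TensorProduct.rid ℂ A (TensorProduct.map LinearMap.id ε x) = a * b

/-- `S` is the antipode of a regular multiplier Hopf algebra with counit `ε`: a bijective
anti-homomorphism of `A` with `m(S ⊗ ι)(Δ(a)(1 ⊗ b)) = ε(a)b` and
`m(ι ⊗ S)((b ⊗ 1)Δ(a)) = ε(a)b`. -/
structure IsAntipode (Δ : A →ₙₐ[ℂ] Multiplier (A ⊗[ℂ] A)) (ε : A →ₗ[ℂ] ℂ) (S : A ≃ₗ[ℂ] A) :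
    Prop where
  map_mul : ∀ a b, S (a * b) = S b * S a
  antipode_left : ∀ (a b : A) (x : A ⊗[ℂ] A), toMultiplier x = Δ a * sndLeg b →
    LinearMap.mul' ℂ A (TensorProduct.map S.toLinearMap LinearMap.id x) = ε a • b
  antipode_right : ∀ (a b : A) (x : A ⊗[ℂ] A), toMultiplier x = fstLeg b * Δ a →
    LinearMap.mul' ℂ A (TensorProduct.map LinearMap.id S.toLinearMap x) = ε a • b

/-! ### Integrals -/

/-- `(ι ⊗ φ)Δ(a) = φ(a)1` in `M(A)` for all `a`, where the multiplier on the left is given by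
`b ↦ (ι ⊗ φ)(Δ(a)(b ⊗ 1))` and `b ↦ (ι ⊗ φ)((b ⊗ 1)Δ(a))`. -/
structure IsLeftInvariant (Δ : A →ₙₐ[ℂ] Multiplier (A ⊗[ℂ] A)) (φ : Module.Dual ℂ A) :
    Prop where
  left_action : ∀ (a b : A) (x : A ⊗[ℂ] A), toMultiplier x = Δ a * fstLeg b →
    TensorProduct.rid ℂ A (TensorProduct.map LinearMap.id φ x) = φ a • b
  right_action : ∀ (a b : A) (x : A ⊗[ℂ] A), toMultiplier x = fstLeg b * Δ a →
    TensorProduct.rid ℂ A (TensorProduct.map LinearMap.id φ x) = φ a • b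

/-- `(ψ ⊗ ι)Δ(a) = ψ(a)1` in `M(A)` for all `a`. -/
structure IsRightInvariant (Δ : A →ₙₐ[ℂ] Multiplier (A ⊗[ℂ] A)) (ψ : Module.Dual ℂ A) :
    Prop where
  left_action : ∀ (a b : A) (x : A ⊗[ℂ] A), toMultiplier x = Δ a * sndLeg b →
    TensorProduct.lid ℂ A (TensorProduct.map ψ LinearMap.id x) = ψ a • b
  right_action : ∀ (a b : A) (x : A ⊗[ℂ] A), toMultiplier x = sndLeg b * Δ a →
    TensorProduct.lid ℂ A (TensorProduct.map ψ LinearMap.id x) = ψ a • b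

/-- A left integral: a non-zero left invariant functional. -/
def IsLeftIntegral (Δ : A →ₙₐ[ℂ] Multiplier (A ⊗[ℂ] A)) (φ : Module.Dual ℂ A) : Prop :=
  φ ≠ 0 ∧ IsLeftInvariant Δ φ

/-- A right integral: a non-zero right invariant functional. -/
def IsRightIntegral (Δ : A →ₙₐ[ℂ] Multiplier (A ⊗[ℂ] A)) (ψ : Module.Dual ℂ A) : Prop :=
  ψ ≠ 0 ∧ IsRightInvariant Δ ψ

/-- `(f ⊗ g)(x)` for functionals `f`, `g` on `A` and `x` in `A ⊗ A`. -/
def evalTensor (f g : Module.Dual ℂ A) : A ⊗[ℂ] A →ₗ[ℂ] ℂ :=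
  LinearMap.mul' ℂ ℂ ∘ₗ TensorProduct.map f g

/-- The space of all functionals `x ↦ φ(xa)`, with `a` in `A`. -/
def dualSpace (φ : Module.Dual ℂ A) : Submodule ℂ (Module.Dual ℂ A) :=
  LinearMap.range (LinearMap.compr₂ (LinearMap.mul ℂ A).flip φ)

/-- The Hopf algebra `H`, as a space of functionals on `A` through `j`, is the dual of `(A, Δ)`
built on the left integral `φ`: the space is `{φ( · a)}`, the product is dual to `Δ`, which for
`f = φ( · c)` and `g = φ( · d)` reads `(fg)(x) = (φ ⊗ φ)(Δ(x)(c ⊗ d))`, and the coproduct is dual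
to the product of `A`. -/
structure IsDual (Δ : A →ₙₐ[ℂ] Multiplier (A ⊗[ℂ] A)) (φ : Module.Dual ℂ A)
    {H : Type w} [Ring H] [HopfAlgebra ℂ H] (j : H →ₗ[ℂ] Module.Dual ℂ A) : Prop where
  injective : Function.Injective j
  range_eq : LinearMap.range j = dualSpace φ
  mul_apply : ∀ (f g : H) (c d : A), (∀ x, j f x = φ (x * c)) → (∀ x, j g x = φ (x * d)) →
    ∀ x, j (f * g) x = evalTensor φ φ ((Δ x).left (c ⊗ₜ[ℂ] d))
  comul_apply : ∀ (f : H) (x y : A),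
    LinearMap.mul' ℂ ℂ (TensorProduct.map (j.flip x) (j.flip y) (Coalgebra.comul f)) =
      j f (x * y)

/-! ### Group-cograded multiplier Hopf algebras -/

variable {G : Type v} [Group G]

/-- The decomposition `A = ⨁ A_p` makes the multiplier Hopf algebra `(A, Δ)` into a
`G`-cograded one: the `A_p` are non-trivial subalgebras with `A_p A_q = 0` for `p ≠ q`, and
`Δ(A_{pq})(1 ⊗ A_q) = A_p ⊗ A_q = (A_p ⊗ 1)Δ(A_{pq})`, where the outer terms are linear spans
of products and `A_p ⊗ A_q` is a subspace of `A ⊗ A`. -/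
structure IsCograded (Δ : A →ₙₐ[ℂ] Multiplier (A ⊗[ℂ] A))
    (𝒜 : G → NonUnitalSubalgebra ℂ A) : Prop where
  nontrivial : ∀ p, 𝒜 p ≠ ⊥
  independent : iSupIndep fun p => (𝒜 p).toSubmodule
  iSup_eq_top : ⨆ p, (𝒜 p).toSubmodule = ⊤
  orthogonal : ∀ p q, p ≠ q → ∀ a ∈ 𝒜 p, ∀ b ∈ 𝒜 q, a * b = 0
  mul_snd : ∀ p q, Submodule.span ℂ {m | ∃ a ∈ 𝒜 (p * q), ∃ b ∈ 𝒜 q, m = Δ a * sndLeg b} =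
    Submodule.span ℂ {m | ∃ a ∈ 𝒜 p, ∃ b ∈ 𝒜 q, m = toMultiplier (a ⊗ₜ[ℂ] b)}
  fst_mul : ∀ p q, Submodule.span ℂ {m | ∃ a ∈ 𝒜 p, ∃ b ∈ 𝒜 (p * q), m = fstLeg a * Δ b} =
    Submodule.span ℂ {m | ∃ a ∈ 𝒜 p, ∃ b ∈ 𝒜 q, m = toMultiplier (a ⊗ₜ[ℂ] b)}

/-- `A_p'` inside the dual of `A`: the functionals that vanish on the other components. -/
def componentDual (𝒜 : G → NonUnitalSubalgebra ℂ A) (p : G) :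
    Submodule ℂ (Module.Dual ℂ A) where
  carrier := {f | ∀ q, q ≠ p → ∀ a ∈ 𝒜 q, f a = 0}
  add_mem' := by
    intro f g hf hg q hq a ha
    simp [hf q hq a ha, hg q hq a ha]
  zero_mem' := by
    intro q _ a _
    rfl
  smul_mem' := by
    intro r f hf q hq a ha
    simp [hf q hq a ha]

/-- The reduced dual `⨁ A_p'` inside the dual of `A`. -/
def reducedDual (𝒜 : G → NonUnitalSubalgebra ℂ A) : Submodule ℂ (Module.Dual ℂ A) :=
  ⨆ p, componentDual 𝒜 p

/-- The component `Δ_{p,q}(a) = Δ(a)(1_p ⊗ 1_q)` of the comultiplication, where `one p` is the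
identity of `A_p`. It is considered as an element of `A ⊗ A`. -/
def coprodComponent (Δ : A →ₙₐ[ℂ] Multiplier (A ⊗[ℂ] A)) (one : G → A) (p q : G) (a : A) :
    A ⊗[ℂ] A :=
  (Δ a).left (one p ⊗ₜ[ℂ] one q)

/-- The Hopf algebra `H` is, through `j`, the space `⨁ A_p'` with the following structure. The
product of `f ∈ A_p'` and `g ∈ A_q'` is in `A_{pq}'` and is `(f ⊗ g) ∘ Δ_{p,q}` there. The unit
is `ε_e ∈ A_e'`, the restriction of the counit `ε`. The coproduct of `f ∈ A_p'` is in
`A_p' ⊗ A_p'` and is given there by `x ⊗ y ↦ f(xy)`. The counit of `f ∈ A_p'` is `f(1_p)`. The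
antipode maps `f ∈ A_p'` into `A_{p⁻¹}'`, where it is `f ∘ S_{p⁻¹}`, with `S_{p⁻¹}` the
restriction of the antipode `S` to `A_{p⁻¹}`. -/
structure IsReducedDualHopf (Δ : A →ₙₐ[ℂ] Multiplier (A ⊗[ℂ] A))
    (𝒜 : G → NonUnitalSubalgebra ℂ A) (one : G → A) (ε : A →ₗ[ℂ] ℂ) (S : A ≃ₗ[ℂ] A)
    {H : Type w} [Ring H] [HopfAlgebra ℂ H] (j : H →ₗ[ℂ] Module.Dual ℂ A) : Prop where
  injective : Function.Injective j
  range_eq : LinearMap.range j = reducedDual 𝒜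
  mul_mem : ∀ p q f g, j f ∈ componentDual 𝒜 p → j g ∈ componentDual 𝒜 q →
    j (f * g) ∈ componentDual 𝒜 (p * q)
  mul_apply : ∀ p q f g, j f ∈ componentDual 𝒜 p → j g ∈ componentDual 𝒜 q →
    ∀ x ∈ 𝒜 (p * q), j (f * g) x = evalTensor (j f) (j g) (coprodComponent Δ one p q x)
  one_mem : j 1 ∈ componentDual 𝒜 1
  one_apply : ∀ x ∈ 𝒜 1, j 1 x = ε x
  comul_mem : ∀ p f, j f ∈ componentDual 𝒜 p →
    Coalgebra.comul f ∈ LinearMap.range (TensorProduct.mapIncl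
      ((componentDual 𝒜 p).comap j) ((componentDual 𝒜 p).comap j))
  comul_apply : ∀ p f, j f ∈ componentDual 𝒜 p → ∀ x ∈ 𝒜 p, ∀ y ∈ 𝒜 p,
    LinearMap.mul' ℂ ℂ (TensorProduct.map (j.flip x) (j.flip y) (Coalgebra.comul f)) =
      j f (x * y)
  counit_apply : ∀ p f, j f ∈ componentDual 𝒜 p → Coalgebra.counit (R := ℂ) f = j f (one p)
  antipode_mem : ∀ p f, j f ∈ componentDual 𝒜 p →
    j (HopfAlgebra.antipode ℂ f) ∈ componentDual 𝒜 p⁻¹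
  antipode_apply : ∀ p f, j f ∈ componentDual 𝒜 p → ∀ x ∈ 𝒜 p⁻¹,
    j (HopfAlgebra.antipode ℂ f) x = j f (S x)

end Hopf

end MultiplierHopf

end

/-! ### Multiplier actions, the projections on the components, and the maps Δ_{p,q}. -/

namespace MultiplierHopf

noncomputable section

section MultiplierLemmas

variable {B : Type u} [NonUnitalRing B] [Module ℂ B] [IsScalarTower ℂ B B] [SMulCommClass ℂ B B]
variable {C : Type v} [NonUnitalRing C] [Module ℂ C] [IsScalarTower ℂ C C] [SMulCommClass ℂ C C]

/-! The Hopf algebra A^* = ⨁ A_p' is built first, without any integral. The integrals, the counit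
and the antipode of A are then read off from it.

Since each A_p is finite-dimensional, functionals on A_p ⊗ A_q are tensors in A_p' ⊗ A_q'. Hence the
product of A dualizes to a coproduct on A^*, the maps Δ_{p,q} dualize to a graded product, and
identities in A^* and its tensor powers can be tested on A (`pair_injective`,
`pairThree_injective`). The bijections a ⊗ b ↦ (a ⊗ 1)Δ(b) of A ⊗ A, for Δ and for Δ^op, are
transposed to the Galois maps f ⊗ g ↦ f₁ ⊗ f₂g and f ⊗ g ↦ f₁ ⊗ gf₂ of A^* (`pair_galois`). They
preserve the gradings, so their transposes are bijective on A^* ⊗ A^* (`galois_bijective`).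
Bijectivity yields one-sided units, which coincide (`exists_unit`), an antipode (`hopfOfGalois`),
and, from the second map, an inverse of the antipode (`antipode_bijective`).

A left invariant functional on A amounts to a family φ_p ∈ A_p' with hφ_q = ε(h)φ_{pq} for h ∈ A_p'
(`isLeftFamily_of_isLeftInvariant`, `isLeftInvariant_of_isLeftFamily`). To find one, consider the
projection of A^* on A_e'. It has finite rank and commutes with left multiplication by A_e', so it
is an element of A^* ⊗ (A^*)' that is invariant under a diagonal action. Untwisting that action
gives Λ ≠ 0 with kΛ = ε(k)Λ for k ∈ A_e' (`exists_invariant`), and left multiplication moves a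
component of Λ to every degree (`exists_isLeftFamily`).

The identity φ₁ ⊗ hφ₂ = S(h)φ'₁ ⊗ φ'₂ (`one_tmul_mul_comul`) gives faithfulness of φ, hence by a
dimension count A_p' = φ(·A_p) (`IsLeftFamily.exists_mul_eq`), and also uniqueness
(`IsLeftFamily.unique`). The antipode exchanges left and right families. Finally, the counit of A is
the unit of A^*, and the antipode of A is the transpose of the antipode of A^* (`exists_antipode`).
-/

theorem Multiplier.mul_left_apply (m n : Multiplier B) (b : B) :
    (m * n).left b = m.left (n.left b) := rfl

theorem toMultiplier_left_apply (b c : B) : (toMultiplier b).left c = b * c := rfl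

variable (B) in
/-- `m ↦ m b` as a linear map in both arguments. -/
def Multiplier.leftLin : Multiplier B →ₗ[ℂ] B →ₗ[ℂ] B where
  toFun := Multiplier.left
  map_add' _ _ := rfl
  map_smul' _ _ := rfl

theorem Multiplier.leftLin_apply (m : Multiplier B) (b : B) :
    Multiplier.leftLin B m b = m.left b := rfl

/-- A multiplier commutes with central idempotents. -/
theorem Multiplier.left_eq_mul_left (m : Multiplier B) {e : B} (he : e * e = e)
    (hc : ∀ b, e * b = b * e) : e * m.left e = m.left e := by
  rw [hc, ← m.left_mul, he]

theorem tmulMultiplier_left_tmul (m : Multiplier B) (n : Multiplier C) (b : B) (c : C) :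
    (tmulMultiplier m n).left (b ⊗ₜ[ℂ] c) = m.left b ⊗ₜ n.left c := rfl

theorem fstLeg_left_tmul (a b c : B) : (fstLeg a).left (b ⊗ₜ[ℂ] c) = (a * b) ⊗ₜ c := rfl

theorem sndLeg_left_tmul (a b c : B) : (sndLeg a).left (b ⊗ₜ[ℂ] c) = b ⊗ₜ (a * c) := rfl

theorem coopposite_left_apply (Δ : B →ₙₐ[ℂ] Multiplier (B ⊗[ℂ] B)) (a : B) (x : B ⊗[ℂ] B) :
    (coopposite Δ a).left x = TensorProduct.comm ℂ B B ((Δ a).left (TensorProduct.comm ℂ B B x)) :=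
  rfl

theorem coprodFst_left_tmul (Δ : B →ₙₐ[ℂ] Multiplier (B ⊗[ℂ] B)) (x y a b c : B) :
    (coprodFst Δ (x ⊗ₜ[ℂ] y)).left (a ⊗ₜ[ℂ] (b ⊗ₜ[ℂ] c)) =
      TensorProduct.assoc ℂ B B B ((Δ x).left (a ⊗ₜ b) ⊗ₜ (y * c)) := rfl

theorem coprodSnd_left_tmul (Δ : B →ₙₐ[ℂ] Multiplier (B ⊗[ℂ] B)) (x y a b c : B) :
    (coprodSnd Δ (x ⊗ₜ[ℂ] y)).left (a ⊗ₜ[ℂ] (b ⊗ₜ[ℂ] c)) =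
      (x * a) ⊗ₜ (Δ y).left (b ⊗ₜ c) := rfl

end MultiplierLemmas

/-- A regular `G`-cograded multiplier Hopf algebra with finite-dimensional unital components. -/
structure CogradedUnital (G : Type v) [Group G] (A : Type u) [NonUnitalRing A] [Module ℂ A]
    [IsScalarTower ℂ A A] [SMulCommClass ℂ A A] where
  /-- the comultiplication -/
  Δ : A →ₙₐ[ℂ] Multiplier (A ⊗[ℂ] A)
  regular : IsRegularMultiplierHopfAlgebra Δ
  /-- the components -/
  comp : G → NonUnitalSubalgebra ℂ A
  cograded : IsCograded Δ comp
  finite : ∀ p, Module.Finite ℂ (comp p)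
  /-- the identities of the components -/
  one : G → A
  one_spec : ∀ p, one p ∈ comp p ∧ ∀ a ∈ comp p, one p * a = a ∧ a * one p = a

namespace CogradedUnital

variable {G : Type v} [Group G] {A : Type u} [NonUnitalRing A] [Module ℂ A]
  [IsScalarTower ℂ A A] [SMulCommClass ℂ A A] (D : CogradedUnital G A)

theorem one_mem (p : G) : D.one p ∈ D.comp p := (D.one_spec p).1

theorem one_mul_of_mem {p : G} {a : A} (ha : a ∈ D.comp p) : D.one p * a = a :=
  ((D.one_spec p).2 a ha).1

theorem mul_one_of_mem {p : G} {a : A} (ha : a ∈ D.comp p) : a * D.one p = a :=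
  ((D.one_spec p).2 a ha).2

theorem one_mul_of_ne {p q : G} (h : p ≠ q) {a : A} (ha : a ∈ D.comp q) : D.one p * a = 0 :=
  D.cograded.orthogonal p q h _ (D.one_mem p) _ ha

theorem mul_one_of_ne {p q : G} (h : p ≠ q) {a : A} (ha : a ∈ D.comp q) : a * D.one p = 0 :=
  D.cograded.orthogonal q p h.symm _ ha _ (D.one_mem p)

theorem one_mul_one (p : G) : D.one p * D.one p = D.one p := D.one_mul_of_mem (D.one_mem p)

theorem one_ne_zero (p : G) : D.one p ≠ 0 := by
  intro h
  refine D.cograded.nontrivial p (eq_bot_iff.2 fun a ha => ?_)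
  have := D.one_mul_of_mem ha
  rw [h, zero_mul] at this
  simp [← this]

/-- To prove something for all elements of `A` it suffices to consider homogeneous ones. -/
@[elab_as_elim]
theorem induction {P : A → Prop} (hom : ∀ p, ∀ a ∈ D.comp p, P a) (zero : P 0)
    (add : ∀ a b, P a → P b → P (a + b)) (a : A) : P a := by
  have ha : a ∈ ⨆ p, (D.comp p).toSubmodule := by rw [D.cograded.iSup_eq_top]; trivial
  exact Submodule.iSup_induction _ (motive := P) ha hom zero add

theorem one_comm (p : G) (a : A) : D.one p * a = a * D.one p := by
  refine D.induction (fun q a ha => ?_) (by simp)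
    (fun a b ha hb => by rw [mul_add, add_mul, ha, hb]) a
  by_cases h : p = q
  · subst h; rw [D.one_mul_of_mem ha, D.mul_one_of_mem ha]
  · rw [D.one_mul_of_ne h ha, D.mul_one_of_ne h ha]

/-- The projection of `A` on a component. -/
def proj (p : G) : A →ₗ[ℂ] A := LinearMap.mulLeft ℂ (D.one p)

theorem proj_apply (p : G) (a : A) : D.proj p a = D.one p * a := rfl

theorem proj_of_mem {p : G} {a : A} (ha : a ∈ D.comp p) : D.proj p a = a := D.one_mul_of_mem ha

theorem proj_of_ne {p q : G} (h : p ≠ q) {a : A} (ha : a ∈ D.comp q) : D.proj p a = 0 :=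
  D.one_mul_of_ne h ha

theorem proj_mem (p : G) (a : A) : D.proj p a ∈ D.comp p := by
  refine D.induction (fun q a ha => ?_) (by simp) (fun a b ha hb => ?_) a
  · by_cases h : p = q
    · subst h; rwa [D.proj_of_mem ha]
    · rw [D.proj_of_ne h ha]; exact zero_mem _
  · rw [map_add]; exact add_mem ha hb

theorem exists_finset_sum_proj (a : A) :
    ∃ F : Finset G, ∀ F', F ⊆ F' → ∑ p ∈ F', D.proj p a = a := by
  classical
  refine D.induction (fun q a ha => ⟨{q}, fun F' hF' => ?_⟩) ⟨∅, by simp⟩ ?_ a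
  · rw [Finset.sum_eq_single q, D.proj_of_mem ha]
    · intro p _ hp; exact D.proj_of_ne hp ha
    · intro h; exact absurd (hF' (Finset.mem_singleton_self q)) h
  · rintro a b ⟨F, hF⟩ ⟨F₁, hF₁⟩
    refine ⟨F ∪ F₁, fun F' h => ?_⟩
    simp only [map_add, Finset.sum_add_distrib]
    rw [hF _ (Finset.union_subset_left h), hF₁ _ (Finset.union_subset_right h)]

theorem exists_finset_sum_map_proj (z : A ⊗[ℂ] A) :
    ∃ F : Finset G, ∀ F₁ F₂, F ⊆ F₁ → F ⊆ F₂ →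
      ∑ p ∈ F₁, ∑ q ∈ F₂, TensorProduct.map (D.proj p) (D.proj q) z = z := by
  classical
  induction z with
  | zero => exact ⟨∅, by simp⟩
  | add z w hz hw =>
    obtain ⟨F, hF⟩ := hz
    obtain ⟨F', hF'⟩ := hw
    refine ⟨F ∪ F', fun F₁ F₂ h₁ h₂ => ?_⟩
    simp only [map_add, Finset.sum_add_distrib]
    rw [hF _ _ (Finset.union_subset_left h₁) (Finset.union_subset_left h₂),
      hF' _ _ (Finset.union_subset_right h₁) (Finset.union_subset_right h₂)]
  | tmul a b =>
    obtain ⟨F, hF⟩ := D.exists_finset_sum_proj a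
    obtain ⟨F', hF'⟩ := D.exists_finset_sum_proj b
    refine ⟨F ∪ F', fun F₁ F₂ h₁ h₂ => ?_⟩
    simp only [TensorProduct.map_tmul, ← TensorProduct.tmul_sum, ← TensorProduct.sum_tmul]
    rw [hF _ (Finset.union_subset_left h₁), hF' _ (Finset.union_subset_right h₂)]

/-- The central idempotent `1_p ⊗ 1_q`. -/
def idem (p q : G) : A ⊗[ℂ] A := D.one p ⊗ₜ D.one q

theorem idem_mul (p q : G) (z : A ⊗[ℂ] A) :
    D.idem p q * z = TensorProduct.map (D.proj p) (D.proj q) z := by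
  induction z with
  | zero => simp
  | add z w hz hw => rw [mul_add, hz, hw, map_add]
  | tmul a b => simp [idem, proj_apply]

theorem idem_comm (p q : G) (z : A ⊗[ℂ] A) : D.idem p q * z = z * D.idem p q := by
  induction z with
  | zero => simp
  | add z w hz hw => rw [mul_add, hz, hw, add_mul]
  | tmul a b => simp [idem, D.one_comm p a, D.one_comm q b]

theorem idem_mul_idem (p q : G) : D.idem p q * D.idem p q = D.idem p q := by
  simp [idem, D.one_mul_one]

theorem idem_mul_idem_of_ne {p q r s : G} (h : p ≠ r ∨ q ≠ s) :
    D.idem p q * D.idem r s = 0 := by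
  rcases h with h | h
  · simp [idem, D.one_mul_of_ne h (D.one_mem r)]
  · simp [idem, D.one_mul_of_ne h (D.one_mem s)]

/-- Elements of `A ⊗ A` with the same components are equal. -/
theorem tensor_ext {z w : A ⊗[ℂ] A} (h : ∀ p q, z * D.idem p q = w * D.idem p q) : z = w := by
  classical
  obtain ⟨F, hF⟩ := D.exists_finset_sum_map_proj z
  obtain ⟨F', hF'⟩ := D.exists_finset_sum_map_proj w
  have h₁ := Finset.subset_union_left (s₁ := F) (s₂ := F')
  have h₂ := Finset.subset_union_right (s₁ := F) (s₂ := F')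
  rw [← hF _ _ h₁ h₁, ← hF' _ _ h₂ h₂]
  refine Finset.sum_congr rfl fun p _ => Finset.sum_congr rfl fun q _ => ?_
  rw [← idem_mul, ← idem_mul, idem_comm, idem_comm, h]

/-- The component `Δ_{p,q}` of the comultiplication as a linear map. -/
def coprod (p q : G) : A →ₗ[ℂ] A ⊗[ℂ] A :=
  (Multiplier.leftLin (A ⊗[ℂ] A)).flip (D.idem p q) ∘ₗ (D.Δ : A →ₗ[ℂ] Multiplier (A ⊗[ℂ] A))

theorem coprod_apply (p q : G) (a : A) : D.coprod p q a = (D.Δ a).left (D.idem p q) := rfl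

theorem coprod_eq_coprodComponent (p q : G) (a : A) :
    D.coprod p q a = coprodComponent D.Δ D.one p q a := rfl

theorem idem_mul_coprod (p q : G) (a : A) : D.idem p q * D.coprod p q a = D.coprod p q a :=
  Multiplier.left_eq_mul_left _ (D.idem_mul_idem p q) (D.idem_comm p q)

theorem coprod_mul_idem (p q : G) (a : A) : D.coprod p q a * D.idem p q = D.coprod p q a := by
  rw [← idem_comm, idem_mul_coprod]

theorem map_proj_coprod (p q : G) (a : A) :
    TensorProduct.map (D.proj p) (D.proj q) (D.coprod p q a) = D.coprod p q a := by
  rw [← idem_mul, idem_mul_coprod]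

theorem coprod_mul (p q : G) (a b : A) :
    D.coprod p q (a * b) = D.coprod p q a * D.coprod p q b := by
  rw [coprod_apply, map_mul, Multiplier.mul_left_apply, ← coprod_apply, ← D.idem_mul_coprod p q b,
    Multiplier.left_mul, ← coprod_apply, idem_mul_coprod]

/-! The components of the elements `Δ(a)(1 ⊗ b)`, `Δ(a)(b ⊗ 1)`, `(a ⊗ 1)Δ(b)`, `(1 ⊗ a)Δ(b)`. -/

theorem mul_idem_of_mul_sndLeg {a b : A} {z : A ⊗[ℂ] A}
    (hz : toMultiplier z = D.Δ a * sndLeg b) (p q : G) :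
    z * D.idem p q = D.coprod p q a * (D.one p ⊗ₜ b) := by
  have : D.idem p q * (D.one p ⊗ₜ b) = D.one p ⊗ₜ[ℂ] (b * D.one q) := by
    simp [idem, D.one_mul_one, D.one_comm]
  rw [← toMultiplier_left_apply, hz, Multiplier.mul_left_apply, coprod_apply,
    ← Multiplier.left_mul, this]
  rfl

theorem mul_idem_of_mul_fstLeg {a b : A} {z : A ⊗[ℂ] A}
    (hz : toMultiplier z = D.Δ a * fstLeg b) (p q : G) :
    z * D.idem p q = D.coprod p q a * (b ⊗ₜ D.one q) := by
  have : D.idem p q * (b ⊗ₜ D.one q) = (b * D.one p) ⊗ₜ[ℂ] D.one q := by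
    simp [idem, D.one_mul_one, D.one_comm]
  rw [← toMultiplier_left_apply, hz, Multiplier.mul_left_apply, coprod_apply,
    ← Multiplier.left_mul, this]
  rfl

theorem fstLeg_left_coprod (p q : G) (a b : A) :
    (fstLeg a).left (D.coprod p q b) = (a ⊗ₜ D.one q) * D.coprod p q b := by
  have : (fstLeg a).left (D.idem p q) = (a ⊗ₜ D.one q) * D.idem p q := by
    simp [idem, fstLeg_left_tmul, D.one_mul_one]
  rw [← idem_mul_coprod, Multiplier.left_mul, this, mul_assoc]

theorem sndLeg_left_coprod (p q : G) (a b : A) :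
    (sndLeg a).left (D.coprod p q b) = (D.one p ⊗ₜ a) * D.coprod p q b := by
  have : (sndLeg a).left (D.idem p q) = (D.one p ⊗ₜ a) * D.idem p q := by
    simp [idem, sndLeg_left_tmul, D.one_mul_one]
  rw [← idem_mul_coprod, Multiplier.left_mul, this, mul_assoc]

theorem mul_idem_of_fstLeg_mul {a b : A} {z : A ⊗[ℂ] A}
    (hz : toMultiplier z = fstLeg a * D.Δ b) (p q : G) :
    z * D.idem p q = (a ⊗ₜ D.one q) * D.coprod p q b := by
  rw [← toMultiplier_left_apply, hz, Multiplier.mul_left_apply, ← coprod_apply, fstLeg_left_coprod]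

theorem mul_idem_of_sndLeg_mul {a b : A} {z : A ⊗[ℂ] A}
    (hz : toMultiplier z = sndLeg a * D.Δ b) (p q : G) :
    z * D.idem p q = (D.one p ⊗ₜ a) * D.coprod p q b := by
  rw [← toMultiplier_left_apply, hz, Multiplier.mul_left_apply, ← coprod_apply, sndLeg_left_coprod]

/-- By the cograding, (1_p ⊗ 1)Δ(a) lies in A_p ⊗ A_{p⁻¹r}, and this space is annihilated by 1_p ⊗
1_q unless q = p⁻¹r. -/
theorem coprod_of_ne {p q r : G} (h : r ≠ p * q) {a : A} (ha : a ∈ D.comp r) :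
    D.coprod p q a = 0 := by
  have key : ∀ m ∈ Submodule.span ℂ {m | ∃ a ∈ D.comp p, ∃ b ∈ D.comp (p⁻¹ * r),
      m = toMultiplier (a ⊗ₜ[ℂ] b)}, Multiplier.leftLin _ m (D.idem p q) = 0 := by
    intro m hm
    induction hm using Submodule.span_induction with
    | mem m hm =>
      obtain ⟨a, ha, b, hb, rfl⟩ := hm
      have hq : q ≠ p⁻¹ * r := fun hq => h (by simp [hq])
      simp [Multiplier.leftLin_apply, toMultiplier_left_apply, idem, D.mul_one_of_ne hq hb]
    | zero => simp
    | add m n _ _ hm hn => simp [hm, hn]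
    | smul c m _ hm => simp [hm]
  have h2 := key (fstLeg (D.one p) * D.Δ a) (by
    rw [← D.cograded.fst_mul]
    exact Submodule.subset_span ⟨_, D.one_mem p, a, by simpa using ha, rfl⟩)
  rwa [Multiplier.leftLin_apply, Multiplier.mul_left_apply, ← coprod_apply, fstLeg_left_coprod,
    ← idem, idem_mul_coprod] at h2

theorem coprod_proj (p q : G) (a : A) : D.coprod p q (D.proj (p * q) a) = D.coprod p q a := by
  refine D.induction (fun r a ha => ?_) (by simp) (fun a b ha hb => by simp [ha, hb]) a
  by_cases h : p * q = r
  · subst h; rw [D.proj_of_mem ha]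
  · rw [D.proj_of_ne h ha, map_zero, D.coprod_of_ne (Ne.symm h) ha]

theorem coprod_proj_of_ne {p q r : G} (h : r ≠ p * q) (a : A) :
    D.coprod p q (D.proj r a) = 0 := D.coprod_of_ne h (D.proj_mem r a)

/-- Left multiplication by Δ(1_{pq}) fixes Δ(A_{pq})(1 ⊗ A_q), whose span is A_p ⊗ A_q and so
contains 1_p ⊗ 1_q. -/
theorem coprod_one (p q : G) : D.coprod p q (D.one (p * q)) = D.idem p q := by
  have key : ∀ m ∈ Submodule.span ℂ {m | ∃ a ∈ D.comp (p * q), ∃ b ∈ D.comp q,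
      m = D.Δ a * sndLeg b}, D.Δ (D.one (p * q)) * m = m := by
    intro m hm
    induction hm using Submodule.span_induction with
    | mem m hm =>
      obtain ⟨a, ha, b, hb, rfl⟩ := hm
      rw [← mul_assoc, ← map_mul, D.one_mul_of_mem ha]
    | zero => simp
    | add m n _ _ hm hn => rw [mul_add, hm, hn]
    | smul c m _ hm => rw [mul_smul_comm, hm]
  have h := key (toMultiplier (D.idem p q)) (by
    rw [D.cograded.mul_snd]
    exact Submodule.subset_span ⟨_, D.one_mem p, _, D.one_mem q, rfl⟩)
  have h2 := congrArg (fun m => m.left (D.idem p q)) h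
  simpa only [Multiplier.mul_left_apply, toMultiplier_left_apply, idem_mul_idem,
    ← coprod_apply] using h2

/-- Coassociativity with outer factors 1_p and 1_r, applied to 1_p ⊗ 1_q ⊗ 1_r. The intermediate
factors 1_{pq} and 1_{qr} can be inserted freely, because Δ_{p,q} only sees A_{pq}. -/
theorem coprod_coassoc (p q r : G) (a : A) :
    TensorProduct.assoc ℂ A A A (TensorProduct.map (D.coprod p q) LinearMap.id
      (D.coprod (p * q) r a)) =
    TensorProduct.map LinearMap.id (D.coprod q r) (D.coprod p (q * r) a) := by
  obtain ⟨x, hx⟩ := D.regular.hopf.isComultiplication.mul_snd a (D.one r)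
  obtain ⟨y, hy⟩ := D.regular.hopf.isComultiplication.fst_mul (D.one p) a
  have h := congrArg (fun m => m.left (D.one p ⊗ₜ (D.one q ⊗ₜ D.one r)))
    (D.regular.hopf.isComultiplication.coassoc _ _ _ x y hx hy)
  have h1 : ∀ x : A ⊗[ℂ] A, (coprodFst D.Δ x).left (D.one p ⊗ₜ (D.one q ⊗ₜ D.one r)) =
      TensorProduct.assoc ℂ A A A (TensorProduct.map (D.coprod p q) LinearMap.id
        (x * D.idem (p * q) r)) := by
    intro x
    induction x with
    | zero => simp only [map_zero, zero_mul]; rfl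
    | add x x' hx hx' => rw [add_mul, map_add, map_add, map_add, ← hx, ← hx']; rfl
    | tmul b c =>
      rw [coprodFst_left_tmul, idem, Algebra.TensorProduct.tmul_mul_tmul, TensorProduct.map_tmul,
        ← D.one_comm (p * q), ← proj_apply, coprod_proj]
      rfl
  have h2 : ∀ y : A ⊗[ℂ] A, (coprodSnd D.Δ y).left (D.one p ⊗ₜ (D.one q ⊗ₜ D.one r)) =
      TensorProduct.map LinearMap.id (D.coprod q r) (y * D.idem p (q * r)) := by
    intro y
    induction y with
    | zero => simp only [map_zero, zero_mul]; rfl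
    | add x x' hx hx' => rw [add_mul, map_add, map_add, ← hx, ← hx']; rfl
    | tmul b c =>
      rw [coprodSnd_left_tmul, idem, Algebra.TensorProduct.tmul_mul_tmul, TensorProduct.map_tmul,
        ← D.one_comm (q * r), ← proj_apply, coprod_proj]
      rfl
  have h3 : ∀ w : A ⊗[ℂ] A, (tmulMultiplier (toMultiplier (D.one p))
      (1 : Multiplier (A ⊗[ℂ] A))).left (TensorProduct.assoc ℂ A A A
        (TensorProduct.map (D.coprod p q) LinearMap.id w)) =
      TensorProduct.assoc ℂ A A A (TensorProduct.map (D.coprod p q) LinearMap.id w) := by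
    intro w
    induction w with
    | zero => simp
    | add x x' hx hx' => rw [map_add, map_add, map_add, hx, hx']
    | tmul b c =>
      have : ∀ z : A ⊗[ℂ] A, (tmulMultiplier (toMultiplier (D.one p))
        (1 : Multiplier (A ⊗[ℂ] A))).left (TensorProduct.assoc ℂ A A A (z ⊗ₜ c)) =
          TensorProduct.assoc ℂ A A A (((fstLeg (D.one p)).left z) ⊗ₜ c) := by
        intro z
        induction z with
        | zero => simp
        | add x x' hx hx' => rw [TensorProduct.add_tmul, map_add, map_add, hx, hx', map_add,
            TensorProduct.add_tmul, map_add]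
        | tmul b d => rfl
      rw [TensorProduct.map_tmul, LinearMap.id_apply, this, fstLeg_left_coprod,
        ← idem, idem_mul_coprod]
  simp only [Multiplier.mul_left_apply] at h
  rw [h1, h3] at h
  have h4 : (tmulMultiplier (1 : Multiplier A) (sndLeg (D.one r))).left
      (D.one p ⊗ₜ (D.one q ⊗ₜ D.one r)) = D.one p ⊗ₜ (D.one q ⊗ₜ D.one r) := by
    rw [tmulMultiplier_left_tmul, sndLeg_left_tmul, D.one_mul_one]; rfl
  rw [h4, h2, D.mul_idem_of_mul_sndLeg hx, D.mul_idem_of_fstLeg_mul hy, ← idem, ← idem,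
    coprod_mul_idem, idem_mul_coprod] at h
  exact h

/-- The bijection `a ⊗ b ↦ (a ⊗ 1)Δ(b)`, in components. -/
theorem exists_fst_mul_equiv : ∃ T : A ⊗[ℂ] A ≃ₗ[ℂ] A ⊗[ℂ] A, ∀ a b p q,
    T (a ⊗ₜ b) * D.idem p q = (a ⊗ₜ D.one q) * D.coprod p q b := by
  obtain ⟨T, hT⟩ := D.regular.hopf.bijective_snd
  exact ⟨T, fun a b p q => D.mul_idem_of_fstLeg_mul (hT a b) p q⟩

/-- The bijection `a ⊗ b ↦ (1 ⊗ a)Δ(b)` followed by the flip, in components. -/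
theorem exists_snd_mul_equiv : ∃ T : A ⊗[ℂ] A ≃ₗ[ℂ] A ⊗[ℂ] A, ∀ a b p q,
    T (a ⊗ₜ b) * D.idem p q = (a ⊗ₜ D.one q) * TensorProduct.comm ℂ A A (D.coprod q p b) := by
  -- This is where regularity enters. It is the source of the right unit of the dual and of the
  -- bijectivity of the antipode.
  obtain ⟨T, hT⟩ := D.regular.hopf_coopposite.bijective_snd
  refine ⟨T, fun a b p q => ?_⟩
  rw [← toMultiplier_left_apply, hT, Multiplier.mul_left_apply, coopposite_left_apply]
  have h1 : TensorProduct.comm ℂ A A (D.idem p q) = D.idem q p := rfl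
  rw [h1, ← coprod_apply, ← idem_mul_coprod, comm_mul, Multiplier.left_mul, ← mul_assoc]
  congr 1
  simp [idem, fstLeg_left_tmul, D.one_mul_one]

end CogradedUnital

end

end MultiplierHopf

/-! ### The reduced dual, its grading and its coalgebra structure. -/

namespace MultiplierHopf

noncomputable section

section Pairing

variable {U U' V V' : Type*} [AddCommGroup U] [Module ℂ U] [AddCommGroup U'] [Module ℂ U']
  [AddCommGroup V] [Module ℂ V] [AddCommGroup V'] [Module ℂ V']

/-- The tensor product of two spaces of functionals is a space of functionals. -/
theorem dualDistrib_comp_map_injective {i : U →ₗ[ℂ] Module.Dual ℂ V}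
    {i' : U' →ₗ[ℂ] Module.Dual ℂ V'} (hi : Function.Injective i) (hi' : Function.Injective i') :
    Function.Injective (TensorProduct.dualDistrib ℂ V V' ∘ₗ TensorProduct.map i i') := by
  classical
  rw [injective_iff_map_eq_zero]
  intro z hz
  -- Write z = ∑ b_k ⊗ c_k. For fixed v', injectivity of i turns the vanishing of the functional
  -- into ∑ i'(c_k)(v') b_k = 0, so every i'(c_k)(v') vanishes.
  let b := Module.Basis.ofVectorSpace ℂ U
  obtain ⟨c, rfl⟩ := TensorProduct.eq_repr_basis_left b z
  have h0 : c = 0 := by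
    ext k
    apply hi'
    ext v'
    have h1 : i (c.sum fun k u => i' u v' • b k) = 0 := by
      ext v
      have := LinearMap.congr_fun hz (v ⊗ₜ v')
      simpa [Finsupp.sum, map_sum, LinearMap.sum_apply, mul_comm] using this
    have h2 : c.sum (fun k u => i' u v' • b k) = 0 := hi (by rw [h1, map_zero])
    have h3 := congrArg (fun u => b.repr u k) h2
    by_cases hk : c k = 0
    · simp [hk]
    · have h4 : ¬c k = 0 → i' (c k) v' = 0 := by
        simpa [Finsupp.sum, map_sum, Finsupp.single_apply] using h3
      simpa using h4 hk
  simp [h0]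

theorem evalTensor_eq_dualDistrib {B : Type*} [NonUnitalRing B] [Module ℂ B] [IsScalarTower ℂ B B]
    [SMulCommClass ℂ B B] (f g : Module.Dual ℂ B) :
    evalTensor f g = TensorProduct.dualDistrib ℂ B B (f ⊗ₜ g) := by
  ext; simp [evalTensor]

end Pairing

namespace CogradedUnital

variable {G : Type v} [Group G] {A : Type u} [NonUnitalRing A] [Module ℂ A]
  [IsScalarTower ℂ A A] [SMulCommClass ℂ A A] (D : CogradedUnital G A)

/-- The reduced dual `⨁ A_p'` as a type. -/
def RedDual : Type u := reducedDual D.comp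

instance : AddCommGroup D.RedDual := inferInstanceAs (AddCommGroup (reducedDual D.comp))

instance : Module ℂ D.RedDual := inferInstanceAs (Module ℂ (reducedDual D.comp))

/-- The inclusion of the reduced dual in the dual. -/
def toDual : D.RedDual →ₗ[ℂ] Module.Dual ℂ A := (reducedDual D.comp).subtype

theorem toDual_injective : Function.Injective D.toDual := Subtype.val_injective

theorem range_toDual : LinearMap.range D.toDual = reducedDual D.comp := Submodule.range_subtype _

/-- The component `A_p'` of the reduced dual. -/
def homog (p : G) : Submodule ℂ D.RedDual := (componentDual D.comp p).comap D.toDual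

theorem comp_proj_mem (p : G) (f : Module.Dual ℂ A) :
    f ∘ₗ D.proj p ∈ componentDual D.comp p := fun q hq a ha => by
  simp [D.proj_of_ne (Ne.symm hq) ha]

/-- The restriction of a functional to `A_p`, as an element of the reduced dual. -/
def restrict (p : G) : Module.Dual ℂ A →ₗ[ℂ] D.RedDual :=
  LinearMap.codRestrict (reducedDual D.comp) (D.proj p).dualMap
    fun f => (le_iSup (componentDual D.comp) p) (D.comp_proj_mem p f)

theorem toDual_restrict (p : G) (f : Module.Dual ℂ A) (a : A) :
    D.toDual (D.restrict p f) a = f (D.proj p a) := rfl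

theorem restrict_mem (p : G) (f : Module.Dual ℂ A) : D.restrict p f ∈ D.homog p :=
  D.comp_proj_mem p f

theorem toDual_of_ne {p q : G} (h : q ≠ p) {f : D.RedDual} (hf : f ∈ D.homog p) {a : A}
    (ha : a ∈ D.comp q) : D.toDual f a = 0 := hf q h a ha

theorem toDual_proj {p : G} {f : D.RedDual} (hf : f ∈ D.homog p) (a : A) :
    D.toDual f (D.proj p a) = D.toDual f a := by
  refine D.induction (fun q a ha => ?_) (by simp) (fun a b ha hb => by simp [ha, hb]) a
  by_cases h : q = p
  · subst h; rw [D.proj_of_mem ha]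
  · rw [D.proj_of_ne (Ne.symm h) ha, map_zero, D.toDual_of_ne h hf ha]

theorem restrict_toDual {p : G} {f : D.RedDual} (hf : f ∈ D.homog p) :
    D.restrict p (D.toDual f) = f :=
  D.toDual_injective (LinearMap.ext fun a => D.toDual_proj hf a)

theorem restrict_toDual_of_ne {p q : G} (h : p ≠ q) {f : D.RedDual} (hf : f ∈ D.homog q) :
    D.restrict p (D.toDual f) = 0 :=
  D.toDual_injective (LinearMap.ext fun a => by
    rw [toDual_restrict, D.toDual_of_ne h hf (D.proj_mem p a)]; simp)

@[elab_as_elim]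
theorem dual_induction {P : D.RedDual → Prop} (hom : ∀ p, ∀ f ∈ D.homog p, P f) (zero : P 0)
    (add : ∀ f g, P f → P g → P (f + g)) (f : D.RedDual) : P f := by
  obtain ⟨f, hf⟩ := f
  induction hf using Submodule.iSup_induction' with
  | mem p f hf => exact hom p ⟨f, _⟩ hf
  | zero => exact zero
  | add f g _ _ hf hg => exact add _ _ hf hg

theorem dual_hom_ext {N : Type*} [AddCommGroup N] [Module ℂ N] {L L' : D.RedDual →ₗ[ℂ] N}
    (h : ∀ p, ∀ f ∈ D.homog p, L f = L' f) : L = L' := by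
  ext f
  refine D.dual_induction h (by simp) (fun f g hf hg => by simp [hf, hg]) f

theorem exists_finset_sum_restrict (f : D.RedDual) :
    ∃ F : Finset G, ∀ F', F ⊆ F' → ∑ p ∈ F', D.restrict p (D.toDual f) = f := by
  classical
  refine D.dual_induction (fun q f hf => ⟨{q}, fun F' hF' => ?_⟩) ⟨∅, by simp⟩ ?_ f
  · rw [Finset.sum_eq_single q, D.restrict_toDual hf]
    · intro p _ hp; exact D.restrict_toDual_of_ne hp hf
    · intro h; exact absurd (hF' (Finset.mem_singleton_self q)) h
  · rintro a b ⟨F, hF⟩ ⟨F₁, hF₁⟩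
    refine ⟨F ∪ F₁, fun F' h => ?_⟩
    simp only [map_add, Finset.sum_add_distrib]
    rw [hF _ (Finset.union_subset_left h), hF₁ _ (Finset.union_subset_right h)]

theorem eq_zero_of_proj {a : A} (h : ∀ p, D.proj p a = 0) : a = 0 := by
  obtain ⟨F, hF⟩ := D.exists_finset_sum_proj a
  rw [← hF F subset_rfl]
  exact Finset.sum_eq_zero fun p _ => h p

theorem dual_eq_zero {f : D.RedDual} (h : ∀ p, D.restrict p (D.toDual f) = 0) : f = 0 := by
  obtain ⟨F, hF⟩ := D.exists_finset_sum_restrict f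
  rw [← hF F subset_rfl]
  exact Finset.sum_eq_zero fun p _ => h p

/-- The reduced dual separates the points of `A`. -/
theorem toDual_flip_injective : Function.Injective D.toDual.flip := by
  rw [injective_iff_map_eq_zero]
  intro a ha
  refine D.eq_zero_of_proj fun p => ?_
  rw [← Module.forall_dual_apply_eq_zero_iff ℂ]
  intro g
  exact LinearMap.congr_fun ha (D.restrict p g)

theorem ext_toDual {a b : A} (h : ∀ p, ∀ f ∈ D.homog p, D.toDual f a = D.toDual f b) : a = b :=
  D.toDual_flip_injective (D.dual_hom_ext h)

theorem mem_comp_of_toDual {p : G} {a : A}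
    (h : ∀ q, q ≠ p → ∀ f ∈ D.homog q, D.toDual f a = 0) : a ∈ D.comp p := by
  have : a = D.proj p a := D.ext_toDual fun q f hf => by
    by_cases hq : q = p
    · subst hq; rw [D.toDual_proj hf]
    · rw [h q hq f hf, D.toDual_of_ne (Ne.symm hq) hf (D.proj_mem p a)]
  rw [this]
  exact D.proj_mem p a

/-- A functional in A_p' that is also a sum of functionals from other components vanishes on A_p as
well as on every other A_q. -/
theorem iSupIndep_componentDual : iSupIndep (componentDual D.comp) := by
  rw [iSupIndep_def]
  intro p
  rw [Submodule.disjoint_def]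
  intro f hf hf'
  have h1 : ∀ a ∈ D.comp p, f a = 0 := by
    intro a ha
    have : (⨆ q, ⨆ (_ : q ≠ p), componentDual D.comp q) ≤
        LinearMap.ker (Module.Dual.eval ℂ A a) := by
      refine iSup₂_le fun q hq g hg => ?_
      exact hg p (Ne.symm hq) a ha
    exact this hf'
  ext a
  refine D.induction (fun q a ha => ?_) (by simp) (fun a b ha hb => by simp [ha, hb]) a
  by_cases h : q = p
  · subst h; exact h1 a ha
  · exact hf q h a ha

/-- The components of an element of the reduced dual, as a finitely supported function. -/
def decomp : D.RedDual →ₗ[ℂ] (G →₀ D.RedDual) where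
  toFun f := Finsupp.ofSupportFinite (fun p => D.restrict p (D.toDual f)) (by
    classical
    obtain ⟨F, hF⟩ := D.exists_finset_sum_restrict f
    refine F.finite_toSet.subset fun p hp => ?_
    by_contra hpF
    refine hp ?_
    have h : ∑ q ∈ insert p F, D.restrict q (D.toDual f) = f := hF _ (Finset.subset_insert _ _)
    rwa [Finset.sum_insert (by simpa using hpF), hF F subset_rfl, add_eq_right] at h)
  map_add' f g := by ext p : 1; simp [Finsupp.ofSupportFinite_coe]
  map_smul' c f := by ext p : 1; simp [Finsupp.ofSupportFinite_coe]

theorem decomp_of_mem {p : G} {f : D.RedDual} (hf : f ∈ D.homog p) :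
    D.decomp f = Finsupp.single p f := by
  classical
  ext q : 1
  change D.restrict q (D.toDual f) = _
  by_cases h : q = p
  · subst h; rw [D.restrict_toDual hf, Finsupp.single_eq_same]
  · rw [D.restrict_toDual_of_ne h hf, Finsupp.single_eq_of_ne h]

/-- The linear map on the reduced dual with given restrictions to the components. -/
def glue {N : Type*} [AddCommGroup N] [Module ℂ N] :
    (G → (D.RedDual →ₗ[ℂ] N)) →ₗ[ℂ] (D.RedDual →ₗ[ℂ] N) where
  toFun F := Finsupp.lsum ℂ F ∘ₗ D.decomp
  map_add' F F' := by ext f; simp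
  map_smul' c F := by ext f; simp [Finsupp.smul_sum]

theorem glue_of_mem {N : Type*} [AddCommGroup N] [Module ℂ N] (F : G → (D.RedDual →ₗ[ℂ] N))
    {p : G} {f : D.RedDual} (hf : f ∈ D.homog p) : D.glue F f = F p f := by
  change Finsupp.lsum ℂ F (D.decomp f) = _
  rw [D.decomp_of_mem hf]
  simp

/-! ### The coalgebra structure -/

/-- `A^* ⊗ A^*` as a space of functionals on `A ⊗ A`. -/
def pair : D.RedDual ⊗[ℂ] D.RedDual →ₗ[ℂ] Module.Dual ℂ (A ⊗[ℂ] A) :=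
  TensorProduct.dualDistrib ℂ A A ∘ₗ TensorProduct.map D.toDual D.toDual

theorem pair_tmul (f g : D.RedDual) (a b : A) :
    D.pair (f ⊗ₜ g) (a ⊗ₜ b) = D.toDual f a * D.toDual g b := rfl

theorem pair_injective : Function.Injective D.pair :=
  dualDistrib_comp_map_injective D.toDual_injective D.toDual_injective

theorem pair_tmul_eq_evalTensor (f g : D.RedDual) :
    D.pair (f ⊗ₜ g) = evalTensor (D.toDual f) (D.toDual g) := by
  rw [evalTensor_eq_dualDistrib]; rfl

/-- A basis of `A_p` together with the dual basis. -/
theorem exists_dual_basis (p : G) : ∃ (n : ℕ) (x : Fin n → D.RedDual) (b : Fin n → A),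
    (∀ i, x i ∈ D.homog p) ∧ ∀ a, D.proj p a = ∑ i, D.toDual (x i) a • b i := by
  have := D.finite p
  let b := Module.finBasis ℂ (D.comp p)
  let π : A →ₗ[ℂ] D.comp p :=
    LinearMap.codRestrict (D.comp p).toSubmodule (D.proj p) (D.proj_mem p)
  have hπ : ∀ a, (π a : A) = D.proj p a := fun _ => rfl
  refine ⟨_, fun i => D.restrict p (b.coord i ∘ₗ π), fun i => (b i : A),
    fun i => D.restrict_mem p _, fun a => ?_⟩
  have h := congrArg Subtype.val (b.sum_repr (π (D.proj p a)))
  rw [hπ, D.proj_of_mem (D.proj_mem p a)] at h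
  refine h.symm.trans ?_
  simp [-Module.Basis.sum_repr, toDual_restrict]

/-- A functional on `A_p ⊗ A_q` is an element of `A_p' ⊗ A_q'`. -/
theorem exists_pair_eq (p q : G) {ω : Module.Dual ℂ (A ⊗[ℂ] A)}
    (hω : ω ∘ₗ TensorProduct.map (D.proj p) (D.proj q) = ω) :
    ∃ X ∈ LinearMap.range (TensorProduct.mapIncl (D.homog p) (D.homog q)), D.pair X = ω := by
  obtain ⟨n, x, b, hx, hb⟩ := D.exists_dual_basis p
  -- Only the first leg is expanded in the dual basis: ω(a ⊗ c) = ∑ x_i(a) ω(b_i ⊗ c).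
  let y : Fin n → D.RedDual := fun i => D.restrict q (ω ∘ₗ TensorProduct.mk ℂ A A (b i))
  have hy : ∀ i, y i ∈ D.homog q := fun i => D.restrict_mem q _
  refine ⟨∑ i, x i ⊗ₜ y i, Submodule.sum_mem _ fun i _ => ⟨⟨x i, hx i⟩ ⊗ₜ ⟨y i, hy i⟩, rfl⟩, ?_⟩
  refine TensorProduct.ext' fun a c => ?_
  have h1 : ω (a ⊗ₜ c) = ω (D.proj p a ⊗ₜ D.proj q c) := (LinearMap.congr_fun hω (a ⊗ₜ c)).symm
  rw [h1, hb]
  simp [TensorProduct.sum_tmul, ← TensorProduct.smul_tmul', pair_tmul, y, toDual_restrict]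

theorem mul'_comp_map_proj (p : G) (f : D.RedDual) (hf : f ∈ D.homog p) :
    (D.toDual f ∘ₗ LinearMap.mul' ℂ A) ∘ₗ TensorProduct.map (D.proj p) (D.proj p) =
      D.toDual f ∘ₗ LinearMap.mul' ℂ A := by
  ext a b
  have : D.proj p a * D.proj p b = D.proj p (a * b) := by
    simp only [proj_apply]
    rw [D.one_comm p a, mul_assoc, ← mul_assoc (D.one p) (D.one p), D.one_mul_one,
      ← mul_assoc, ← D.one_comm, mul_assoc]
  simp [this, D.toDual_proj hf]

theorem exists_pair_eq_mul' (f : D.RedDual) :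
    ((LinearMap.mul' ℂ A).dualMap ∘ₗ D.toDual) f ∈ LinearMap.range D.pair := by
  refine D.dual_induction (fun p f hf => ?_) (by simp) (fun f g hf hg => ?_) f
  · obtain ⟨X, -, hX⟩ := D.exists_pair_eq p p (D.mul'_comp_map_proj p f hf)
    exact ⟨X, hX⟩
  · rw [map_add]; exact add_mem hf hg

/-- The coproduct is the transposed product of A, pulled back through the injective `pair`. The
counit is glued from the evaluations at 1_p, since A need not contain a global identity at which to
evaluate. -/
instance : CoalgebraStruct ℂ D.RedDual where
  comul := (LinearEquiv.ofInjective D.pair D.pair_injective).symm.toLinearMap ∘ₗ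
    LinearMap.codRestrict (LinearMap.range D.pair) ((LinearMap.mul' ℂ A).dualMap ∘ₗ D.toDual)
      D.exists_pair_eq_mul'
  counit := D.glue fun p => D.toDual.flip (D.one p)

open Coalgebra

theorem pair_comul (f : D.RedDual) : D.pair (comul (R := ℂ) f) = D.toDual f ∘ₗ LinearMap.mul' ℂ A :=
  congrArg Subtype.val (LinearEquiv.apply_symm_apply
    (LinearEquiv.ofInjective D.pair D.pair_injective)
    (⟨_, D.exists_pair_eq_mul' f⟩ : LinearMap.range D.pair))

theorem pair_comul_tmul (f : D.RedDual) (a b : A) :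
    D.pair (comul (R := ℂ) f) (a ⊗ₜ b) = D.toDual f (a * b) := by
  rw [pair_comul]; simp

theorem counit_of_mem {p : G} {f : D.RedDual} (hf : f ∈ D.homog p) :
    counit (R := ℂ) f = D.toDual f (D.one p) := D.glue_of_mem _ hf

theorem comul_mem {p : G} {f : D.RedDual} (hf : f ∈ D.homog p) :
    comul (R := ℂ) f ∈ LinearMap.range (TensorProduct.mapIncl (D.homog p) (D.homog p)) := by
  obtain ⟨X, hX, h⟩ := D.exists_pair_eq p p (D.mul'_comp_map_proj p f hf)
  rw [← D.pair_comul] at h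
  rwa [← D.pair_injective h]

/-- Sweedler notation with homogeneous legs. Later computations with f₁ ⊗ f₂ go through such a sum
because the product and the counit are explicit only on homogeneous elements. -/
theorem exists_comul_eq_sum {p : G} {f : D.RedDual} (hf : f ∈ D.homog p) :
    ∃ (n : ℕ) (x y : Fin n → D.RedDual), (∀ i, x i ∈ D.homog p) ∧ (∀ i, y i ∈ D.homog p) ∧
      comul (R := ℂ) f = ∑ i, x i ⊗ₜ y i := by
  obtain ⟨X, hX⟩ := D.comul_mem hf
  obtain ⟨S, hS⟩ := TensorProduct.exists_finset X
  let e := S.equivFin.symm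
  refine ⟨S.card, fun i => (e i).1.1, fun i => (e i).1.2, fun i => (e i).1.1.2,
    fun i => (e i).1.2.2, ?_⟩
  rw [← hX, hS, map_sum, ← Finset.sum_coe_sort S, ← e.sum_comp]
  rfl

/-- `A^* ⊗ A^* ⊗ A^*` as a space of functionals on `A ⊗ A ⊗ A`. -/
def pairThree : D.RedDual ⊗[ℂ] (D.RedDual ⊗[ℂ] D.RedDual) →ₗ[ℂ]
    Module.Dual ℂ (A ⊗[ℂ] (A ⊗[ℂ] A)) :=
  TensorProduct.dualDistrib ℂ A (A ⊗[ℂ] A) ∘ₗ TensorProduct.map D.toDual D.pair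

theorem pairThree_injective : Function.Injective D.pairThree :=
  dualDistrib_comp_map_injective D.toDual_injective D.pair_injective

theorem pairThree_lTensor_comul (X : D.RedDual ⊗[ℂ] D.RedDual) (a b c : A) :
    D.pairThree (comul.lTensor _ X) (a ⊗ₜ (b ⊗ₜ c)) = D.pair X (a ⊗ₜ (b * c)) := by
  induction X with
  | zero => simp
  | add X Y hX hY => simp only [map_add, LinearMap.add_apply, hX, hY]
  | tmul f g =>
    change D.toDual f a * D.pair (comul g) (b ⊗ₜ c) = _
    rw [pair_comul_tmul, pair_tmul]

theorem pairThree_rTensor_comul (X : D.RedDual ⊗[ℂ] D.RedDual) (a b c : A) :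
    D.pairThree (TensorProduct.assoc ℂ _ _ _ (comul.rTensor _ X)) (a ⊗ₜ (b ⊗ₜ c)) =
      D.pair X ((a * b) ⊗ₜ c) := by
  induction X with
  | zero => simp
  | add X Y hX hY => simp only [map_add, LinearMap.add_apply, hX, hY]
  | tmul f g =>
    have : ∀ Y : D.RedDual ⊗[ℂ] D.RedDual, D.pairThree (TensorProduct.assoc ℂ _ _ _ (Y ⊗ₜ g))
        (a ⊗ₜ (b ⊗ₜ c)) = D.pair Y (a ⊗ₜ b) * D.toDual g c := by
      intro Y
      induction Y with
      | zero => simp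
      | add X Y hX hY => simp only [map_add, LinearMap.add_apply, hX, hY, TensorProduct.add_tmul,
          add_mul]
      | tmul h k => exact (mul_assoc _ _ _).symm
    rw [LinearMap.rTensor_tmul, this, pair_comul_tmul, pair_tmul]

instance : Coalgebra ℂ D.RedDual where
  coassoc := by
    ext f
    apply D.pairThree_injective
    ext a b c
    simp only [LinearMap.coe_comp, Function.comp_apply, LinearEquiv.coe_coe,
      TensorProduct.AlgebraTensorModule.curry_apply, LinearMap.restrictScalars_self,
      TensorProduct.curry_apply]
    rw [pairThree_lTensor_comul, pairThree_rTensor_comul, pair_comul_tmul, pair_comul_tmul,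
      mul_assoc]
  rTensor_counit_comp_comul := by
    refine D.dual_hom_ext fun p f hf => ?_
    obtain ⟨n, x, y, hx, hy, h⟩ := D.exists_comul_eq_sum hf
    apply (TensorProduct.lid ℂ _).injective
    apply D.toDual_injective
    ext b
    -- All legs of the coproduct of f lie in A_p', so there the counit is evaluation at 1_p. The
    -- counit axiom becomes f(1_p b) = f(b).
    have := D.pair_comul_tmul f (D.one p) b
    rw [← proj_apply, D.toDual_proj hf] at this
    rw [LinearMap.comp_apply, h]
    rw [h] at this
    simpa [D.counit_of_mem (hx _), pair_tmul] using this
  lTensor_counit_comp_comul := by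
    refine D.dual_hom_ext fun p f hf => ?_
    obtain ⟨n, x, y, hx, hy, h⟩ := D.exists_comul_eq_sum hf
    apply (TensorProduct.rid ℂ _).injective
    apply D.toDual_injective
    ext b
    have := D.pair_comul_tmul f b (D.one p)
    rw [← D.one_comm, ← proj_apply, D.toDual_proj hf] at this
    rw [LinearMap.comp_apply, h]
    rw [h] at this
    simpa [D.counit_of_mem (hy _), pair_tmul, mul_comm] using this

end CogradedUnital

end

end MultiplierHopf

namespace MultiplierHopf

noncomputable section

open Coalgebra

/-! ### Galois maps -/

section Galois

variable {H : Type u} [AddCommGroup H] [Module ℂ H] [Coalgebra ℂ H] (μ : H →ₗ[ℂ] H →ₗ[ℂ] H)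

/-- The Galois map `h ⊗ g ↦ h₁ ⊗ h₂ g` of a coalgebra with a product `μ`. -/
def galois : H ⊗[ℂ] H →ₗ[ℂ] H ⊗[ℂ] H :=
  (TensorProduct.lift μ).lTensor H ∘ₗ (TensorProduct.assoc ℂ H H H).toLinearMap ∘ₗ
    comul.rTensor H

theorem galois_tmul (h g : H) : galois μ (h ⊗ₜ g) = (μ.flip g).lTensor H (comul h) := by
  simp only [galois, LinearMap.comp_apply, LinearMap.rTensor_tmul, LinearEquiv.coe_coe]
  generalize (comul h : H ⊗[ℂ] H) = X
  induction X with
  | zero => simp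
  | add X Y hX hY => simp only [TensorProduct.add_tmul, map_add, hX, hY]
  | tmul x y => simp

theorem lid_counit_lTensor {N : Type*} [AddCommGroup N] [Module ℂ N] (L : H →ₗ[ℂ] N)
    (X : H ⊗[ℂ] H) : TensorProduct.lid ℂ N (counit.rTensor N (L.lTensor H X)) =
      L (TensorProduct.lid ℂ H (counit.rTensor H X)) := by
  induction X with
  | zero => simp
  | add X Y hX hY => simp only [map_add, hX, hY]
  | tmul x y => simp

/-- The counit on the first leg recovers the product from the Galois map: ε(h₁)h₂g = hg. -/
theorem lid_counit_galois (X : H ⊗[ℂ] H) :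
    TensorProduct.lid ℂ H (counit.rTensor H (galois μ X)) = TensorProduct.lift μ X := by
  induction X with
  | zero => simp
  | add X Y hX hY => simp only [map_add, hX, hY]
  | tmul x y => simp [galois_tmul, lid_counit_lTensor]

variable {μ}

theorem galois_lTensor_flip (hμ : ∀ x y z, μ (μ x y) z = μ x (μ y z)) (k : H) (X : H ⊗[ℂ] H) :
    galois μ ((μ.flip k).lTensor H X) = (μ.flip k).lTensor H (galois μ X) := by
  induction X with
  | zero => simp
  | add X Y hX hY => simp only [map_add, hX, hY]
  | tmul x y =>
    rw [LinearMap.lTensor_tmul, galois_tmul, galois_tmul,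
      ← LinearMap.lTensor_comp_apply]
    congr 2
    ext z
    simp [hμ]

/-- A product with bijective Galois map has a left unit. -/
theorem exists_left_unit (hμ : ∀ x y z, μ (μ x y) z = μ x (μ y z))
    (hb : Function.Bijective (galois μ)) (hε : ∃ h : H, counit (R := ℂ) h = 1) :
    ∃ e, ∀ k, μ e k = k := by
  obtain ⟨h, hh⟩ := hε
  -- In a unital algebra X would be h ⊗ 1. In general X(1 ⊗ k) and h ⊗ k have the same image h₁ ⊗
  -- h₂k, so they agree. Applying ε ⊗ ι then shows that (ε ⊗ ι)(X) is a left unit.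
  obtain ⟨X, hX⟩ := hb.2 (comul h)
  refine ⟨TensorProduct.lid ℂ H (counit.rTensor H X), fun k => ?_⟩
  have h1 : (μ.flip k).lTensor H X = h ⊗ₜ k := hb.1 (by
    rw [galois_lTensor_flip hμ, hX, galois_tmul])
  rw [← μ.flip_apply, ← lid_counit_lTensor, h1]
  simp [hh]

/-- The antipode associated to a bijective Galois map and an element `e`. -/
def galoisAntipode (hb : Function.Bijective (galois μ)) (e : H) : H →ₗ[ℂ] H :=
  (TensorProduct.lid ℂ H).toLinearMap ∘ₗ counit.rTensor H ∘ₗ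
    (LinearEquiv.ofBijective (galois μ) hb).symm.toLinearMap ∘ₗ (TensorProduct.mk ℂ H H).flip e

/-- Colinearity of the Galois map Γ for the left coaction on the first leg. It is coassociativity,
and it passes to the inverse of Γ. -/
theorem galois_comul (X : H ⊗[ℂ] H) :
    (galois μ).lTensor H (TensorProduct.assoc ℂ H H H (comul.rTensor H X)) =
      TensorProduct.assoc ℂ H H H (comul.rTensor H (galois μ X)) := by
  induction X with
  | zero => simp
  | add X Y hX hY => simp only [map_add, hX, hY]
  | tmul h g =>
    have h1 : ∀ Y : H ⊗[ℂ] H, (galois μ).lTensor H (TensorProduct.assoc ℂ H H H (Y ⊗ₜ g)) =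
        ((μ.flip g).lTensor H).lTensor H (comul.lTensor H Y) := by
      intro Y
      induction Y with
      | zero => simp
      | add X Y hX hY => simp only [TensorProduct.add_tmul, map_add, hX, hY]
      | tmul x y => simp [galois_tmul]
    have h2 : ∀ Y : H ⊗[ℂ] H, TensorProduct.assoc ℂ H H H
        (comul.rTensor H ((μ.flip g).lTensor H Y)) =
        ((μ.flip g).lTensor H).lTensor H (TensorProduct.assoc ℂ H H H (comul.rTensor H Y)) := by
      intro Y
      induction Y with
      | zero => simp
      | add X Y hX hY => simp only [map_add, hX, hY]
      | tmul x y =>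
        simp only [LinearMap.lTensor_tmul, LinearMap.rTensor_tmul]
        generalize (comul x : H ⊗[ℂ] H) = Z
        induction Z with
        | zero => simp
        | add X Y hX hY => simp only [TensorProduct.add_tmul, map_add, hX, hY]
        | tmul x y => simp
    rw [LinearMap.rTensor_tmul, h1, galois_tmul, h2, coassoc_apply]

theorem lTensor_lid_counit_assoc_comul (X : H ⊗[ℂ] H) :
    ((TensorProduct.lid ℂ H).toLinearMap ∘ₗ counit.rTensor H).lTensor H
      (TensorProduct.assoc ℂ H H H (comul.rTensor H X)) = X := by
  induction X with
  | zero => simp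
  | add X Y hX hY => simp only [map_add, hX, hY]
  | tmul h g =>
    have h1 : ∀ Y : H ⊗[ℂ] H, ((TensorProduct.lid ℂ H).toLinearMap ∘ₗ counit.rTensor H).lTensor H
        (TensorProduct.assoc ℂ H H H (Y ⊗ₜ g)) =
        TensorProduct.rid ℂ H (counit.lTensor H Y) ⊗ₜ g := by
      intro Y
      induction Y with
      | zero => simp
      | add X Y hX hY => simp only [TensorProduct.add_tmul, map_add, hX, hY]
      | tmul x y => simp [TensorProduct.smul_tmul]
    rw [LinearMap.rTensor_tmul, h1]
    simp

/-- With S(h) = (ε ⊗ ι)Γ⁻¹(h ⊗ e), colinearity of Γ⁻¹ determines it from S: Γ⁻¹(h ⊗ e) = h₁ ⊗ S(h₂).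
-/
theorem galois_lTensor_galoisAntipode (hb : Function.Bijective (galois μ)) (e h : H) :
    galois μ ((galoisAntipode hb e).lTensor H (comul h)) = h ⊗ₜ e := by
  let B := LinearEquiv.ofBijective (galois μ) hb
  have hB : ∀ X, galois μ (B.symm X) = X := fun X => B.apply_symm_apply X
  have h1 := galois_comul (μ := μ) (B.symm (h ⊗ₜ e))
  rw [hB] at h1
  have h2 := congrArg (B.symm.toLinearMap.lTensor H) h1
  rw [← LinearMap.comp_apply, ← LinearMap.lTensor_comp] at h2
  have h3 : B.symm.toLinearMap ∘ₗ galois μ = LinearMap.id :=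
    LinearMap.ext fun X => B.symm_apply_apply X
  rw [h3, LinearMap.lTensor_id, LinearMap.id_apply] at h2
  have h4 := congrArg (((TensorProduct.lid ℂ H).toLinearMap ∘ₗ counit.rTensor H).lTensor H) h2
  rw [lTensor_lid_counit_assoc_comul] at h4
  have h5 : ((TensorProduct.lid ℂ H).toLinearMap ∘ₗ counit.rTensor H).lTensor H
      (B.symm.toLinearMap.lTensor H (TensorProduct.assoc ℂ H H H (comul.rTensor H (h ⊗ₜ e)))) =
      (galoisAntipode hb e).lTensor H (comul h) := by
    rw [LinearMap.rTensor_tmul]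
    generalize (comul h : H ⊗[ℂ] H) = Y
    induction Y with
    | zero => simp
    | add X Y hX hY => simp only [TensorProduct.add_tmul, map_add, hX, hY]
    | tmul x y => simp [galoisAntipode, B]
  rw [← h5, ← h4, hB]

theorem lift_lTensor_galoisAntipode (hb : Function.Bijective (galois μ)) (e h : H) :
    TensorProduct.lift μ ((galoisAntipode hb e).lTensor H (comul h)) = counit (R := ℂ) h • e := by
  rw [← lid_counit_galois, galois_lTensor_galoisAntipode]
  simp

/-- By coassociativity both sides are h₁ ⊗ h₂g(h₃). Thus injectivity of Γ makes convolution by the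
identity on the left injective. -/
theorem galois_lTensor_comul (g : H →ₗ[ℂ] H) (h : H) :
    galois μ (g.lTensor H (comul h)) =
      (TensorProduct.lift μ ∘ₗ g.lTensor H ∘ₗ comul).lTensor H (comul h) := by
  have h1 : ∀ X : H ⊗[ℂ] H, galois μ (g.lTensor H X) =
      (TensorProduct.lift μ ∘ₗ g.lTensor H).lTensor H
        (TensorProduct.assoc ℂ H H H (comul.rTensor H X)) := by
    intro X
    induction X with
    | zero => simp
    | add X Y hX hY => simp only [map_add, hX, hY]
    | tmul x y =>
      rw [LinearMap.lTensor_tmul, galois_tmul, LinearMap.rTensor_tmul]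
      generalize (comul x : H ⊗[ℂ] H) = Y
      induction Y with
      | zero => simp
      | add X Y hX hY => simp only [TensorProduct.add_tmul, map_add, hX, hY]
      | tmul x y => simp
  rw [h1, coassoc_apply, ← LinearMap.comp_apply, ← LinearMap.lTensor_comp]
  rfl

end Galois

/-! ### From a bijective Galois map to a Hopf algebra. -/

section HopfOfGalois

variable {H : Type u} [Ring H] [Bialgebra ℂ H]

open WithConv

theorem convMul_apply_eq (f g : H →ₗ[ℂ] H) (h : H) : (toConv f * toConv g).ofConv h =
    LinearMap.mul' ℂ H (TensorProduct.map f g (comul h)) := rfl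

/-- A bialgebra with bijective Galois map is a Hopf algebra. -/
abbrev hopfOfGalois (hb : Function.Bijective (galois (LinearMap.mul ℂ H))) : HopfAlgebra ℂ H :=
  have h1 : toConv LinearMap.id * toConv (galoisAntipode hb 1) = 1 := by
    ext h
    rw [convMul_apply_eq]
    exact (lift_lTensor_galoisAntipode hb 1 h).trans (by simp [Algebra.smul_def])
  -- So far S is only a right convolution inverse of ι. Since ι * (S * ι) = ι = ι * 1, cancelling ι
  -- on the left makes S a left inverse too.
  have hinj : ∀ g g' : H →ₗ[ℂ] H, toConv LinearMap.id * toConv g = toConv LinearMap.id * toConv g' →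
      g = g' := by
    intro g g' hg
    have h2 : TensorProduct.lift (LinearMap.mul ℂ H) ∘ₗ g.lTensor H ∘ₗ comul =
      TensorProduct.lift (LinearMap.mul ℂ H) ∘ₗ g'.lTensor H ∘ₗ comul := congrArg ofConv hg
    ext h
    have h3 : g.lTensor H (comul h) = g'.lTensor H (comul h) := hb.1 (by
      rw [galois_lTensor_comul, galois_lTensor_comul, h2])
    have h4 := congrArg (fun X => TensorProduct.lid ℂ H (counit.rTensor H X)) h3
    simpa [lid_counit_lTensor] using h4
  HopfAlgebra.ofConvInverse (galoisAntipode hb 1)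
    (by
      apply ofConv_injective
      apply hinj
      change toConv LinearMap.id * (toConv (galoisAntipode hb 1) * toConv LinearMap.id) =
        toConv LinearMap.id * 1
      rw [← mul_assoc, h1, one_mul, mul_one])
    h1

end HopfOfGalois

/-! ### The antipode reverses the coproduct; a criterion for its bijectivity. -/

section AntipodeLemmas

variable {H : Type u} [Ring H] [HopfAlgebra ℂ H]

open WithConv HopfAlgebra

/-- `h ↦ h ⊗ 1` -/
def inclFst : H →ₗ[ℂ] H ⊗[ℂ] H := (TensorProduct.mk ℂ H H).flip 1

/-- `h ↦ 1 ⊗ h` -/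
def inclSnd : H →ₗ[ℂ] H ⊗[ℂ] H := TensorProduct.mk ℂ H H 1

theorem convMul_tensor_apply (f g : H →ₗ[ℂ] H ⊗[ℂ] H) (h : H) : (toConv f * toConv g).ofConv h =
    LinearMap.mul' ℂ (H ⊗[ℂ] H) (TensorProduct.map f g (comul h)) := rfl

theorem inclFst_mul_inclSnd :
    toConv (inclFst (H := H)) * toConv inclSnd = toConv (comul (R := ℂ)) := by
  ext h
  rw [convMul_tensor_apply]
  change _ = comul h
  generalize (comul h : H ⊗[ℂ] H) = X
  induction X with
  | zero => simp
  | add X Y hX hY => simp only [map_add, hX, hY]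
  | tmul x y => simp [inclFst, inclSnd]

theorem inclFst_antipode_mul : toConv (inclFst ∘ₗ antipode ℂ (A := H)) * toConv inclFst = 1 := by
  ext h
  rw [convMul_tensor_apply]
  have h1 : ∀ X : H ⊗[ℂ] H, LinearMap.mul' ℂ (H ⊗[ℂ] H)
      (TensorProduct.map (inclFst ∘ₗ antipode ℂ) inclFst X) =
      inclFst (LinearMap.mul' ℂ H ((antipode ℂ).rTensor H X)) := by
    intro X
    induction X with
    | zero => simp
    | add X Y hX hY => simp only [map_add, hX, hY]
    | tmul x y => simp [inclFst]
  rw [h1, mul_antipode_rTensor_comul_apply]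
  rfl

theorem inclSnd_antipode_mul : toConv (inclSnd ∘ₗ antipode ℂ (A := H)) * toConv inclSnd = 1 := by
  ext h
  rw [convMul_tensor_apply]
  have h1 : ∀ X : H ⊗[ℂ] H, LinearMap.mul' ℂ (H ⊗[ℂ] H)
      (TensorProduct.map (inclSnd ∘ₗ antipode ℂ) inclSnd X) =
      inclSnd (LinearMap.mul' ℂ H ((antipode ℂ).rTensor H X)) := by
    intro X
    induction X with
    | zero => simp
    | add X Y hX hY => simp only [map_add, hX, hY]
    | tmul x y => simp [inclSnd]
  rw [h1, mul_antipode_rTensor_comul_apply, LinearMap.convOne_apply, inclSnd,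
    TensorProduct.mk_apply]
  rw [Algebra.algebraMap_eq_smul_one, Algebra.algebraMap_eq_smul_one, TensorProduct.tmul_smul]
  rfl

/-- The antipode is an anti-homomorphism of coalgebras. -/
theorem comul_antipode (h : H) : comul (R := ℂ) (antipode ℂ h) =
    TensorProduct.map (antipode ℂ) (antipode ℂ) (TensorProduct.comm ℂ H H (comul h)) := by
  -- The coproduct is the convolution product of h ↦ h ⊗ 1 and h ↦ 1 ⊗ h. Inverting the factors in
  -- reverse order gives a left inverse of it, while the coproduct composed with S is a right
  -- inverse.
  have h1 : (toConv (inclSnd ∘ₗ antipode ℂ (A := H)) * toConv (inclFst ∘ₗ antipode ℂ)) *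
      toConv (comul (R := ℂ)) = 1 := by
    rw [← inclFst_mul_inclSnd, mul_assoc, ← mul_assoc (toConv (inclFst ∘ₗ antipode ℂ)),
      inclFst_antipode_mul, one_mul, inclSnd_antipode_mul]
  have h2 := left_inv_eq_right_inv h1 (LinearMap.comul_right_inv (R := ℂ) (C := H))
  have h3 := congrArg (fun f => f.ofConv h) h2
  change _ = comul (R := ℂ) (antipode ℂ h) at h3
  rw [← h3]
  refine (convMul_tensor_apply (inclSnd ∘ₗ antipode ℂ) (inclFst ∘ₗ antipode ℂ) h).trans ?_
  generalize (comul h : H ⊗[ℂ] H) = X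
  induction X with
  | zero => simp
  | add X Y hX hY => simp only [map_add, hX, hY]
  | tmul x y => simp [inclFst, inclSnd]

/-- `S(h₁)h₂ ⊗ h₃ = 1 ⊗ h`. -/
theorem antipode_fst_mul_comul :
    toConv (inclFst ∘ₗ antipode ℂ (A := H)) * toConv (comul (R := ℂ)) = toConv inclSnd := by
  rw [← inclFst_mul_inclSnd, ← mul_assoc, inclFst_antipode_mul, one_mul]

/-- The antipode is bijective if the Galois map of the opposite product is. -/
theorem antipode_bijective (hb : Function.Bijective (galois (LinearMap.mul ℂ H).flip)) :
    Function.Bijective (antipode ℂ (A := H)) := by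
  -- S' satisfies S'(h₂)h₁ = ε(h)1, so it plays the role of the inverse antipode. Both S' ∘ S and ι
  -- are convolution inverses of S, and so are ι and S ∘ S'.
  set S' := galoisAntipode hb (1 : H)
  have hS' : ∀ h : H, LinearMap.mul' ℂ H (TensorProduct.map S' LinearMap.id
      (TensorProduct.comm ℂ H H (comul h))) = counit (R := ℂ) h • 1 := by
    intro h
    rw [← lift_lTensor_galoisAntipode hb 1 h]
    generalize (comul h : H ⊗[ℂ] H) = X
    induction X with
    | zero => simp
    | add X Y hX hY => simp only [map_add, hX, hY]
    | tmul x y => simp [S']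
  have h1 : toConv (S' ∘ₗ antipode ℂ) * toConv (antipode ℂ) = 1 := by
    ext h
    have := hS' (antipode ℂ h)
    rw [comul_antipode, counit_antipode] at this
    rw [convMul_apply_eq, LinearMap.convOne_apply, Algebra.algebraMap_eq_smul_one, ← this]
    generalize (comul h : H ⊗[ℂ] H) = X
    induction X with
    | zero => simp
    | add X Y hX hY => simp only [map_add, hX, hY]
    | tmul x y => simp
  have h2 : toConv (antipode ℂ) * toConv (antipode ℂ ∘ₗ S') = 1 := by
    ext h
    have := congrArg (antipode ℂ) (hS' h)
    rw [map_smul, antipode_one] at this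
    rw [convMul_apply_eq, LinearMap.convOne_apply, Algebra.algebraMap_eq_smul_one, ← this]
    generalize (comul h : H ⊗[ℂ] H) = X
    induction X with
    | zero => simp
    | add X Y hX hY => simp only [map_add, hX, hY]
    | tmul x y => simp [antipode_mul_antidistrib]
  have h3 := left_inv_eq_right_inv h1 (LinearMap.antipode_mul_id (R := ℂ) (C := H))
  have h4 := left_inv_eq_right_inv (LinearMap.id_mul_antipode (R := ℂ) (C := H)) h2
  have h3' : S' ∘ₗ antipode ℂ = LinearMap.id := congrArg ofConv h3
  have h4' : LinearMap.id = antipode ℂ ∘ₗ S' := congrArg ofConv h4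
  exact ⟨Function.LeftInverse.injective (g := S') fun h => LinearMap.congr_fun h3' h,
    Function.RightInverse.surjective (g := S') fun h => (LinearMap.congr_fun h4' h).symm⟩

end AntipodeLemmas

end

end MultiplierHopf

namespace MultiplierHopf

noncomputable section

open Coalgebra

namespace CogradedUnital

variable {G : Type v} [Group G] {A : Type u} [NonUnitalRing A] [Module ℂ A]
  [IsScalarTower ℂ A A] [SMulCommClass ℂ A A] (D : CogradedUnital G A)

/-! ### The product of the reduced dual -/

/-- The product `(f ⊗ g) ∘ Δ_{p,q}` with values in `A_{pq}'`. -/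
def prodComponent (p q : G) : D.RedDual →ₗ[ℂ] D.RedDual →ₗ[ℂ] D.RedDual :=
  TensorProduct.curry (D.restrict (p * q) ∘ₗ (D.coprod p q).dualMap ∘ₗ D.pair)

/-- The product of the reduced dual. -/
def mulLin : D.RedDual →ₗ[ℂ] D.RedDual →ₗ[ℂ] D.RedDual :=
  D.glue fun p => D.glue ∘ₗ LinearMap.pi fun q => D.prodComponent p q

theorem mulLin_of_mem {p q : G} {f g : D.RedDual} (hf : f ∈ D.homog p) (hg : g ∈ D.homog q) :
    D.mulLin f g = D.prodComponent p q f g := by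
  rw [mulLin, D.glue_of_mem _ hf, LinearMap.comp_apply, D.glue_of_mem _ hg]
  rfl

theorem mulLin_mem {p q : G} {f g : D.RedDual} (hf : f ∈ D.homog p) (hg : g ∈ D.homog q) :
    D.mulLin f g ∈ D.homog (p * q) := by
  rw [D.mulLin_of_mem hf hg]
  exact D.restrict_mem _ _

theorem toDual_mulLin {p q : G} {f g : D.RedDual} (hf : f ∈ D.homog p) (hg : g ∈ D.homog q)
    (a : A) : D.toDual (D.mulLin f g) a = D.pair (f ⊗ₜ g) (D.coprod p q a) := by
  rw [D.mulLin_of_mem hf hg, ← D.coprod_proj]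
  rfl

theorem pair_map_proj {p q : G} {f g : D.RedDual} (hf : f ∈ D.homog p) (hg : g ∈ D.homog q)
    (z : A ⊗[ℂ] A) :
    D.pair (f ⊗ₜ g) (TensorProduct.map (D.proj p) (D.proj q) z) = D.pair (f ⊗ₜ g) z := by
  induction z with
  | zero => simp
  | add z w hz hw => simp only [map_add, hz, hw]
  | tmul a b => simp [pair_tmul, D.toDual_proj hf, D.toDual_proj hg]

theorem pair_mul_idem {p q : G} {f g : D.RedDual} (hf : f ∈ D.homog p) (hg : g ∈ D.homog q)
    (z : A ⊗[ℂ] A) : D.pair (f ⊗ₜ g) (z * D.idem p q) = D.pair (f ⊗ₜ g) z := by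
  rw [← idem_comm, idem_mul, D.pair_map_proj hf hg]

/-- On homogeneous elements both sides are f ⊗ g ⊗ h evaluated on the two iterated coproducts of a,
which agree by `coprod_coassoc`. -/
theorem mulLin_assoc (f g h : D.RedDual) :
    D.mulLin (D.mulLin f g) h = D.mulLin f (D.mulLin g h) := by
  refine D.dual_induction (fun p f hf => ?_) (by simp) (fun f f' hf hf' => by simp [hf, hf']) f
  refine D.dual_induction (fun q g hg => ?_) (by simp) (fun f f' hf hf' => by simp [hf, hf']) g
  refine D.dual_induction (fun r h hh => ?_) (by simp) (fun f f' hf hf' => by simp [hf, hf']) h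
  apply D.toDual_injective
  ext a
  rw [D.toDual_mulLin (D.mulLin_mem hf hg) hh, D.toDual_mulLin hf (D.mulLin_mem hg hh)]
  have h1 : ∀ z : A ⊗[ℂ] A, D.pair (D.mulLin f g ⊗ₜ h) z =
      D.pairThree (f ⊗ₜ (g ⊗ₜ h)) (TensorProduct.assoc ℂ A A A
        (TensorProduct.map (D.coprod p q) LinearMap.id z)) := by
    intro z
    induction z with
    | zero => simp
    | add z w hz hw => simp only [map_add, hz, hw]
    | tmul b c =>
      rw [pair_tmul, D.toDual_mulLin hf hg, TensorProduct.map_tmul]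
      generalize D.coprod p q b = w
      induction w with
      | zero => simp
      | add z w hz hw => simp only [map_add, TensorProduct.add_tmul, add_mul, hz, hw]
      | tmul b d => exact mul_assoc _ _ _
  have h2 : ∀ z : A ⊗[ℂ] A, D.pair (f ⊗ₜ D.mulLin g h) z =
      D.pairThree (f ⊗ₜ (g ⊗ₜ h)) (TensorProduct.map LinearMap.id (D.coprod q r) z) := by
    intro z
    induction z with
    | zero => simp
    | add z w hz hw => simp only [map_add, hz, hw]
    | tmul b c =>
      rw [pair_tmul, D.toDual_mulLin hg hh, TensorProduct.map_tmul]
      rfl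
  rw [h1, h2, coprod_coassoc]

theorem counit_mulLin (f g : D.RedDual) :
    counit (R := ℂ) (D.mulLin f g) = counit (R := ℂ) f * counit (R := ℂ) g := by
  refine D.dual_induction (fun p f hf => ?_) (by simp)
    (fun f f' hf hf' => by simp [hf, hf', add_mul]) f
  refine D.dual_induction (fun q g hg => ?_) (by simp)
    (fun f f' hf hf' => by simp [hf, hf', mul_add]) g
  rw [D.counit_of_mem (D.mulLin_mem hf hg), D.toDual_mulLin hf hg, coprod_one,
    D.counit_of_mem hf, D.counit_of_mem hg]
  rfl

theorem exists_counit_eq_one (p : G) : ∃ f ∈ D.homog p, counit (R := ℂ) f = 1 := by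
  have h : ∃ g : Module.Dual ℂ A, g (D.one p) ≠ 0 := by
    by_contra! h
    exact D.one_ne_zero p ((Module.forall_dual_apply_eq_zero_iff ℂ _).1 h)
  obtain ⟨g, hg⟩ := h
  refine ⟨(g (D.one p))⁻¹ • D.restrict p g, Submodule.smul_mem _ _ (D.restrict_mem p g), ?_⟩
  rw [map_smul, D.counit_of_mem (D.restrict_mem p g), toDual_restrict,
    D.proj_of_mem (D.one_mem p), smul_eq_mul, inv_mul_cancel₀ hg]

/-! ### Bijectivity of the Galois maps -/

theorem pair_fst_mul {q : G} {f g : D.RedDual} (hg : g ∈ D.homog q) {n : ℕ}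
    {x y : Fin n → D.RedDual} (h : comul (R := ℂ) f = ∑ i, x i ⊗ₜ y i) (a : A) (z : A ⊗[ℂ] A) :
    D.pair (f ⊗ₜ g) ((a ⊗ₜ D.one q) * z) = ∑ i, D.toDual (x i) a * D.pair (y i ⊗ₜ g) z := by
  induction z with
  | zero => simp
  | add z w hz hw => simp only [map_add, mul_add, hz, hw, Finset.sum_add_distrib]
  | tmul c d =>
    rw [Algebra.TensorProduct.tmul_mul_tmul, pair_tmul, ← pair_comul_tmul, h, ← proj_apply,
      D.toDual_proj hg]
    simp [pair_tmul, Finset.sum_mul, mul_assoc]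

section GaloisBijective

variable {D} {μ : D.RedDual →ₗ[ℂ] D.RedDual →ₗ[ℂ] D.RedDual} {C : G → G → A →ₗ[ℂ] A ⊗[ℂ] A}
  {σ : G → G → G} {T : A ⊗[ℂ] A ≃ₗ[ℂ] A ⊗[ℂ] A}

/-- The Galois map is the transpose of T: on a ⊗ b both sides are f₁(a)(f₂g)(b). Keeping C and σ
general covers Δ and its opposite at once. -/
theorem pair_galois
    (hμ : ∀ p q, ∀ f ∈ D.homog p, ∀ g ∈ D.homog q, ∀ a,
      D.toDual (μ f g) a = D.pair (f ⊗ₜ g) (C p q a))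
    (hT : ∀ a b p q, T (a ⊗ₜ b) * D.idem p q = (a ⊗ₜ D.one q) * C p q b)
    (X : D.RedDual ⊗[ℂ] D.RedDual) : D.pair (galois μ X) = D.pair X ∘ₗ T.toLinearMap := by
  induction X with
  | zero => simp
  | add X Y hX hY => rw [map_add, map_add, map_add, hX, hY, LinearMap.add_comp]
  | tmul f g =>
    refine D.dual_induction (fun p f hf => ?_) (by simp)
      (fun f f' hf hf' => by
        rw [TensorProduct.add_tmul, map_add, map_add, map_add, hf, hf', LinearMap.add_comp]) f
    refine D.dual_induction (fun q g hg => ?_) (by simp)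
      (fun f f' hf hf' => by
        rw [TensorProduct.tmul_add, map_add, map_add, map_add, hf, hf', LinearMap.add_comp]) g
    obtain ⟨n, x, y, hx, hy, h⟩ := D.exists_comul_eq_sum hf
    refine TensorProduct.ext' fun a b => ?_
    rw [galois_tmul, h, LinearMap.comp_apply, LinearEquiv.coe_coe, ← D.pair_mul_idem hf hg,
      hT, D.pair_fst_mul hg h]
    simp [pair_tmul, hμ p q _ (hy _) _ hg]

/-- T respects the decompositions and takes A_p ⊗ A_{σ(p,q)} to A_p ⊗ A_q. This lets its inverse be
transposed inside A^* ⊗ A^*, not merely inside the full dual of A ⊗ A. -/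
theorem map_proj_equiv (hσ : ∀ p, Function.Injective (σ p))
    (hC : ∀ p q a, D.idem p q * C p q a = C p q a)
    (hC₁ : ∀ p q a, C p q (D.proj (σ p q) a) = C p q a)
    (hC₂ : ∀ p q r a, r ≠ σ p q → C p q (D.proj r a) = 0)
    (hT : ∀ a b p q, T (a ⊗ₜ b) * D.idem p q = (a ⊗ₜ D.one q) * C p q b) (p q : G)
    (z : A ⊗[ℂ] A) : T (TensorProduct.map (D.proj p) (D.proj (σ p q)) z) =
      TensorProduct.map (D.proj p) (D.proj q) (T z) := by
  induction z with
  | zero => simp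
  | add z w hz hw => simp only [map_add, hz, hw]
  | tmul a b =>
    refine D.tensor_ext fun r s => ?_
    rw [TensorProduct.map_tmul, hT, ← idem_mul, D.idem_comm p q, mul_assoc]
    by_cases hr : p = r
    · subst hr
      by_cases hs : q = s
      · subst hs
        rw [hC₁, idem_mul_idem, hT, ← hC p q b, ← mul_assoc, ← mul_assoc]
        congr 1
        simp only [idem, Algebra.TensorProduct.tmul_mul_tmul, proj_apply]
        rw [← D.one_comm, ← mul_assoc, D.one_mul_one, D.one_comm p a]
      · rw [hC₂ _ _ _ _ (fun h => hs (hσ p h)), mul_zero, D.idem_mul_idem_of_ne (Or.inr hs),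
          mul_zero]
    · rw [D.idem_mul_idem_of_ne (Or.inl hr), mul_zero, ← hC r s, ← mul_assoc, idem,
        Algebra.TensorProduct.tmul_mul_tmul, D.mul_one_of_ne (Ne.symm hr) (D.proj_mem p a),
        TensorProduct.zero_tmul, zero_mul]

theorem exists_galois_eq (hσ : ∀ p, Function.Injective (σ p))
    (hμ : ∀ p q, ∀ f ∈ D.homog p, ∀ g ∈ D.homog q, ∀ a,
      D.toDual (μ f g) a = D.pair (f ⊗ₜ g) (C p q a))
    (hC : ∀ p q a, D.idem p q * C p q a = C p q a)
    (hC₁ : ∀ p q a, C p q (D.proj (σ p q) a) = C p q a)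
    (hC₂ : ∀ p q r a, r ≠ σ p q → C p q (D.proj r a) = 0)
    (hT : ∀ a b p q, T (a ⊗ₜ b) * D.idem p q = (a ⊗ₜ D.one q) * C p q b) (p q : G)
    {f g : D.RedDual} (hf : f ∈ D.homog p) (hg : g ∈ D.homog (σ p q)) :
    ∃ X ∈ LinearMap.range (TensorProduct.mapIncl (D.homog p) (D.homog q)),
      galois μ X = f ⊗ₜ g := by
  -- The preimage of f ⊗ g must be the functional (f ⊗ g) ∘ T⁻¹. It is supported on A_p ⊗ A_q, so
  -- finite-dimensionality makes it a tensor.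
  obtain ⟨X, hX, h⟩ := D.exists_pair_eq p q (ω := D.pair (f ⊗ₜ g) ∘ₗ T.symm.toLinearMap) (by
    refine LinearMap.ext fun z => ?_
    simp only [LinearMap.comp_apply, LinearEquiv.coe_coe]
    conv_lhs => rw [← T.apply_symm_apply z]
    rw [← map_proj_equiv hσ hC hC₁ hC₂ hT, T.symm_apply_apply, D.pair_map_proj hf hg])
  refine ⟨X, hX, D.pair_injective ?_⟩
  rw [pair_galois hμ hT, h]
  ext a b
  simp

theorem galois_bijective (hσ : ∀ p, Function.Bijective (σ p))
    (hμ : ∀ p q, ∀ f ∈ D.homog p, ∀ g ∈ D.homog q, ∀ a,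
      D.toDual (μ f g) a = D.pair (f ⊗ₜ g) (C p q a))
    (hC : ∀ p q a, D.idem p q * C p q a = C p q a)
    (hC₁ : ∀ p q a, C p q (D.proj (σ p q) a) = C p q a)
    (hC₂ : ∀ p q r a, r ≠ σ p q → C p q (D.proj r a) = 0)
    (hT : ∀ a b p q, T (a ⊗ₜ b) * D.idem p q = (a ⊗ₜ D.one q) * C p q b) :
    Function.Bijective (galois μ) := by
  constructor
  · rw [injective_iff_map_eq_zero]
    intro X hX
    apply D.pair_injective
    have h := pair_galois hμ hT X
    rw [hX, map_zero] at h
    rw [map_zero]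
    refine LinearMap.ext fun z => ?_
    have h1 := LinearMap.congr_fun h (T.symm z)
    simpa using h1.symm
  · rw [← LinearMap.range_eq_top, eq_top_iff]
    intro Y _
    induction Y with
    | zero => exact zero_mem _
    | add X Y hX hY => exact add_mem (hX trivial) (hY trivial)
    | tmul f g =>
      refine D.dual_induction (fun p f hf => ?_) (by simp)
        (fun f f' hf hf' => by rw [TensorProduct.add_tmul]; exact add_mem hf hf') f
      refine D.dual_induction (fun r g hg => ?_) (by simp)
        (fun f f' hf hf' => by rw [TensorProduct.tmul_add]; exact add_mem hf hf') g
      obtain ⟨q, rfl⟩ := (hσ p).2 r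
      obtain ⟨X, -, hX⟩ := exists_galois_eq (fun p => (hσ p).1) hμ hC hC₁ hC₂ hT p q hf hg
      exact ⟨X, hX⟩

end GaloisBijective

theorem exists_galois_mulLin_eq (p q : G) {f g : D.RedDual} (hf : f ∈ D.homog p)
    (hg : g ∈ D.homog (p * q)) :
    ∃ X ∈ LinearMap.range (TensorProduct.mapIncl (D.homog p) (D.homog q)),
      galois D.mulLin X = f ⊗ₜ g := by
  obtain ⟨T, hT⟩ := D.exists_fst_mul_equiv
  exact exists_galois_eq (σ := fun p q => p * q) (C := D.coprod) (fun p => mul_right_injective p)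
    (fun p q f hf g hg a => D.toDual_mulLin hf hg a) D.idem_mul_coprod D.coprod_proj
    (fun p q r a h => D.coprod_proj_of_ne h a) hT p q hf hg

theorem galois_mulLin_bijective : Function.Bijective (galois D.mulLin) := by
  obtain ⟨T, hT⟩ := D.exists_fst_mul_equiv
  exact galois_bijective (σ := fun p q => p * q) (C := D.coprod)
    (fun p => Group.mulLeft_bijective p)
    (fun p q f hf g hg a => D.toDual_mulLin hf hg a) D.idem_mul_coprod D.coprod_proj
    (fun p q r a h => D.coprod_proj_of_ne h a) hT

theorem pair_comm (f g : D.RedDual) (z : A ⊗[ℂ] A) :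
    D.pair (f ⊗ₜ g) (TensorProduct.comm ℂ A A z) = D.pair (g ⊗ₜ f) z := by
  induction z with
  | zero => simp
  | add z w hz hw => simp only [map_add, hz, hw]
  | tmul a b => exact mul_comm _ _

theorem galois_mulLin_flip_bijective : Function.Bijective (galois D.mulLin.flip) := by
  obtain ⟨T, hT⟩ := D.exists_snd_mul_equiv
  refine galois_bijective (σ := fun p q => q * p)
    (C := fun p q => (TensorProduct.comm ℂ A A).toLinearMap ∘ₗ D.coprod q p)
    (fun p => Group.mulRight_bijective p) (fun p q f hf g hg a => ?_) (fun p q a => ?_)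
    (fun p q a => ?_) (fun p q r a h => ?_) hT
  · rw [LinearMap.flip_apply, D.toDual_mulLin hg hf, LinearMap.comp_apply]
    exact (D.pair_comm f g _).symm
  · have h1 : D.idem p q = TensorProduct.comm ℂ A A (D.idem q p) := rfl
    rw [LinearMap.comp_apply, LinearEquiv.coe_coe, h1, ← comm_mul, idem_mul_coprod]
  · rw [LinearMap.comp_apply, coprod_proj, LinearMap.comp_apply]
  · rw [LinearMap.comp_apply, D.coprod_proj_of_ne h, map_zero]

/-! ### The Hopf algebra structure -/

theorem restrict_mulLin (e : D.RedDual) {q : G} {k : D.RedDual} (hk : k ∈ D.homog q) :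
    D.restrict q (D.toDual (D.mulLin e k)) = D.mulLin (D.restrict 1 (D.toDual e)) k := by
  refine D.dual_induction (fun p e he => ?_) (by simp)
    (fun f f' hf hf' => by simp only [map_add, LinearMap.add_apply, hf, hf']) e
  by_cases hp : p = 1
  · subst hp
    have h := D.mulLin_mem he hk
    rw [one_mul] at h
    rw [D.restrict_toDual he, D.restrict_toDual h]
  · rw [D.restrict_toDual_of_ne (fun h => hp h.symm) he,
      D.restrict_toDual_of_ne _ (D.mulLin_mem he hk), map_zero, LinearMap.zero_apply]
    intro h
    exact hp (by simpa using h)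

/-- The two Galois maps give a left and a right unit. Comparing degrees, the component in A_e' of
the left unit is still a left unit, and it must equal the right unit. -/
theorem exists_unit : ∃ e ∈ D.homog 1, (∀ k, D.mulLin e k = k) ∧ ∀ k, D.mulLin k e = k := by
  obtain ⟨h, -, hh⟩ := D.exists_counit_eq_one 1
  obtain ⟨e, he⟩ := exists_left_unit D.mulLin_assoc D.galois_mulLin_bijective ⟨h, hh⟩
  obtain ⟨e', he'⟩ := exists_left_unit (μ := D.mulLin.flip)
    (fun x y z => by simp [D.mulLin_assoc]) D.galois_mulLin_flip_bijective ⟨h, hh⟩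
  have h1 : ∀ k, D.mulLin (D.restrict 1 (D.toDual e)) k = k := by
    intro k
    refine D.dual_induction (fun q k hk => ?_) (by simp) (fun f f' hf hf' => by simp [hf, hf']) k
    rw [← D.restrict_mulLin e hk, he, D.restrict_toDual hk]
  have h2 : D.restrict 1 (D.toDual e) = e' := by
    rw [← h1 e']
    exact (he' (D.restrict 1 (D.toDual e))).symm
  refine ⟨D.restrict 1 (D.toDual e), D.restrict_mem _ _, h1, fun k => ?_⟩
  rw [h2]
  exact he' k

instance : Ring D.RedDual :=
  { (inferInstance : AddCommGroup D.RedDual) with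
    mul := fun f g => D.mulLin f g
    one := D.exists_unit.choose
    left_distrib := fun f g h => map_add (D.mulLin f) g h
    right_distrib := fun f g h => LinearMap.map_add₂ D.mulLin f g h
    zero_mul := fun f => LinearMap.map_zero₂ D.mulLin f
    mul_zero := fun f => map_zero (D.mulLin f)
    mul_assoc := D.mulLin_assoc
    one_mul := D.exists_unit.choose_spec.2.1
    mul_one := D.exists_unit.choose_spec.2.2 }

instance : Algebra ℂ D.RedDual :=
  Algebra.ofModule (fun r f g => LinearMap.map_smul₂ D.mulLin r f g)
    (fun r f g => map_smul (D.mulLin f) r g)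

theorem mul_eq_mulLin (f g : D.RedDual) : f * g = D.mulLin f g := rfl

theorem linearMap_mul_eq : LinearMap.mul ℂ D.RedDual = D.mulLin := rfl

theorem dual_one_mem : (1 : D.RedDual) ∈ D.homog 1 := D.exists_unit.choose_spec.1

theorem dual_mul_mem {p q : G} {f g : D.RedDual} (hf : f ∈ D.homog p) (hg : g ∈ D.homog q) :
    f * g ∈ D.homog (p * q) := D.mulLin_mem hf hg

theorem toDual_mul {p q : G} {f g : D.RedDual} (hf : f ∈ D.homog p) (hg : g ∈ D.homog q)
    (a : A) : D.toDual (f * g) a = D.pair (f ⊗ₜ g) (D.coprod p q a) := D.toDual_mulLin hf hg a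

theorem pair_tmul_mul {f g : D.RedDual} {m n : ℕ}
    {x y : Fin m → D.RedDual} (hf : comul (R := ℂ) f = ∑ i, x i ⊗ₜ y i)
    {x' y' : Fin n → D.RedDual} (hg : comul (R := ℂ) g = ∑ i, x' i ⊗ₜ y' i) (z w : A ⊗[ℂ] A) :
    D.pair (f ⊗ₜ g) (z * w) =
      ∑ i, ∑ j, D.pair (x i ⊗ₜ x' j) z * D.pair (y i ⊗ₜ y' j) w := by
  induction z with
  | zero => simp
  | add z z' hz hw => simp only [map_add, add_mul, hz, hw, Finset.sum_add_distrib]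
  | tmul a b =>
    induction w with
    | zero => simp
    | add z z' hz hw => simp only [map_add, mul_add, hz, hw, Finset.sum_add_distrib]
    | tmul c d =>
      rw [Algebra.TensorProduct.tmul_mul_tmul, pair_tmul, ← pair_comul_tmul, ← pair_comul_tmul,
        hf, hg]
      simp only [map_sum, LinearMap.sum_apply, pair_tmul, Finset.sum_mul_sum]
      refine Finset.sum_congr rfl fun i _ => Finset.sum_congr rfl fun j _ => ?_
      ring

/-- Dual to multiplicativity of Δ_{p,q}: both sides evaluate f ⊗ g on Δ_{p,q}(a)Δ_{p,q}(b). -/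
theorem dual_comul_mul (f g : D.RedDual) :
    comul (R := ℂ) (f * g) = comul (R := ℂ) f * comul (R := ℂ) g := by
  refine D.dual_induction (fun p f hf => ?_) (by simp)
    (fun f f' hf hf' => by simp only [add_mul, map_add, hf, hf']) f
  refine D.dual_induction (fun q g hg => ?_) (by simp)
    (fun f f' hf hf' => by simp only [mul_add, map_add, hf, hf']) g
  obtain ⟨m, x, y, hx, hy, h⟩ := D.exists_comul_eq_sum hf
  obtain ⟨n, x', y', hx', hy', h'⟩ := D.exists_comul_eq_sum hg
  apply D.pair_injective
  refine TensorProduct.ext' fun a b => ?_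
  rw [pair_comul_tmul, D.toDual_mul hf hg, coprod_mul, D.pair_tmul_mul h h', h, h']
  simp only [Finset.sum_mul_sum, Algebra.TensorProduct.tmul_mul_tmul, map_sum,
    LinearMap.sum_apply, pair_tmul]
  refine Finset.sum_congr rfl fun i _ => Finset.sum_congr rfl fun j _ => ?_
  rw [D.toDual_mul (hx i) (hx' j), D.toDual_mul (hy i) (hy' j)]

theorem dual_counit_one : counit (R := ℂ) (1 : D.RedDual) = 1 := by
  obtain ⟨h, -, hh⟩ := D.exists_counit_eq_one 1
  have := D.counit_mulLin 1 h
  rw [← mul_eq_mulLin, one_mul, hh, mul_one] at this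
  exact this.symm

theorem dual_comul_one : comul (R := ℂ) (1 : D.RedDual) = 1 := by
  -- Values of the Galois map are sums of Δ(f)(1 ⊗ g), which Δ(1) fixes on the left. By surjectivity
  -- 1 ⊗ 1 is such a value.
  have h1 : ∀ X, comul (R := ℂ) (1 : D.RedDual) * galois (LinearMap.mul ℂ D.RedDual) X =
      galois (LinearMap.mul ℂ D.RedDual) X := by
    intro X
    induction X with
    | zero => simp
    | add X Y hX hY => rw [map_add, mul_add, hX, hY]
    | tmul f g =>
      have h2 : ∀ Y : D.RedDual ⊗[ℂ] D.RedDual,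
          ((LinearMap.mul ℂ D.RedDual).flip g).lTensor _ Y = Y * (1 ⊗ₜ g) := by
        intro Y
        induction Y with
        | zero => simp
        | add X Y hX hY => rw [map_add, add_mul, hX, hY]
        | tmul f g => simp
      rw [galois_tmul, h2, ← mul_assoc, ← dual_comul_mul, one_mul]
  obtain ⟨X, hX⟩ := D.galois_mulLin_bijective.2 1
  have := h1 X
  rw [linearMap_mul_eq, hX, mul_one] at this
  exact this

instance : Bialgebra ℂ D.RedDual :=
  Bialgebra.mk' ℂ D.RedDual D.dual_counit_one (fun {f g} => D.counit_mulLin f g)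
    D.dual_comul_one (fun {f g} => D.dual_comul_mul f g)

instance : HopfAlgebra ℂ D.RedDual := hopfOfGalois (H := D.RedDual) D.galois_mulLin_bijective

open HopfAlgebra

theorem antipode_eq_galoisAntipode : antipode ℂ (A := D.RedDual) =
    galoisAntipode (μ := D.mulLin) D.galois_mulLin_bijective 1 := rfl

theorem dual_antipode_bijective : Function.Bijective (antipode ℂ (A := D.RedDual)) :=
  antipode_bijective D.galois_mulLin_flip_bijective

theorem dual_antipode_mem {p : G} {f : D.RedDual} (hf : f ∈ D.homog p) :
    antipode ℂ f ∈ D.homog p⁻¹ := by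
  -- As 1 has degree e = pp⁻¹, the preimage of f ⊗ 1 under the Galois map lies in A_p' ⊗ A_{p⁻¹}',
  -- and S(f) is its image under ε ⊗ ι.
  obtain ⟨X, ⟨Y, rfl⟩, h⟩ := D.exists_galois_mulLin_eq p p⁻¹ (g := 1) hf (by
    rw [mul_inv_cancel]; exact D.dual_one_mem)
  have h1 : antipode ℂ f = TensorProduct.lid ℂ _ (counit.rTensor _
      (TensorProduct.mapIncl (D.homog p) (D.homog p⁻¹) Y)) := by
    rw [antipode_eq_galoisAntipode]
    simp only [galoisAntipode, LinearMap.comp_apply, LinearEquiv.coe_coe, LinearMap.flip_apply,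
      TensorProduct.mk_apply]
    rw [← h]
    exact congrArg (fun X => TensorProduct.lid ℂ _ (counit.rTensor _ X))
      (LinearEquiv.symm_apply_apply
        (LinearEquiv.ofBijective (galois D.mulLin) D.galois_mulLin_bijective) _)
  rw [h1]
  clear h h1
  induction Y with
  | zero => simp
  | add X Y hX hY => simp only [map_add]; exact add_mem hX hY
  | tmul x y =>
    simp only [TensorProduct.mapIncl, TensorProduct.map_tmul, LinearMap.rTensor_tmul,
      TensorProduct.lid_tmul]
    exact Submodule.smul_mem _ _ y.2

end CogradedUnital

end

end MultiplierHopf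

namespace MultiplierHopf

noncomputable section

open Coalgebra

/-! ### Integrals in Hopf algebras -/

section HopfIntegral

open HopfAlgebra WithConv

variable {H : Type u} [Ring H] [HopfAlgebra ℂ H]

/-- If `h₁ ⊗ h₂φ = h ⊗ φ'`, then `φ₁ ⊗ hφ₂ = S(h)φ'₁ ⊗ φ'₂`. -/
theorem one_tmul_mul_comul {h φ φ' : H}
    (hφ : (LinearMap.mulRight ℂ φ).lTensor H (comul h) = h ⊗ₜ φ') :
    (1 ⊗ₜ[ℂ] h) * comul (R := ℂ) φ = (antipode ℂ h ⊗ₜ 1) * comul (R := ℂ) φ' := by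
  -- Replacing 1 ⊗ h by S(h₁)h₂ ⊗ h₃ turns the left side into (S(h₁) ⊗ 1)Δ(h₂φ), to which the
  -- hypothesis applies.
  have h1 := congrArg (fun f => f.ofConv h) (antipode_fst_mul_comul (H := H))
  change LinearMap.mul' ℂ (H ⊗[ℂ] H) (TensorProduct.map (inclFst ∘ₗ antipode ℂ) comul (comul h)) =
    1 ⊗ₜ[ℂ] h at h1
  have h2 : ∀ X : H ⊗[ℂ] H, LinearMap.mul' ℂ (H ⊗[ℂ] H)
      (TensorProduct.map (inclFst ∘ₗ antipode ℂ) comul X) * comul (R := ℂ) φ =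
      LinearMap.mul' ℂ (H ⊗[ℂ] H) (TensorProduct.map (inclFst ∘ₗ antipode ℂ) comul
        ((LinearMap.mulRight ℂ φ).lTensor H X)) := by
    intro X
    induction X with
    | zero => simp
    | add X Y hX hY => simp only [map_add, add_mul, hX, hY]
    | tmul x y => simp [mul_assoc]
  rw [← h1, h2, hφ]
  simp [inclFst]

/-- If `φ₁ a(hφ₂) = 0` for all `h`, then `a = 0` or `φ = 0`. -/
theorem smul_eq_zero_of_contract {φ : H} {a : Module.Dual ℂ H}
    (ha : ∀ h, TensorProduct.rid ℂ H ((a ∘ₗ LinearMap.mulLeft ℂ h).lTensor H (comul φ)) = 0)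
    (g : H) : a g • φ = 0 := by
  let Ξ : H →ₗ[ℂ] Module.Dual ℂ H := (LinearMap.mul ℂ H).flip.compr₂ a
  have hΞ : ∀ z h, Ξ z h = a (h * z) := fun _ _ => rfl
  have h1 : Ξ.lTensor H (comul φ) = 0 := by
    apply dualDistrib_comp_map_injective (i := Module.Dual.eval ℂ H)
      (i' := (LinearMap.id : Module.Dual ℂ H →ₗ[ℂ] Module.Dual ℂ H))
      (Module.eval_apply_injective ℂ) Function.injective_id
    rw [map_zero]
    refine TensorProduct.ext' fun b h => ?_
    have h2 := congrArg b (ha h)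
    rw [map_zero] at h2
    rw [LinearMap.zero_apply, ← h2]
    generalize (comul φ : H ⊗[ℂ] H) = X
    induction X with
    | zero => simp
    | add X Y hX hY => simp only [map_add, LinearMap.add_apply, hX, hY]
    | tmul x y => simp [hΞ, mul_comm]
  -- The map c sends x ⊗ ξ to ξ(gS(x)). Splitting the first leg of φ₁ ⊗ a(·φ₂) = 0 and contracting
  -- with c gives 0 = φ₁ a(gS(φ₂)φ₃) = a(g)φ.
  let c : H ⊗[ℂ] Module.Dual ℂ H →ₗ[ℂ] ℂ :=
    TensorProduct.lift (Module.Dual.eval ℂ H ∘ₗ LinearMap.mulLeft ℂ g ∘ₗ antipode ℂ)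
  have h3 : ∀ X : H ⊗[ℂ] H, c.lTensor H (TensorProduct.assoc ℂ _ _ _
      (comul.rTensor _ (Ξ.lTensor H X))) =
      (c ∘ₗ Ξ.lTensor H).lTensor H (TensorProduct.assoc ℂ _ _ _ (comul.rTensor _ X)) := by
    intro X
    induction X with
    | zero => simp
    | add X Y hX hY => simp only [map_add, hX, hY]
    | tmul x y =>
      simp only [LinearMap.lTensor_tmul, LinearMap.rTensor_tmul]
      generalize (comul x : H ⊗[ℂ] H) = Y
      induction Y with
      | zero => simp
      | add X Y hX hY => simp only [TensorProduct.add_tmul, map_add, hX, hY]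
      | tmul x y => simp
  have h4 : c ∘ₗ Ξ.lTensor H ∘ₗ comul = a g • counit := by
    ext k
    have h5 : ∀ X : H ⊗[ℂ] H, c (Ξ.lTensor H X) =
        a (g * LinearMap.mul' ℂ H ((antipode ℂ).rTensor H X)) := by
      intro X
      induction X with
      | zero => simp
      | add X Y hX hY => simp only [map_add, mul_add, hX, hY]
      | tmul x y => simp [c, hΞ, mul_assoc]
    rw [LinearMap.comp_apply, LinearMap.comp_apply, h5, mul_antipode_rTensor_comul_apply]
    simp [Algebra.algebraMap_eq_smul_one, mul_comm]
  have h6 := h3 (comul φ)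
  rw [h1, coassoc_apply, ← LinearMap.lTensor_comp_apply, LinearMap.comp_assoc, h4,
    LinearMap.lTensor_smul, LinearMap.smul_apply, lTensor_counit_comul] at h6
  have h7 := congrArg (TensorProduct.rid ℂ H) h6
  simpa using h7.symm

/-! ### Galois maps of modules over a Hopf algebra. -/

section Action

variable {M : Type v} [AddCommGroup M] [Module ℂ M]

/-- The map `k ⊗ m ↦ k₁ ⊗ k₂m` for an action of `H` on `M`. -/
def actGalois (ρ : H →ₗ[ℂ] Module.End ℂ M) : H ⊗[ℂ] M →ₗ[ℂ] H ⊗[ℂ] M :=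
  (TensorProduct.lift ρ).lTensor H ∘ₗ (TensorProduct.assoc ℂ H H M).toLinearMap ∘ₗ
    comul.rTensor M

theorem actGalois_tmul (ρ : H →ₗ[ℂ] Module.End ℂ M) (k : H) (m : M) :
    actGalois ρ (k ⊗ₜ m) = (ρ.flip m).lTensor H (comul k) := by
  simp only [actGalois, LinearMap.comp_apply, LinearMap.rTensor_tmul, LinearEquiv.coe_coe]
  generalize (comul k : H ⊗[ℂ] H) = X
  induction X with
  | zero => simp
  | add X Y hX hY => simp only [TensorProduct.add_tmul, map_add, hX, hY]
  | tmul x y => simp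

/-- Both sides are k₁ ⊗ ρ(k₂)ρ'(k₃)m. So convolution inverses give inverse Galois maps, and for an
action ρ the convolution inverse is ρ ∘ S. -/
theorem actGalois_comp (ρ ρ' : H →ₗ[ℂ] Module.End ℂ M) :
    actGalois ρ ∘ₗ actGalois ρ' = actGalois (toConv ρ * toConv ρ').ofConv := by
  refine TensorProduct.ext' fun k m => ?_
  rw [LinearMap.comp_apply, actGalois_tmul, actGalois_tmul]
  have h1 : ∀ X : H ⊗[ℂ] H, actGalois ρ ((ρ'.flip m).lTensor H X) =
      (TensorProduct.lift ρ ∘ₗ (ρ'.flip m).lTensor H).lTensor H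
        (TensorProduct.assoc ℂ _ _ _ (comul.rTensor _ X)) := by
    intro X
    induction X with
    | zero => simp
    | add X Y hX hY => simp only [map_add, hX, hY]
    | tmul x y =>
      rw [LinearMap.lTensor_tmul, actGalois_tmul, LinearMap.rTensor_tmul]
      generalize (comul x : H ⊗[ℂ] H) = Y
      induction Y with
      | zero => simp
      | add X Y hX hY => simp only [TensorProduct.add_tmul, map_add, hX, hY]
      | tmul x y => simp
  rw [h1, coassoc_apply, ← LinearMap.lTensor_comp_apply]
  congr 2
  ext h
  change _ = LinearMap.mul' ℂ (Module.End ℂ M) (TensorProduct.map ρ ρ' (comul h)) m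
  rw [LinearMap.comp_apply, LinearMap.comp_apply]
  generalize (comul h : H ⊗[ℂ] H) = Y
  induction Y with
  | zero => simp
  | add X Y hX hY => simp only [map_add, LinearMap.add_apply, hX, hY]
  | tmul x y => simp

theorem actGalois_one : actGalois (1 : WithConv (H →ₗ[ℂ] Module.End ℂ M)).ofConv =
    LinearMap.id := by
  refine TensorProduct.ext' fun k m => ?_
  rw [actGalois_tmul]
  have h1 : ∀ X : H ⊗[ℂ] H,
      ((1 : WithConv (H →ₗ[ℂ] Module.End ℂ M)).ofConv.flip m).lTensor H X =
      (LinearMap.toSpanSingleton ℂ M m).lTensor H (counit.lTensor H X) := by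
    intro X
    induction X with
    | zero => simp
    | add X Y hX hY => simp only [map_add, hX, hY]
    | tmul x y =>
      simp only [LinearMap.lTensor_tmul, LinearMap.flip_apply]
      rfl
  rw [h1, lTensor_counit_comul]
  simp

theorem actGalois_bijective (ρ : H →ₐ[ℂ] Module.End ℂ M) :
    Function.Bijective (actGalois ρ.toLinearMap) := by
  have h1 : toConv ρ.toLinearMap * toConv (ρ.toLinearMap ∘ₗ antipode ℂ) = 1 := by
    refine ofConv_injective (LinearMap.ext fun h => ?_)
    have h2 : ∀ X : H ⊗[ℂ] H, LinearMap.mul' ℂ (Module.End ℂ M)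
        (TensorProduct.map ρ.toLinearMap (ρ.toLinearMap ∘ₗ antipode ℂ) X) =
        ρ (LinearMap.mul' ℂ H ((antipode ℂ).lTensor H X)) := by
      intro X
      induction X with
      | zero => simp
      | add X Y hX hY => simp only [map_add, hX, hY]
      | tmul x y => simp
    refine (h2 (comul h)).trans ?_
    rw [mul_antipode_lTensor_comul_apply, AlgHom.commutes]
    rfl
  have h1' : toConv (ρ.toLinearMap ∘ₗ antipode ℂ) * toConv ρ.toLinearMap = 1 := by
    refine ofConv_injective (LinearMap.ext fun h => ?_)
    have h2 : ∀ X : H ⊗[ℂ] H, LinearMap.mul' ℂ (Module.End ℂ M)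
        (TensorProduct.map (ρ.toLinearMap ∘ₗ antipode ℂ) ρ.toLinearMap X) =
        ρ (LinearMap.mul' ℂ H ((antipode ℂ).rTensor H X)) := by
      intro X
      induction X with
      | zero => simp
      | add X Y hX hY => simp only [map_add, hX, hY]
      | tmul x y => simp
    refine (h2 (comul h)).trans ?_
    rw [mul_antipode_rTensor_comul_apply, AlgHom.commutes]
    rfl
  have h3 := actGalois_comp ρ.toLinearMap (ρ.toLinearMap ∘ₗ antipode ℂ)
  have h3' := actGalois_comp (ρ.toLinearMap ∘ₗ antipode ℂ) ρ.toLinearMap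
  rw [h1, actGalois_one] at h3
  rw [h1', actGalois_one] at h3'
  exact ⟨Function.LeftInverse.injective (g := actGalois (ρ.toLinearMap ∘ₗ antipode ℂ))
      fun x => LinearMap.congr_fun h3' x,
    Function.RightInverse.surjective (g := actGalois (ρ.toLinearMap ∘ₗ antipode ℂ))
      fun x => LinearMap.congr_fun h3 x⟩

/-- The action of `H ⊗ H` on `H ⊗ M`. -/
def tensorAct (ρ : H →ₗ[ℂ] Module.End ℂ M) : H ⊗[ℂ] H →ₗ[ℂ] Module.End ℂ (H ⊗[ℂ] M) :=
  TensorProduct.homTensorHomMap (RingHom.id ℂ) H M H M ∘ₗ TensorProduct.map (LinearMap.mul ℂ H) ρ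

theorem tensorAct_tmul (ρ : H →ₗ[ℂ] Module.End ℂ M) (x y k : H) (m : M) :
    tensorAct ρ (x ⊗ₜ y) (k ⊗ₜ m) = (x * k) ⊗ₜ ρ y m := rfl

/-- The untwisting step: multiplication on the first leg alone corresponds to the diagonal action on
H ⊗ M. -/
theorem actGalois_mulLeft (ρ : H →ₐ[ℂ] Module.End ℂ M) (h : H) (x : H ⊗[ℂ] M) :
    actGalois ρ.toLinearMap ((LinearMap.mulLeft ℂ h).rTensor M x) =
      tensorAct ρ.toLinearMap (comul h) (actGalois ρ.toLinearMap x) := by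
  induction x with
  | zero => simp
  | add X Y hX hY => simp only [map_add, hX, hY]
  | tmul k m =>
    rw [LinearMap.rTensor_tmul, actGalois_tmul, actGalois_tmul, LinearMap.mulLeft_apply,
      Bialgebra.comul_mul]
    generalize (comul h : H ⊗[ℂ] H) = X
    generalize (comul k : H ⊗[ℂ] H) = Y
    induction X with
    | zero => simp
    | add X Y hX hY => simp only [add_mul, map_add, LinearMap.add_apply, hX, hY]
    | tmul x y =>
      induction Y with
      | zero => simp
      | add X Y hX hY => simp only [mul_add, map_add, hX, hY]
      | tmul k l => simp [tensorAct_tmul]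

end Action

/-- The action of a Hopf algebra on its dual space that is adjoint to left multiplication. -/
def dualAct : H →ₐ[ℂ] Module.End ℂ (Module.Dual ℂ H) :=
  AlgHom.ofLinearMap (Module.Dual.transpose ∘ₗ LinearMap.mul ℂ H ∘ₗ antipode ℂ)
    (by ext ξ k; simp [Module.Dual.transpose_apply])
    (fun h h' => by
      ext ξ k; simp [Module.Dual.transpose_apply, antipode_mul_antidistrib, mul_assoc])

theorem dualAct_apply (h : H) (ξ : Module.Dual ℂ H) (k : H) :
    dualAct h ξ k = ξ (antipode ℂ h * k) := rfl

/-- A finite-rank operator `P` that commutes with the left multiplications by `S(k)` for `k` in a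
subcoalgebra `K` yields an element that is invariant for `K`. -/
theorem exists_invariant {K : Submodule ℂ H}
    (hK : ∀ k ∈ K, comul k ∈ LinearMap.range (TensorProduct.mapIncl K K))
    {n : ℕ} (x : Fin n → H) (ξ : Fin n → Module.Dual ℂ H)
    (hP : ∀ k ∈ K, ∀ y, ∑ i, ξ i (antipode ℂ k * y) • x i = antipode ℂ k * ∑ i, ξ i y • x i)
    (hP₀ : ∃ y, ∑ i, ξ i y • x i ≠ 0) :
    ∃ Λ : H, Λ ≠ 0 ∧ ∀ k ∈ K, k * Λ = counit (R := ℂ) k • Λ := by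
  let i₀ : H →ₗ[ℂ] Module.Dual ℂ (Module.Dual ℂ H) := Module.Dual.eval ℂ H
  have hi₀ : Function.Injective i₀ := Module.eval_apply_injective ℂ
  let θ : H ⊗[ℂ] Module.Dual ℂ H →ₗ[ℂ] H →ₗ[ℂ] H :=
    TensorProduct.lift (LinearMap.smulRightₗ.flip)
  have hθ : ∀ x ξ y, θ (x ⊗ₜ ξ) y = ξ y • x := fun _ _ _ => rfl
  have hθi : Function.Injective θ := by
    rw [injective_iff_map_eq_zero]
    intro t ht
    apply dualDistrib_comp_map_injective (i := i₀)
      (i' := (LinearMap.id : Module.Dual ℂ H →ₗ[ℂ] Module.Dual ℂ H)) hi₀ Function.injective_id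
    rw [map_zero]
    refine TensorProduct.ext' fun b h => ?_
    have h2 := congrArg b (LinearMap.congr_fun ht h)
    rw [LinearMap.zero_apply, map_zero] at h2
    rw [LinearMap.zero_apply, ← h2]
    clear h2 ht
    induction t with
    | zero => simp
    | add X Y hX hY => simp only [map_add, LinearMap.add_apply, hX, hY]
    | tmul x y => simp [hθ, i₀, mul_comm]
  -- Finite rank is what puts P in H ⊗ H'. The diagonal action turns P into k₁P(S(k₂)·) = k₁S(k₂)P =
  -- ε(k)P, so t is invariant under K.
  let t : H ⊗[ℂ] Module.Dual ℂ H := ∑ i, x i ⊗ₜ ξ i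
  have ht : ∀ y, θ t y = ∑ i, ξ i y • x i := fun y => by simp [t, hθ, map_sum]
  have hinv : ∀ k ∈ K, tensorAct dualAct.toLinearMap (comul k) t = counit (R := ℂ) k • t := by
    intro k hk
    apply hθi
    ext z
    have h1 : ∀ X : H ⊗[ℂ] H, X ∈ LinearMap.range (TensorProduct.mapIncl K K) →
        θ (tensorAct dualAct.toLinearMap X t) z =
        LinearMap.mul' ℂ H ((antipode ℂ).lTensor H X) * θ t z := by
      rintro _ ⟨Y, rfl⟩
      induction Y with
      | zero => simp
      | add X Y hX hY => simp only [map_add, LinearMap.add_apply, add_mul, hX, hY]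
      | tmul a b =>
        have h2 : ∀ s : H ⊗[ℂ] Module.Dual ℂ H,
            θ (tensorAct dualAct.toLinearMap ((a : H) ⊗ₜ (b : H)) s) z =
            a * θ s (antipode ℂ (b : H) * z) := by
          intro s
          induction s with
          | zero => simp
          | add X Y hX hY => simp only [map_add, LinearMap.add_apply, mul_add, hX, hY]
          | tmul c d => simp [tensorAct_tmul, hθ, dualAct_apply]
        simp only [TensorProduct.mapIncl, TensorProduct.map_tmul, Submodule.subtype_apply]
        rw [h2, ht, hP _ b.2, ← ht]
        simp [mul_assoc]
    rw [h1 _ (hK k hk), mul_antipode_lTensor_comul_apply, map_smul, LinearMap.smul_apply,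
      ← Algebra.smul_def]
  have ht0 : t ≠ 0 := by
    rintro h
    obtain ⟨y, hy⟩ := hP₀
    exact hy (by rw [← ht, h]; simp)
  obtain ⟨hinj, hsurj⟩ := actGalois_bijective (dualAct (H := H))
  obtain ⟨u, hu⟩ := hsurj t
  have hu0 : u ≠ 0 := by rintro rfl; exact ht0 (by rw [← hu, map_zero])
  have hui : ∀ k ∈ K, (LinearMap.mulLeft ℂ k).rTensor _ u = counit (R := ℂ) k • u := by
    intro k hk
    apply hinj
    rw [actGalois_mulLeft, hu, hinv k hk, map_smul, hu]
  -- After untwisting, K acts on the first leg of u only, so any nonzero slice of u along the second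
  -- leg is an invariant element of H.
  obtain ⟨l, hl⟩ : ∃ l : Module.Dual ℂ (Module.Dual ℂ H),
      TensorProduct.rid ℂ H (l.lTensor H u) ≠ 0 := by
    by_contra! h
    refine hu0 (dualDistrib_comp_map_injective (i := i₀)
      (i' := Module.Dual.eval ℂ (Module.Dual ℂ H)) hi₀ (Module.eval_apply_injective ℂ) ?_)
    rw [map_zero]
    refine TensorProduct.ext' fun b l => ?_
    have h2 := congrArg b (h l)
    rw [map_zero] at h2
    rw [LinearMap.zero_apply, ← h2]
    generalize u = u
    induction u with
    | zero => simp
    | add X Y hX hY => simp only [map_add, LinearMap.add_apply, hX, hY]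
    | tmul x y => simp [i₀, mul_comm]
  refine ⟨_, hl, fun k hk => ?_⟩
  have h1 : ∀ w : H ⊗[ℂ] Module.Dual ℂ H, k * TensorProduct.rid ℂ H (l.lTensor H w) =
      TensorProduct.rid ℂ H (l.lTensor H ((LinearMap.mulLeft ℂ k).rTensor _ w)) := by
    intro w
    induction w with
    | zero => simp
    | add X Y hX hY => simp only [map_add, mul_add, hX, hY]
    | tmul x y => simp
  rw [h1, hui k hk, map_smul, map_smul]

end HopfIntegral

end

end MultiplierHopf

namespace MultiplierHopf

noncomputable section

open Coalgebra HopfAlgebra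

namespace CogradedUnital

variable {G : Type v} [Group G] {A : Type u} [NonUnitalRing A] [Module ℂ A]
  [IsScalarTower ℂ A A] [SMulCommClass ℂ A A] (D : CogradedUnital G A)

/-! ### Gradings -/

theorem restrict_mul {q : G} {k : D.RedDual} (hk : k ∈ D.homog q) (p : G) (x : D.RedDual) :
    D.restrict (q * p) (D.toDual (k * x)) = k * D.restrict p (D.toDual x) := by
  refine D.dual_induction (fun r x hx => ?_) (by simp)
    (fun f f' hf hf' => by simp only [map_add, mul_add, hf, hf']) x
  by_cases h : p = r
  · subst h; rw [D.restrict_toDual hx, D.restrict_toDual (D.dual_mul_mem hk hx)]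
  · rw [D.restrict_toDual_of_ne h hx, mul_zero,
      D.restrict_toDual_of_ne (fun h' => h (mul_left_cancel h')) (D.dual_mul_mem hk hx)]

theorem antipode_restrict (p : G) (f : D.RedDual) :
    antipode ℂ (D.restrict p (D.toDual f)) = D.restrict p⁻¹ (D.toDual (antipode ℂ f)) := by
  refine D.dual_induction (fun r x hx => ?_) (by simp)
    (fun f f' hf hf' => by simp only [map_add, hf, hf']) f
  by_cases h : p = r
  · subst h; rw [D.restrict_toDual hx, D.restrict_toDual (D.dual_antipode_mem hx)]
  · rw [D.restrict_toDual_of_ne h hx, map_zero,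
      D.restrict_toDual_of_ne (fun h' => h (inv_injective h')) (D.dual_antipode_mem hx)]

theorem mem_homog_of_restrict {p : G} {f : D.RedDual}
    (h : ∀ q, q ≠ p → D.restrict q (D.toDual f) = 0) : f ∈ D.homog p := by
  intro q hq a ha
  have := D.toDual_restrict q (D.toDual f) a
  rw [h q hq, D.proj_of_mem ha] at this
  simpa using this.symm

theorem mem_homog_of_antipode_mem {p : G} {f : D.RedDual} (h : antipode ℂ f ∈ D.homog p) :
    f ∈ D.homog p⁻¹ := by
  refine D.mem_homog_of_restrict fun q hq => D.dual_antipode_bijective.1 ?_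
  rw [antipode_restrict, map_zero, D.restrict_toDual_of_ne _ h]
  rintro rfl
  simp at hq

/-! ### Families of integrals in the reduced dual -/

/-- The components `φ_p ∈ A_p'` of a left invariant functional. -/
structure IsLeftFamily (φ : G → D.RedDual) : Prop where
  mem : ∀ p, φ p ∈ D.homog p
  mul : ∀ p q, ∀ h ∈ D.homog p, h * φ q = counit (R := ℂ) h • φ (p * q)

/-- The components `ψ_p ∈ A_p'` of a right invariant functional. -/
structure IsRightFamily (ψ : G → D.RedDual) : Prop where
  mem : ∀ p, ψ p ∈ D.homog p
  mul : ∀ p q, ∀ h ∈ D.homog p, ψ q * h = counit (R := ℂ) h • ψ (q * p)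

theorem sum_counit_smul_left {f : D.RedDual} {n : ℕ} {x y : Fin n → D.RedDual}
    (h : comul (R := ℂ) f = ∑ i, x i ⊗ₜ y i) : ∑ i, counit (R := ℂ) (x i) • y i = f := by
  have := congrArg (TensorProduct.lid ℂ D.RedDual) (rTensor_counit_comul (R := ℂ) f)
  rw [h] at this
  simpa using this

theorem sum_counit_smul_right {f : D.RedDual} {n : ℕ} {x y : Fin n → D.RedDual}
    (h : comul (R := ℂ) f = ∑ i, x i ⊗ₜ y i) : ∑ i, counit (R := ℂ) (y i) • x i = f := by
  have := congrArg (TensorProduct.rid ℂ D.RedDual) (lTensor_counit_comul (R := ℂ) f)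
  rw [h] at this
  simpa using this

theorem sum_mul_antipode {f : D.RedDual} {n : ℕ} {x y : Fin n → D.RedDual}
    (h : comul (R := ℂ) f = ∑ i, x i ⊗ₜ y i) :
    ∑ i, x i * antipode ℂ (y i) = counit (R := ℂ) f • 1 := by
  have := mul_antipode_lTensor_comul_apply (R := ℂ) f
  rw [h, Algebra.algebraMap_eq_smul_one] at this
  simpa using this

/-- Insert y₁S(y₂) = 1 in front of xΛ. The factor S(y₂)x has degree s⁻¹s = e, so Λ absorbs it with
scalar ε(y₂)ε(x). -/
theorem mul_eq_of_invariant {Λ : D.RedDual}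
    (hΛ : ∀ k ∈ D.homog 1, k * Λ = counit (R := ℂ) k • Λ) {s : G} {x y : D.RedDual}
    (hx : x ∈ D.homog s) (hy : y ∈ D.homog s) (hy1 : counit (R := ℂ) y = 1) :
    x * Λ = counit (R := ℂ) x • (y * Λ) := by
  obtain ⟨n, u, v, hu, hv, h⟩ := D.exists_comul_eq_sum hy
  have h1 := D.sum_mul_antipode h
  rw [hy1, one_smul] at h1
  have h2 : ∀ i, antipode ℂ (v i) * x * Λ =
      (counit (R := ℂ) (v i) * counit (R := ℂ) x) • Λ := by
    intro i
    have h3 := D.dual_mul_mem (D.dual_antipode_mem (hv i)) hx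
    rw [inv_mul_cancel] at h3
    rw [hΛ _ h3, Bialgebra.counit_mul, counit_antipode]
  calc x * Λ = (∑ i, u i * antipode ℂ (v i)) * (x * Λ) := by rw [h1, one_mul]
    _ = ∑ i, u i * (antipode ℂ (v i) * x * Λ) := by simp only [Finset.sum_mul, mul_assoc]
    _ = counit (R := ℂ) x • ((∑ i, counit (R := ℂ) (v i) • u i) * Λ) := by
      simp only [h2, Finset.sum_mul, Finset.smul_sum, mul_smul_comm, smul_mul_assoc, smul_smul]
      simp only [mul_comm]
    _ = counit (R := ℂ) x • (y * Λ) := by rw [D.sum_counit_smul_right h]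

theorem exists_isLeftFamily : ∃ φ : G → D.RedDual, D.IsLeftFamily φ ∧ ∃ p, φ p ≠ 0 := by
  obtain ⟨n, x, b, hx, hb⟩ := D.exists_dual_basis 1
  have hsum : ∀ f : D.RedDual, ∑ i, D.toDual f (b i) • x i = D.restrict 1 (D.toDual f) := by
    intro f
    apply D.toDual_injective
    ext a
    rw [toDual_restrict, hb]
    simp [mul_comm]
  -- By `hsum` the operator here is the projection of A^* on A_e'. It is nonzero because it fixes
  -- the unit.
  obtain ⟨Λ, hΛ0, hΛ⟩ := exists_invariant (K := D.homog 1) (fun k hk => D.comul_mem hk) x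
    (fun i => D.toDual.flip (b i))
    (fun k hk y => by
      have h1 := D.dual_antipode_mem hk
      rw [inv_one] at h1
      simp only [LinearMap.flip_apply]
      rw [hsum, hsum, ← D.restrict_mul h1, one_mul])
    ⟨1, by
      simp only [LinearMap.flip_apply]
      rw [hsum, D.restrict_toDual D.dual_one_mem]
      intro h
      have := D.dual_counit_one
      rw [h, map_zero] at this
      exact zero_ne_one this⟩
  obtain ⟨p, hp⟩ : ∃ p, D.restrict p (D.toDual Λ) ≠ 0 := by
    by_contra! h
    exact hΛ0 (D.dual_eq_zero h)
  set M := D.restrict p (D.toDual Λ) with hM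
  have hM1 : ∀ k ∈ D.homog 1, k * M = counit (R := ℂ) k • M := by
    intro k hk
    rw [hM, ← D.restrict_mul hk, hΛ k hk, one_mul, map_smul, map_smul]
  choose y hy hy1 using D.exists_counit_eq_one
  -- Move M from degree p to degree q by any element of counit 1. The result does not depend on the
  -- choice, by `mul_eq_of_invariant`.
  refine ⟨fun q => y (q * p⁻¹) * M, ⟨fun q => ?_, fun r q h hh => ?_⟩, p, ?_⟩
  · have := D.dual_mul_mem (hy (q * p⁻¹)) (D.restrict_mem p (D.toDual Λ))
    rwa [inv_mul_cancel_right] at this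
  · rw [← mul_assoc, D.mul_eq_of_invariant hM1 (D.dual_mul_mem hh (hy (q * p⁻¹)))
      (by rw [← mul_assoc]; exact hy (r * q * p⁻¹)) (hy1 _), Bialgebra.counit_mul, hy1, mul_one]
  · have h1 := hy (p * p⁻¹)
    rw [mul_inv_cancel] at h1
    simp only [mul_inv_cancel]
    rw [hM1 _ h1, hy1, one_smul]
    exact hp

variable {D}

theorem IsLeftFamily.eq_mul {φ : G → D.RedDual} (hφ : D.IsLeftFamily φ) {p q : G} {y : D.RedDual}
    (hy : y ∈ D.homog (p * q⁻¹)) (hy1 : counit (R := ℂ) y = 1) : φ p = y * φ q := by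
  rw [hφ.mul _ _ _ hy, hy1, one_smul, inv_mul_cancel_right]

theorem IsLeftFamily.ne_zero {φ : G → D.RedDual} (hφ : D.IsLeftFamily φ) (h0 : ∃ p, φ p ≠ 0)
    (q : G) : φ q ≠ 0 := by
  obtain ⟨p, hp⟩ := h0
  obtain ⟨y, hy, hy1⟩ := D.exists_counit_eq_one (p * q⁻¹)
  intro h
  exact hp (by rw [hφ.eq_mul hy hy1, h, mul_zero])

theorem IsLeftFamily.lTensor_mulRight {φ : G → D.RedDual} (hφ : D.IsLeftFamily φ) {q : G} (p : G)
    {h : D.RedDual} (hh : h ∈ D.homog q) :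
    (LinearMap.mulRight ℂ (φ p)).lTensor _ (comul h) = h ⊗ₜ φ (q * p) := by
  obtain ⟨n, x, y, hx, hy, hc⟩ := D.exists_comul_eq_sum hh
  conv_rhs => rw [← D.sum_counit_smul_right hc]
  rw [hc]
  simp [hφ.mul q p _ (hy _), TensorProduct.sum_tmul, TensorProduct.smul_tmul]

theorem rid_lTensor_one_tmul_mul (α : Module.Dual ℂ D.RedDual) (h : D.RedDual)
    (X : D.RedDual ⊗[ℂ] D.RedDual) :
    TensorProduct.rid ℂ _ (α.lTensor _ ((1 ⊗ₜ h) * X)) =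
      TensorProduct.rid ℂ _ ((α ∘ₗ LinearMap.mulLeft ℂ h).lTensor _ X) := by
  induction X with
  | zero => simp
  | add X Y hX hY => simp only [map_add, mul_add, hX, hY]
  | tmul x y => simp

theorem rid_lTensor_tmul_one_mul (α : Module.Dual ℂ D.RedDual) (h : D.RedDual)
    (X : D.RedDual ⊗[ℂ] D.RedDual) :
    TensorProduct.rid ℂ _ (α.lTensor _ ((h ⊗ₜ 1) * X)) =
      h * TensorProduct.rid ℂ _ (α.lTensor _ X) := by
  induction X with
  | zero => simp
  | add X Y hX hY => simp only [map_add, mul_add, hX, hY]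
  | tmul x y => simp

theorem toDual_rid_lTensor_flip (a x : A) (X : D.RedDual ⊗[ℂ] D.RedDual) :
    D.toDual (TensorProduct.rid ℂ _ ((D.toDual.flip a).lTensor _ X)) x = D.pair X (x ⊗ₜ a) := by
  induction X with
  | zero => simp
  | add X Y hX hY => simp only [map_add, LinearMap.add_apply, hX, hY]
  | tmul f g => simp [pair_tmul, mul_comm]

/-- The goal is to contract φ_e with a and apply `smul_eq_zero_of_contract`. For k of degree p,
`one_tmul_mul_comul` rewrites the contraction as S(k) times φ_p(·a) = 0. In other degrees kφ₂
vanishes on a already. -/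
theorem IsLeftFamily.eq_zero_of_mul {φ : G → D.RedDual} (hφ : D.IsLeftFamily φ)
    (h0 : ∃ p, φ p ≠ 0) {p : G} {a : A} (ha : a ∈ D.comp p)
    (h : ∀ x, D.toDual (φ p) (x * a) = 0) : a = 0 := by
  have h1 : TensorProduct.rid ℂ _ ((D.toDual.flip a).lTensor _ (comul (φ p))) = 0 := by
    apply D.toDual_injective
    ext x
    rw [toDual_rid_lTensor_flip, pair_comul_tmul, h]
    simp
  have h2 : ∀ k : D.RedDual, TensorProduct.rid ℂ _
      ((D.toDual.flip a ∘ₗ LinearMap.mulLeft ℂ k).lTensor _ (comul (φ 1))) = 0 := by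
    intro k
    rw [← rid_lTensor_one_tmul_mul]
    refine D.dual_induction (fun q k hk => ?_) (by simp)
      (fun f f' hf hf' => by simp only [TensorProduct.tmul_add, add_mul, map_add, hf, hf',
        add_zero]) k
    by_cases hq : q = p
    · subst hq
      rw [one_tmul_mul_comul (hφ.lTensor_mulRight 1 hk), rid_lTensor_tmul_one_mul, mul_one, h1,
        mul_zero]
    · obtain ⟨n, x, y, hx, hy, hc⟩ := D.exists_comul_eq_sum (hφ.mem 1)
      rw [rid_lTensor_one_tmul_mul, hc]
      have h3 : ∀ i, D.toDual (k * y i) a = 0 := fun i =>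
        D.toDual_of_ne (by rw [mul_one]; exact Ne.symm hq) (D.dual_mul_mem hk (hy i)) ha
      simp [h3]
  refine D.ext_toDual fun q f hf => ?_
  have h3 := smul_eq_zero_of_contract h2 f
  rw [map_zero]
  exact (smul_eq_zero.1 h3).resolve_right (hφ.ne_zero h0 1)

theorem IsLeftFamily.exists_mul_eq {φ : G → D.RedDual} (hφ : D.IsLeftFamily φ)
    (h0 : ∃ p, φ p ≠ 0) {p : G} {g : D.RedDual} (hg : g ∈ D.homog p) :
    ∃ a ∈ D.comp p, ∀ x, D.toDual g x = D.toDual (φ p) (x * a) := by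
  have := D.finite p
  let ι : D.comp p →ₗ[ℂ] A := (D.comp p).toSubmodule.subtype
  let L : D.comp p →ₗ[ℂ] Module.Dual ℂ (D.comp p) :=
    ((LinearMap.mul ℂ A).flip.compr₂ (D.toDual (φ p))).compl₁₂ ι ι
  have hL : ∀ a x : D.comp p, L a x = D.toDual (φ p) ((x : A) * a) := fun _ _ => rfl
  have hinj : Function.Injective L := by
    rw [injective_iff_map_eq_zero]
    intro a ha
    apply Subtype.ext
    refine hφ.eq_zero_of_mul h0 a.2 fun x => ?_
    have h1 := LinearMap.congr_fun ha ⟨D.proj p x, D.proj_mem p x⟩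
    rw [hL] at h1
    change D.toDual (φ p) (D.one p * x * a) = 0 at h1
    rwa [mul_assoc, ← proj_apply, D.toDual_proj (hφ.mem p)] at h1
  -- Faithfulness makes a ↦ φ_p(·a) injective from A_p to its dual, and the dimensions agree.
  have hsurj : Function.Surjective L :=
    (LinearMap.injective_iff_surjective_of_finrank_eq_finrank
      (Subspace.dual_finrank_eq (K := ℂ) (V := D.comp p)).symm).1 hinj
  obtain ⟨a, ha⟩ := hsurj (D.toDual g ∘ₗ ι)
  refine ⟨a, a.2, fun x => ?_⟩
  have h1 := LinearMap.congr_fun ha ⟨D.proj p x, D.proj_mem p x⟩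
  rw [hL] at h1
  change D.toDual (φ p) (D.one p * x * a) = D.toDual g (D.proj p x) at h1
  rw [mul_assoc, ← proj_apply, D.toDual_proj (hφ.mem p), D.toDual_proj hg] at h1
  exact h1.symm

theorem IsLeftFamily.unique {φ φ' : G → D.RedDual} (hφ : D.IsLeftFamily φ)
    (h0 : ∃ p, φ p ≠ 0) (hφ' : D.IsLeftFamily φ') : ∃ c : ℂ, ∀ p, φ' p = c • φ p := by
  -- Choose a with φ_e(·a) = 1 and s with S(s) = φ'_e. In φ₁ ⊗ sφ₂ = S(s)φ₁ ⊗ φ₂ for φ = φ_e,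
  -- evaluate the second leg at a. The left side is s(a)φ_e, as sφ₂ = ε(φ₂)s, and the right side is
  -- φ'_e.
  obtain ⟨a, ha, hau⟩ := hφ.exists_mul_eq h0 D.dual_one_mem
  have h1 : TensorProduct.rid ℂ _ ((D.toDual.flip a).lTensor _ (comul (φ 1))) = 1 := by
    apply D.toDual_injective
    ext x
    rw [toDual_rid_lTensor_flip, pair_comul_tmul, hau]
  obtain ⟨s, hs⟩ := D.dual_antipode_bijective.2 (φ' 1)
  have hs1 : s ∈ D.homog 1 := by
    have := D.mem_homog_of_antipode_mem (f := s) (p := 1) (by rw [hs]; exact hφ'.mem 1)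
    rwa [inv_one] at this
  have hsy : ∀ y ∈ D.homog 1, s * y = counit (R := ℂ) y • s := by
    intro y hy
    apply D.dual_antipode_bijective.1
    have h2 := D.dual_antipode_mem hy
    rw [inv_one] at h2
    rw [antipode_mul_antidistrib, hs, hφ'.mul _ _ _ h2, counit_antipode, map_smul, hs, one_mul]
  have h3 := congrArg (fun X => TensorProduct.rid ℂ _ ((D.toDual.flip a).lTensor _ X))
    (one_tmul_mul_comul (hφ.lTensor_mulRight 1 hs1))
  simp only [one_mul] at h3
  rw [rid_lTensor_one_tmul_mul, rid_lTensor_tmul_one_mul, h1, mul_one, hs] at h3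
  obtain ⟨n, x, y, hx, hy, hc⟩ := D.exists_comul_eq_sum (hφ.mem 1)
  have h4 : φ' 1 = D.toDual s a • φ 1 := by
    rw [← h3]
    conv_rhs => rw [← D.sum_counit_smul_right hc]
    rw [hc]
    simp [hsy _ (hy _), Finset.smul_sum, smul_smul, mul_comm]
  refine ⟨D.toDual s a, fun p => ?_⟩
  obtain ⟨y, hy, hy1⟩ := D.exists_counit_eq_one (p * 1⁻¹)
  rw [hφ.eq_mul hy hy1, hφ'.eq_mul hy hy1, h4, mul_smul_comm]

theorem IsLeftFamily.antipode {φ : G → D.RedDual} (hφ : D.IsLeftFamily φ) :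
    D.IsRightFamily fun p => antipode ℂ (φ p⁻¹) where
  mem p := by simpa using D.dual_antipode_mem (hφ.mem p⁻¹)
  mul p q h hh := by
    obtain ⟨k, rfl⟩ := D.dual_antipode_bijective.2 h
    rw [← antipode_mul_antidistrib, hφ.mul _ _ _ (D.mem_homog_of_antipode_mem hh),
      counit_antipode, map_smul, mul_inv_rev]

theorem IsRightFamily.exists_antipode {ψ : G → D.RedDual} (hψ : D.IsRightFamily ψ) :
    ∃ φ : G → D.RedDual, D.IsLeftFamily φ ∧ ∀ p, ψ p = HopfAlgebra.antipode ℂ (φ p⁻¹) := by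
  choose k hk using fun p => D.dual_antipode_bijective.2 (ψ p⁻¹)
  refine ⟨k, ⟨fun p => ?_, fun p q h hh => ?_⟩, fun p => by rw [hk, inv_inv]⟩
  · simpa using D.mem_homog_of_antipode_mem (f := k p) (p := p⁻¹) (by rw [hk]; exact hψ.mem p⁻¹)
  · apply D.dual_antipode_bijective.1
    rw [antipode_mul_antidistrib, hk, hψ.mul _ _ _ (D.dual_antipode_mem hh), counit_antipode,
      map_smul, hk, mul_inv_rev]

end CogradedUnital

end

end MultiplierHopf

namespace MultiplierHopf

noncomputable section

open Coalgebra HopfAlgebra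

namespace CogradedUnital

variable {G : Type v} [Group G] {A : Type u} [NonUnitalRing A] [Module ℂ A]
  [IsScalarTower ℂ A A] [SMulCommClass ℂ A A] (D : CogradedUnital G A)

/-! ### Pairings with products in one leg -/

theorem pair_mul_fst {q : G} {f g : D.RedDual} (hg : g ∈ D.homog q) {n : ℕ}
    {x y : Fin n → D.RedDual} (h : comul (R := ℂ) f = ∑ i, x i ⊗ₜ y i) (b : A) (z : A ⊗[ℂ] A) :
    D.pair (f ⊗ₜ g) (z * (b ⊗ₜ D.one q)) = ∑ i, D.pair (x i ⊗ₜ g) z * D.toDual (y i) b := by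
  induction z with
  | zero => simp
  | add z w hz hw => simp only [map_add, add_mul, hz, hw, Finset.sum_add_distrib]
  | tmul c d =>
    rw [Algebra.TensorProduct.tmul_mul_tmul, pair_tmul, ← pair_comul_tmul, h, ← D.one_comm,
      ← proj_apply, D.toDual_proj hg]
    simp [pair_tmul, Finset.sum_mul, mul_right_comm]

theorem pair_mul_snd {q : G} {f g : D.RedDual} (hg : g ∈ D.homog q) {n : ℕ}
    {x y : Fin n → D.RedDual} (h : comul (R := ℂ) f = ∑ i, x i ⊗ₜ y i) (b : A) (z : A ⊗[ℂ] A) :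
    D.pair (g ⊗ₜ f) (z * (D.one q ⊗ₜ b)) = ∑ i, D.pair (g ⊗ₜ x i) z * D.toDual (y i) b := by
  induction z with
  | zero => simp
  | add z w hz hw => simp only [map_add, add_mul, hz, hw, Finset.sum_add_distrib]
  | tmul c d =>
    rw [Algebra.TensorProduct.tmul_mul_tmul, pair_tmul, ← D.pair_comul_tmul f, h, ← D.one_comm,
      ← proj_apply, D.toDual_proj hg]
    simp [pair_tmul, Finset.mul_sum, mul_assoc]

theorem pair_snd_mul {q : G} {f g : D.RedDual} (hg : g ∈ D.homog q) {n : ℕ}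
    {x y : Fin n → D.RedDual} (h : comul (R := ℂ) f = ∑ i, x i ⊗ₜ y i) (a : A) (z : A ⊗[ℂ] A) :
    D.pair (g ⊗ₜ f) ((D.one q ⊗ₜ a) * z) = ∑ i, D.toDual (x i) a * D.pair (g ⊗ₜ y i) z := by
  induction z with
  | zero => simp
  | add z w hz hw => simp only [map_add, mul_add, hz, hw, Finset.sum_add_distrib]
  | tmul c d =>
    rw [Algebra.TensorProduct.tmul_mul_tmul, pair_tmul, ← D.pair_comul_tmul f, h, ← proj_apply,
      D.toDual_proj hg]
    simp [pair_tmul, Finset.mul_sum, mul_left_comm]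

/-! ### Invariant functionals and their components -/

theorem pair_restrict_right {p : G} {h : D.RedDual} (hh : h ∈ D.homog p) (q : G)
    (φ : Module.Dual ℂ A) (w : A ⊗[ℂ] A) : D.pair (h ⊗ₜ D.restrict q φ) w =
      D.toDual h (TensorProduct.rid ℂ A (TensorProduct.map LinearMap.id φ
        (TensorProduct.map (D.proj p) (D.proj q) w))) := by
  induction w with
  | zero => simp
  | add z w hz hw => simp only [map_add, hz, hw]
  | tmul a b => simp [pair_tmul, toDual_restrict, D.toDual_proj hh, mul_comm]

theorem pair_restrict_left {p : G} {h : D.RedDual} (hh : h ∈ D.homog p) (q : G)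
    (φ : Module.Dual ℂ A) (w : A ⊗[ℂ] A) : D.pair (D.restrict q φ ⊗ₜ h) w =
      D.toDual h (TensorProduct.lid ℂ A (TensorProduct.map φ LinearMap.id
        (TensorProduct.map (D.proj q) (D.proj p) w))) := by
  induction w with
  | zero => simp
  | add z w hz hw => simp only [map_add, hz, hw]
  | tmul a b => simp [pair_tmul, toDual_restrict, D.toDual_proj hh]

variable {D}

theorem isLeftFamily_of_isLeftInvariant {φ : Module.Dual ℂ A} (hφ : IsLeftInvariant D.Δ φ) :
    D.IsLeftFamily fun p => D.restrict p φ where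
  mem p := D.restrict_mem p φ
  mul p q h hh := by
    apply D.toDual_injective
    ext a
    rw [D.toDual_mul hh (D.restrict_mem q φ), ← coprod_proj]
    -- For a in A_{pq}, the element (1_p ⊗ 1)Δ(a) has the single component Δ_{p,q}(a), so invariance
    -- can be applied to Δ_{p,q}(a) itself.
    obtain ⟨z, hz⟩ := D.regular.hopf.isComultiplication.fst_mul (D.one p) (D.proj (p * q) a)
    have h1 : z = D.coprod p q (D.proj (p * q) a) := by
      refine D.tensor_ext fun r s => ?_
      rw [D.mul_idem_of_fstLeg_mul hz]
      by_cases hr : p = r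
      · subst hr
        rw [← idem, idem_mul_coprod]
        by_cases hs : q = s
        · subst hs; rw [coprod_mul_idem]
        · rw [D.coprod_proj_of_ne (fun h => hs (mul_left_cancel h)), ← D.coprod_mul_idem p q,
            mul_assoc, D.idem_mul_idem_of_ne (Or.inr hs), mul_zero]
      · rw [← D.idem_mul_coprod r s, ← mul_assoc, ← idem, D.idem_mul_idem_of_ne (Or.inl hr),
          zero_mul, ← D.coprod_mul_idem p q, mul_assoc, D.idem_mul_idem_of_ne (Or.inl hr), mul_zero]
    rw [D.pair_restrict_right hh, map_proj_coprod, ← h1, hφ.right_action _ _ _ hz, map_smul,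
      D.counit_of_mem hh]
    simp [toDual_restrict, mul_comm]

theorem isRightFamily_of_isRightInvariant {ψ : Module.Dual ℂ A} (hψ : IsRightInvariant D.Δ ψ) :
    D.IsRightFamily fun p => D.restrict p ψ where
  mem p := D.restrict_mem p ψ
  mul p q h hh := by
    apply D.toDual_injective
    ext a
    rw [D.toDual_mul (D.restrict_mem q ψ) hh, ← coprod_proj]
    obtain ⟨z, hz⟩ := D.regular.hopf.isComultiplication.mul_snd (D.proj (q * p) a) (D.one p)
    have h1 : z = D.coprod q p (D.proj (q * p) a) := by
      refine D.tensor_ext fun r s => ?_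
      rw [D.mul_idem_of_mul_sndLeg hz]
      by_cases hs : s = p
      · subst hs
        rw [← idem, coprod_mul_idem]
        by_cases hr : q = r
        · subst hr; rw [coprod_mul_idem]
        · rw [D.coprod_proj_of_ne (fun h => hr (mul_right_cancel h)), ← D.coprod_mul_idem q s,
            mul_assoc, D.idem_mul_idem_of_ne (Or.inl hr), mul_zero]
      · rw [← D.coprod_mul_idem r s, mul_assoc, ← idem, D.idem_mul_idem_of_ne (Or.inr hs),
          mul_zero, ← D.coprod_mul_idem q p, mul_assoc,
          D.idem_mul_idem_of_ne (Or.inr (Ne.symm hs)), mul_zero]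
    rw [D.pair_restrict_left hh, map_proj_coprod, ← h1, hψ.left_action _ _ _ hz, map_smul,
      D.counit_of_mem hh]
    simp [toDual_restrict, mul_comm]

/-- Componentwise invariance suffices. For fixed p, a finite set of q can be chosen to cover the
second leg of z and, after translation by p, the components of a. -/
theorem rid_map_eq_smul {φ : Module.Dual ℂ A} {a b : A} {z : A ⊗[ℂ] A}
    (h : ∀ p q, ∀ f ∈ D.homog p, D.pair (f ⊗ₜ D.restrict q φ) z =
      φ (D.proj (p * q) a) * D.toDual f b) :
    TensorProduct.rid ℂ A (TensorProduct.map LinearMap.id φ z) = φ a • b := by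
  classical
  refine D.ext_toDual fun p f hf => ?_
  have h1 : ∀ z : A ⊗[ℂ] A, ∃ F : Finset G, ∀ F', F ⊆ F' →
      ∑ q ∈ F', D.pair (f ⊗ₜ D.restrict q φ) z =
        D.toDual f (TensorProduct.rid ℂ A (TensorProduct.map LinearMap.id φ z)) := by
    intro z
    induction z with
    | zero => exact ⟨∅, by simp⟩
    | add z w hz hw =>
      obtain ⟨F, hF⟩ := hz
      obtain ⟨F', hF'⟩ := hw
      refine ⟨F ∪ F', fun F₁ h₁ => ?_⟩
      simp only [map_add, Finset.sum_add_distrib]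
      rw [hF _ (Finset.union_subset_left h₁), hF' _ (Finset.union_subset_right h₁)]
    | tmul c d =>
      obtain ⟨F, hF⟩ := D.exists_finset_sum_proj d
      refine ⟨F, fun F' hF' => ?_⟩
      simp only [pair_tmul, toDual_restrict, ← Finset.mul_sum, ← map_sum, hF F' hF']
      simp [mul_comm]
  obtain ⟨F, hF⟩ := h1 z
  obtain ⟨F', hF'⟩ := D.exists_finset_sum_proj a
  let e : G ↪ G := ⟨fun r => p⁻¹ * r, mul_right_injective p⁻¹⟩
  let e' : G ↪ G := ⟨fun r => p * r, mul_right_injective p⟩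
  rw [← hF (F ∪ F'.map e) Finset.subset_union_left]
  simp only [h p _ f hf, ← Finset.sum_mul, ← map_sum]
  have h2 : F' ⊆ (F ∪ F'.map e).map e' := by
    intro r hr
    simp only [Finset.mem_map, Finset.mem_union]
    exact ⟨p⁻¹ * r, Or.inr ⟨r, hr, rfl⟩, mul_inv_cancel_left p r⟩
  have h3 : ∑ q ∈ F ∪ F'.map e, D.proj (p * q) a = a := by
    have := hF' _ h2
    rwa [Finset.sum_map] at this
  rw [h3, map_smul, smul_eq_mul]

theorem lid_map_eq_smul {ψ : Module.Dual ℂ A} {a b : A} {z : A ⊗[ℂ] A}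
    (h : ∀ p q, ∀ f ∈ D.homog p, D.pair (D.restrict q ψ ⊗ₜ f) z =
      ψ (D.proj (q * p) a) * D.toDual f b) :
    TensorProduct.lid ℂ A (TensorProduct.map ψ LinearMap.id z) = ψ a • b := by
  classical
  refine D.ext_toDual fun p f hf => ?_
  have h1 : ∀ z : A ⊗[ℂ] A, ∃ F : Finset G, ∀ F', F ⊆ F' →
      ∑ q ∈ F', D.pair (D.restrict q ψ ⊗ₜ f) z =
        D.toDual f (TensorProduct.lid ℂ A (TensorProduct.map ψ LinearMap.id z)) := by
    intro z
    induction z with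
    | zero => exact ⟨∅, by simp⟩
    | add z w hz hw =>
      obtain ⟨F, hF⟩ := hz
      obtain ⟨F', hF'⟩ := hw
      refine ⟨F ∪ F', fun F₁ h₁ => ?_⟩
      simp only [map_add, Finset.sum_add_distrib]
      rw [hF _ (Finset.union_subset_left h₁), hF' _ (Finset.union_subset_right h₁)]
    | tmul c d =>
      obtain ⟨F, hF⟩ := D.exists_finset_sum_proj c
      refine ⟨F, fun F' hF' => ?_⟩
      simp only [pair_tmul, toDual_restrict, ← Finset.sum_mul, ← map_sum, hF F' hF']
      simp
  obtain ⟨F, hF⟩ := h1 z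
  obtain ⟨F', hF'⟩ := D.exists_finset_sum_proj a
  let e : G ↪ G := ⟨fun r => r * p⁻¹, mul_left_injective p⁻¹⟩
  let e' : G ↪ G := ⟨fun r => r * p, mul_left_injective p⟩
  rw [← hF (F ∪ F'.map e) Finset.subset_union_left]
  simp only [h p _ f hf, ← Finset.sum_mul, ← map_sum]
  have h2 : F' ⊆ (F ∪ F'.map e).map e' := by
    intro r hr
    simp only [Finset.mem_map, Finset.mem_union]
    exact ⟨r * p⁻¹, Or.inr ⟨r, hr, rfl⟩, inv_mul_cancel_right r p⟩
  have h3 : ∑ q ∈ F ∪ F'.map e, D.proj (q * p) a = a := by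
    have := hF' _ h2
    rwa [Finset.sum_map] at this
  rw [h3, map_smul, smul_eq_mul]

theorem isLeftInvariant_of_isLeftFamily {φ : Module.Dual ℂ A}
    (hφ : D.IsLeftFamily fun p => D.restrict p φ) : IsLeftInvariant D.Δ φ where
  left_action a b z hz := by
    refine rid_map_eq_smul (D := D) fun p q f hf => ?_
    obtain ⟨n, x, y, hx, hy, h⟩ := D.exists_comul_eq_sum hf
    rw [← D.pair_mul_idem hf (D.restrict_mem q φ), D.mul_idem_of_mul_fstLeg hz,
      D.pair_mul_fst (D.restrict_mem q φ) h]
    conv_rhs => rw [← D.sum_counit_smul_left h]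
    simp only [← D.toDual_mul (hx _) (D.restrict_mem q φ), hφ.mul p q _ (hx _)]
    simp [toDual_restrict, Finset.mul_sum, mul_left_comm, mul_assoc]
  right_action a b z hz := by
    refine rid_map_eq_smul (D := D) fun p q f hf => ?_
    obtain ⟨n, x, y, hx, hy, h⟩ := D.exists_comul_eq_sum hf
    rw [← D.pair_mul_idem hf (D.restrict_mem q φ), D.mul_idem_of_fstLeg_mul hz,
      D.pair_fst_mul (D.restrict_mem q φ) h]
    conv_rhs => rw [← D.sum_counit_smul_right h]
    simp only [← D.toDual_mul (hy _) (D.restrict_mem q φ), hφ.mul p q _ (hy _)]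
    simp [toDual_restrict, Finset.mul_sum]
    exact Finset.sum_congr rfl fun i _ => by ring

theorem isRightInvariant_of_isRightFamily {ψ : Module.Dual ℂ A}
    (hψ : D.IsRightFamily fun p => D.restrict p ψ) : IsRightInvariant D.Δ ψ where
  left_action a b z hz := by
    refine lid_map_eq_smul (D := D) fun p q f hf => ?_
    obtain ⟨n, x, y, hx, hy, h⟩ := D.exists_comul_eq_sum hf
    rw [← D.pair_mul_idem (D.restrict_mem q ψ) hf, D.mul_idem_of_mul_sndLeg hz,
      D.pair_mul_snd (D.restrict_mem q ψ) h]
    conv_rhs => rw [← D.sum_counit_smul_left h]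
    simp only [← D.toDual_mul (D.restrict_mem q ψ) (hx _), hψ.mul p q _ (hx _)]
    simp [toDual_restrict, Finset.mul_sum, mul_left_comm, mul_assoc]
  right_action a b z hz := by
    refine lid_map_eq_smul (D := D) fun p q f hf => ?_
    obtain ⟨n, x, y, hx, hy, h⟩ := D.exists_comul_eq_sum hf
    rw [← D.pair_mul_idem (D.restrict_mem q ψ) hf, D.mul_idem_of_sndLeg_mul hz,
      D.pair_snd_mul (D.restrict_mem q ψ) h]
    conv_rhs => rw [← D.sum_counit_smul_right h]
    simp only [← D.toDual_mul (D.restrict_mem q ψ) (hy _), hψ.mul p q _ (hy _)]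
    simp [toDual_restrict, Finset.mul_sum]
    exact Finset.sum_congr rfl fun i _ => by ring

variable (D) in
/-- A functional on `A` is given by its components. -/
theorem exists_restrict_eq {φ : G → D.RedDual} (hφ : ∀ p, φ p ∈ D.homog p) :
    ∃ Φ : Module.Dual ℂ A, ∀ p, D.restrict p Φ = φ p := by
  classical
  let e := D.cograded.independent.linearEquiv D.cograded.iSup_eq_top
  refine ⟨DFinsupp.lsum ℂ (fun p => D.toDual (φ p) ∘ₗ (D.comp p).toSubmodule.subtype) ∘ₗ
    e.symm.toLinearMap, fun p => D.toDual_injective (LinearMap.ext fun a => ?_)⟩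
  rw [toDual_restrict, LinearMap.comp_apply, LinearEquiv.coe_coe,
    iSupIndep.linearEquiv_symm_apply D.cograded.independent D.cograded.iSup_eq_top
      (D.proj_mem p a), DFinsupp.lsum_single]
  exact D.toDual_proj (hφ p) a

variable (D) in
theorem eq_of_restrict {φ ψ : Module.Dual ℂ A} (h : ∀ p, D.restrict p φ = D.restrict p ψ) :
    φ = ψ := by
  ext a
  refine D.induction (fun p a ha => ?_) (by simp) (fun a b ha hb => by simp [ha, hb]) a
  rw [← D.proj_of_mem ha, ← toDual_restrict, h, toDual_restrict]

theorem exists_restrict_ne_zero {φ : Module.Dual ℂ A} (h : φ ≠ 0) :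
    ∃ p, D.restrict p φ ≠ 0 := by
  by_contra! h'
  exact h (D.eq_of_restrict fun p => by rw [h', map_zero])

variable (D)

theorem exists_leftIntegral : ∃ φ, IsLeftIntegral D.Δ φ ∧
    ∀ φ', IsLeftIntegral D.Δ φ' → ∃ c : ℂ, φ' = c • φ := by
  obtain ⟨φ, hφ, h0⟩ := D.exists_isLeftFamily
  obtain ⟨Φ, hΦ⟩ := D.exists_restrict_eq hφ.mem
  have hΦ' : (fun p => D.restrict p Φ) = φ := funext hΦ
  refine ⟨Φ, ⟨?_, isLeftInvariant_of_isLeftFamily (by rwa [hΦ'])⟩, fun φ' hφ' => ?_⟩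
  · rintro rfl
    obtain ⟨p, hp⟩ := h0
    exact hp (by rw [← hΦ, map_zero])
  · obtain ⟨c, hc⟩ := hφ.unique h0 (isLeftFamily_of_isLeftInvariant hφ'.2)
    exact ⟨c, D.eq_of_restrict fun p => by rw [hc, map_smul, hΦ]⟩

theorem exists_rightIntegral : ∃ ψ, IsRightIntegral D.Δ ψ ∧
    ∀ ψ', IsRightIntegral D.Δ ψ' → ∃ c : ℂ, ψ' = c • ψ := by
  obtain ⟨φ, hφ, h0⟩ := D.exists_isLeftFamily
  have hψ := hφ.antipode
  obtain ⟨Φ, hΦ⟩ := D.exists_restrict_eq hψ.mem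
  have hΦ' : (fun p => D.restrict p Φ) = _ := funext hΦ
  refine ⟨Φ, ⟨?_, isRightInvariant_of_isRightFamily (by rwa [hΦ'])⟩, fun ψ' hψ' => ?_⟩
  · rintro rfl
    refine hφ.ne_zero h0 (1⁻¹) (D.dual_antipode_bijective.1 ?_)
    rw [← hΦ, map_zero, map_zero]
  · obtain ⟨φ', hφ', h⟩ := (isRightFamily_of_isRightInvariant hψ'.2).exists_antipode
    obtain ⟨c, hc⟩ := hφ.unique h0 hφ'
    exact ⟨c, D.eq_of_restrict fun p => by rw [h, map_smul, hΦ, hc, map_smul]⟩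

/-! ### The space of functionals `φ( · a)` -/

theorem dualSpace_le (φ : Module.Dual ℂ A) : dualSpace φ ≤ reducedDual D.comp := by
  rintro _ ⟨a, rfl⟩
  refine D.induction (fun p a ha => ?_) (by simp)
    (fun a b ha hb => by rw [map_add]; exact add_mem ha hb) a
  refine (le_iSup (componentDual D.comp) p) fun q hq x hx => ?_
  simp [D.cograded.orthogonal q p hq x hx a ha]

theorem dualSpace_eq {φ : Module.Dual ℂ A} (hφ : IsLeftIntegral D.Δ φ) :
    dualSpace φ = reducedDual D.comp := by
  refine le_antisymm (D.dualSpace_le φ) (iSup_le fun p f hf => ?_)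
  obtain ⟨a, ha, h⟩ := (isLeftFamily_of_isLeftInvariant hφ.2).exists_mul_eq
    (exists_restrict_ne_zero hφ.1) (g := ⟨f, (le_iSup (componentDual D.comp) p) hf⟩) hf
  refine ⟨a, LinearMap.ext fun x => ?_⟩
  refine Eq.trans ?_ (h x).symm
  rw [toDual_restrict, proj_apply, D.one_comm, mul_assoc, D.mul_one_of_mem ha]
  rfl

/-- The map `a ↦ φ( · a)`. -/
def mulRightDual (φ : Module.Dual ℂ A) : A →ₗ[ℂ] D.RedDual :=
  LinearMap.codRestrict (reducedDual D.comp) ((LinearMap.mul ℂ A).flip.compr₂ φ)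
    fun a => D.dualSpace_le φ ⟨a, rfl⟩

theorem toDual_mulRightDual (φ : Module.Dual ℂ A) (a x : A) :
    D.toDual (D.mulRightDual φ a) x = φ (x * a) := rfl

theorem toDual_mulRightDual_mul (φ : Module.Dual ℂ A) (c d x : A) :
    D.toDual (D.mulRightDual φ c * D.mulRightDual φ d) x =
      evalTensor φ φ ((D.Δ x).left (c ⊗ₜ d)) := by
  refine D.induction (fun p c hc => ?_) (by simp) (fun a b ha hb => by
    rw [map_add, add_mul, map_add, LinearMap.add_apply, ha, hb, TensorProduct.add_tmul, map_add,
      map_add]) c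
  refine D.induction (fun q d hd => ?_) (by simp) (fun a b ha hb => by
    rw [map_add, mul_add, map_add, LinearMap.add_apply, ha, hb, TensorProduct.tmul_add, map_add,
      map_add]) d
  have hc' : D.mulRightDual φ c ∈ D.homog p := fun q hq x hx => by
    rw [toDual_mulRightDual, D.cograded.orthogonal q p hq x hx c hc, map_zero]
  have hd' : D.mulRightDual φ d ∈ D.homog q := fun r hr x hx => by
    rw [toDual_mulRightDual, D.cograded.orthogonal r q hr x hx d hd, map_zero]
  -- For c in A_p and d in A_q, Δ(x)(c ⊗ d) = Δ_{p,q}(x)(c ⊗ d). This reduces the global formula to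
  -- the graded product.
  have h1 : D.idem p q * (c ⊗ₜ d) = c ⊗ₜ[ℂ] d := by
    simp [idem, D.one_mul_of_mem hc, D.one_mul_of_mem hd]
  rw [D.toDual_mul hc' hd', ← h1, Multiplier.left_mul, ← coprod_apply]
  generalize D.coprod p q x = z
  induction z with
  | zero => simp
  | add z w hz hw => simp only [map_add, add_mul, hz, hw]
  | tmul a b => simp [pair_tmul, toDual_mulRightDual, evalTensor]

theorem mul'_map_flip (X : D.RedDual ⊗[ℂ] D.RedDual) (x y : A) :
    LinearMap.mul' ℂ ℂ (TensorProduct.map (D.toDual.flip x) (D.toDual.flip y) X) =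
      D.pair X (x ⊗ₜ y) := by
  induction X with
  | zero => simp
  | add z w hz hw => simp only [map_add, LinearMap.add_apply, hz, hw]
  | tmul a b => simp [pair_tmul]

theorem isDual {φ : Module.Dual ℂ A} (hφ : IsLeftIntegral D.Δ φ) :
    IsDual D.Δ φ D.toDual where
  injective := D.toDual_injective
  range_eq := by rw [range_toDual, D.dualSpace_eq hφ]
  mul_apply f g c d hf hg x := by
    have h1 : f = D.mulRightDual φ c := D.toDual_injective (LinearMap.ext hf)
    have h2 : g = D.mulRightDual φ d := D.toDual_injective (LinearMap.ext hg)
    rw [h1, h2, toDual_mulRightDual_mul]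
  comul_apply f x y := by rw [mul'_map_flip, pair_comul_tmul]

/-! ### Counit and antipode of `A` -/

/-- The counit of `A`. -/
def counitA : A →ₗ[ℂ] ℂ := D.toDual 1

theorem toDual_lid_map_counitA (f : D.RedDual) (z : A ⊗[ℂ] A) :
    D.toDual f (TensorProduct.lid ℂ A (TensorProduct.map D.counitA LinearMap.id z)) =
      D.pair (1 ⊗ₜ f) z := by
  induction z with
  | zero => simp
  | add z w hz hw => simp only [map_add, hz, hw]
  | tmul a b => simp [pair_tmul, counitA]

theorem toDual_rid_map_counitA (f : D.RedDual) (z : A ⊗[ℂ] A) :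
    D.toDual f (TensorProduct.rid ℂ A (TensorProduct.map LinearMap.id D.counitA z)) =
      D.pair (f ⊗ₜ 1) z := by
  induction z with
  | zero => simp
  | add z w hz hw => simp only [map_add, hz, hw]
  | tmul a b => simp [pair_tmul, counitA, mul_comm]

/-- Each axiom is dual to one for the unit of A^*: multiplicativity is Δ(1) = 1 ⊗ 1, and the two
counit identities are 1f = f = f1. -/
theorem isCounit : IsCounit D.Δ D.counitA where
  map_mul a b := by
    rw [counitA, ← pair_comul_tmul, Bialgebra.comul_one, Algebra.TensorProduct.one_def, pair_tmul]
  counit_left a b z hz := by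
    refine D.ext_toDual fun q f hf => ?_
    obtain ⟨n, x, y, hx, hy, h⟩ := D.exists_comul_eq_sum hf
    rw [toDual_lid_map_counitA, ← D.pair_mul_idem D.dual_one_mem hf, D.mul_idem_of_mul_sndLeg hz,
      D.pair_mul_snd D.dual_one_mem h, ← pair_comul_tmul, h]
    simp only [← D.toDual_mul D.dual_one_mem (hx _), one_mul]
    simp [pair_tmul]
  counit_right a b z hz := by
    refine D.ext_toDual fun q f hf => ?_
    obtain ⟨n, x, y, hx, hy, h⟩ := D.exists_comul_eq_sum hf
    rw [toDual_rid_map_counitA, ← D.pair_mul_idem hf D.dual_one_mem, D.mul_idem_of_fstLeg_mul hz,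
      D.pair_fst_mul D.dual_one_mem h, ← pair_comul_tmul, h]
    simp only [← D.toDual_mul (hy _) D.dual_one_mem, mul_one]
    simp [pair_tmul]

end CogradedUnital

end

end MultiplierHopf

/-! ### The antipode of A by transposition, and the conclusion. -/

namespace MultiplierHopf

noncomputable section

open Coalgebra HopfAlgebra

namespace CogradedUnital

variable {G : Type v} [Group G] {A : Type u} [NonUnitalRing A] [Module ℂ A]
  [IsScalarTower ℂ A A] [SMulCommClass ℂ A A] (D : CogradedUnital G A)

theorem exists_transpose {L : D.RedDual →ₗ[ℂ] D.RedDual}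
    (hL : ∀ p f, L (D.restrict p⁻¹ (D.toDual f)) = D.restrict p (D.toDual (L f))) :
    ∃ T : A →ₗ[ℂ] A, ∀ f a, D.toDual f (T a) = D.toDual (L f) a := by
  have h : ∀ a, ∃ b, D.toDual.flip b = D.toDual.flip a ∘ₗ L := by
    intro a
    refine D.induction (fun p a ha => ?_) ⟨0, by simp⟩ ?_ a
    · obtain ⟨n, x, b, hx, hb⟩ := D.exists_dual_basis p⁻¹
      -- For a in A_p, (L f)(a) depends only on the component of f in A_{p⁻¹}', which is ∑ f(b_i)
      -- x_i. Hence (L f)(a) = ∑ f(b_i)(L x_i)(a).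
      refine ⟨∑ i, D.toDual (L (x i)) a • b i, LinearMap.ext fun f => ?_⟩
      have h1 : D.restrict p⁻¹ (D.toDual f) = ∑ i, D.toDual f (b i) • x i := by
        apply D.toDual_injective
        ext c
        rw [toDual_restrict, hb]
        simp [mul_comm]
      have h2 := congrArg (fun g => D.toDual g a) (hL p f)
      rw [h1] at h2
      simp only [toDual_restrict, D.proj_of_mem ha] at h2
      rw [LinearMap.comp_apply, LinearMap.flip_apply, LinearMap.flip_apply, ← h2]
      simp [mul_comm]
    · rintro a a' ⟨b, hb⟩ ⟨b', hb'⟩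
      exact ⟨b + b', by rw [map_add, map_add, hb, hb', LinearMap.add_comp]⟩
  choose T hT using h
  refine ⟨⟨⟨T, fun a b => D.toDual_flip_injective ?_⟩, fun c a => D.toDual_flip_injective ?_⟩,
    fun f a => LinearMap.congr_fun (hT a) f⟩
  · rw [map_add, hT, hT, hT, map_add, LinearMap.add_comp]
  · rw [hT, map_smul, map_smul, hT]
    rfl

theorem exists_antipode : ∃ S : A ≃ₗ[ℂ] A, ∀ f a, D.toDual f (S a) =
    D.toDual (antipode ℂ f) a := by
  let e := LinearEquiv.ofBijective (antipode ℂ (A := D.RedDual)) D.dual_antipode_bijective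
  have he : ∀ f, e f = antipode ℂ f := fun _ => rfl
  obtain ⟨S, hS⟩ := D.exists_transpose (L := e.toLinearMap) fun p f => by
    simp only [LinearEquiv.coe_coe, he]
    rw [antipode_restrict, inv_inv]
  obtain ⟨S', hS'⟩ := D.exists_transpose (L := e.symm.toLinearMap) fun p f => by
    apply e.injective
    rw [LinearEquiv.coe_coe, e.apply_symm_apply, he, antipode_restrict, ← he,
      e.apply_symm_apply]
  refine ⟨LinearEquiv.ofLinearMap S S' ?_ ?_, hS⟩
  · refine LinearMap.ext fun a => D.ext_toDual fun p f _ => ?_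
    simp [hS, hS']
  · refine LinearMap.ext fun a => D.ext_toDual fun p f _ => ?_
    simp [hS, hS']

/-- The antipode of `A`. -/
def antipodeA : A ≃ₗ[ℂ] A := D.exists_antipode.choose

theorem toDual_antipodeA (f : D.RedDual) (a : A) :
    D.toDual f (D.antipodeA a) = D.toDual (antipode ℂ f) a := D.exists_antipode.choose_spec f a

theorem map_antipodeA (p : G) :
    (D.comp p).toSubmodule.map D.antipodeA.toLinearMap = (D.comp p⁻¹).toSubmodule := by
  apply le_antisymm
  · rintro _ ⟨a, ha, rfl⟩
    refine D.mem_comp_of_toDual fun q hq f hf => ?_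
    rw [LinearEquiv.coe_coe, toDual_antipodeA]
    exact D.toDual_of_ne (fun h => hq (by rw [h, inv_inv])) (D.dual_antipode_mem hf) ha
  · intro b hb
    refine ⟨D.antipodeA.symm b, D.mem_comp_of_toDual fun q hq f hf => ?_,
      D.antipodeA.apply_symm_apply b⟩
    obtain ⟨g, rfl⟩ := D.dual_antipode_bijective.2 f
    rw [← toDual_antipodeA, LinearEquiv.apply_symm_apply]
    exact D.toDual_of_ne (fun h => hq (inv_injective h).symm) (D.mem_homog_of_antipode_mem hf) hb

theorem pair_map_antipode_comm (X : D.RedDual ⊗[ℂ] D.RedDual) (a b : A) :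
    D.pair (TensorProduct.map (antipode ℂ) (antipode ℂ) (TensorProduct.comm ℂ _ _ X)) (a ⊗ₜ b) =
      D.pair X (D.antipodeA b ⊗ₜ D.antipodeA a) := by
  induction X with
  | zero => simp
  | add X Y hX hY => simp only [map_add, LinearMap.add_apply, hX, hY]
  | tmul f g => simp [pair_tmul, toDual_antipodeA, mul_comm]

theorem toDual_mul'_map_antipodeA_id {f : D.RedDual} {n : ℕ} {x y : Fin n → D.RedDual}
    (h : comul (R := ℂ) f = ∑ i, x i ⊗ₜ y i) (z : A ⊗[ℂ] A) :
    D.toDual f (LinearMap.mul' ℂ A (TensorProduct.map D.antipodeA.toLinearMap LinearMap.id z)) =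
      ∑ i, D.pair (antipode ℂ (x i) ⊗ₜ y i) z := by
  induction z with
  | zero => simp
  | add z w hz hw => simp only [map_add, hz, hw, Finset.sum_add_distrib]
  | tmul a b =>
    rw [TensorProduct.map_tmul, LinearMap.mul'_apply, ← pair_comul_tmul, h]
    simp [pair_tmul, toDual_antipodeA]

theorem toDual_mul'_map_id_antipodeA {f : D.RedDual} {n : ℕ} {x y : Fin n → D.RedDual}
    (h : comul (R := ℂ) f = ∑ i, x i ⊗ₜ y i) (z : A ⊗[ℂ] A) :
    D.toDual f (LinearMap.mul' ℂ A (TensorProduct.map LinearMap.id D.antipodeA.toLinearMap z)) =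
      ∑ i, D.pair (x i ⊗ₜ antipode ℂ (y i)) z := by
  induction z with
  | zero => simp
  | add z w hz hw => simp only [map_add, hz, hw, Finset.sum_add_distrib]
  | tmul a b =>
    rw [TensorProduct.map_tmul, LinearMap.mul'_apply, ← pair_comul_tmul, h]
    simp [pair_tmul, toDual_antipodeA]

theorem isAntipode_left (a b : A) (z : A ⊗[ℂ] A) (hz : toMultiplier z = D.Δ a * sndLeg b) :
    LinearMap.mul' ℂ A (TensorProduct.map D.antipodeA.toLinearMap LinearMap.id z) =
      D.counitA a • b := by
  refine D.ext_toDual fun p f hf => ?_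
  obtain ⟨n, x, y, hx, hy, h⟩ := D.exists_comul_eq_sum hf
  -- Ψ sends x ⊗ y ⊗ w to (S(x)y)(a) w(b). Testing the axiom on f gives Ψ(f₁ ⊗ f₂ ⊗ f₃), and S(f₁)f₂
  -- collapses to the counit.
  let Ψ : D.RedDual ⊗[ℂ] (D.RedDual ⊗[ℂ] D.RedDual) →ₗ[ℂ] ℂ :=
    LinearMap.mul' ℂ ℂ ∘ₗ TensorProduct.map
      (D.toDual.flip a ∘ₗ LinearMap.mul' ℂ D.RedDual ∘ₗ (antipode ℂ).rTensor D.RedDual)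
      (D.toDual.flip b) ∘ₗ (TensorProduct.assoc ℂ _ _ _).symm.toLinearMap
  have h1 : ∀ i, D.pair (antipode ℂ (x i) ⊗ₜ y i) z = Ψ (x i ⊗ₜ comul (y i)) := by
    intro i
    obtain ⟨m, u, w, hu, hw, hi⟩ := D.exists_comul_eq_sum (hy i)
    have hxi := D.dual_antipode_mem (hx i)
    rw [← D.pair_mul_idem hxi (hy i), D.mul_idem_of_mul_sndLeg hz, D.pair_mul_snd hxi hi, hi]
    simp [Ψ, ← D.toDual_mul hxi (hu _), TensorProduct.tmul_sum]
  have h2 : ∀ X : D.RedDual ⊗[ℂ] D.RedDual,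
      Ψ (TensorProduct.assoc ℂ _ _ _ (comul.rTensor _ X)) =
        D.counitA a * D.toDual (TensorProduct.lid ℂ _ (counit.rTensor _ X)) b := by
    intro X
    induction X with
    | zero => simp
    | add X Y hX hY => simp only [map_add, LinearMap.add_apply, mul_add, hX, hY]
    | tmul x y =>
      simp [Ψ, mul_antipode_rTensor_comul_apply, Algebra.algebraMap_eq_smul_one, counitA]
      ring
  have h3 : ∑ i, Ψ (x i ⊗ₜ comul (y i)) = Ψ (comul.lTensor _ (comul (R := ℂ) f)) := by
    rw [h]; simp
  rw [D.toDual_mul'_map_antipodeA_id h, Finset.sum_congr rfl fun i _ => h1 i, h3,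
    ← Coalgebra.coassoc_apply, h2, rTensor_counit_comul]
  simp

theorem isAntipode_right (a b : A) (z : A ⊗[ℂ] A) (hz : toMultiplier z = fstLeg b * D.Δ a) :
    LinearMap.mul' ℂ A (TensorProduct.map LinearMap.id D.antipodeA.toLinearMap z) =
      D.counitA a • b := by
  refine D.ext_toDual fun p f hf => ?_
  obtain ⟨n, x, y, hx, hy, h⟩ := D.exists_comul_eq_sum hf
  -- Here Ψ sends x ⊗ y ⊗ w to x(b)(yS(w))(a), and f₂S(f₃) collapses.
  let Ψ : D.RedDual ⊗[ℂ] (D.RedDual ⊗[ℂ] D.RedDual) →ₗ[ℂ] ℂ :=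
    LinearMap.mul' ℂ ℂ ∘ₗ TensorProduct.map (D.toDual.flip b)
      (D.toDual.flip a ∘ₗ LinearMap.mul' ℂ D.RedDual ∘ₗ (antipode ℂ).lTensor D.RedDual)
  have h1 : ∀ i, D.pair (x i ⊗ₜ antipode ℂ (y i)) z =
      Ψ (TensorProduct.assoc ℂ _ _ _ (comul (x i) ⊗ₜ y i)) := by
    intro i
    obtain ⟨m, u, w, hu, hw, hi⟩ := D.exists_comul_eq_sum (hx i)
    have hyi := D.dual_antipode_mem (hy i)
    rw [← D.pair_mul_idem (hx i) hyi, D.mul_idem_of_fstLeg_mul hz, D.pair_fst_mul hyi hi, hi]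
    simp [Ψ, ← D.toDual_mul (hw _) hyi, TensorProduct.sum_tmul]
  have h2 : ∀ X : D.RedDual ⊗[ℂ] D.RedDual, Ψ (comul.lTensor _ X) =
      D.counitA a * D.toDual (TensorProduct.rid ℂ _ (counit.lTensor _ X)) b := by
    intro X
    induction X with
    | zero => simp
    | add X Y hX hY => simp only [map_add, LinearMap.add_apply, mul_add, hX, hY]
    | tmul x y =>
      simp [Ψ, mul_antipode_lTensor_comul_apply, Algebra.algebraMap_eq_smul_one, counitA]
      ring
  have h3 : ∑ i, Ψ (TensorProduct.assoc ℂ _ _ _ (comul (x i) ⊗ₜ y i)) =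
      Ψ (TensorProduct.assoc ℂ _ _ _ (comul.rTensor _ (comul (R := ℂ) f))) := by
    rw [h]; simp
  rw [D.toDual_mul'_map_id_antipodeA h, Finset.sum_congr rfl fun i _ => h1 i, h3,
    Coalgebra.coassoc_apply, h2, lTensor_counit_comul]
  simp

theorem isAntipode : IsAntipode D.Δ D.counitA D.antipodeA where
  map_mul a b := D.ext_toDual fun p f _ => by
    rw [toDual_antipodeA, ← pair_comul_tmul, comul_antipode, pair_map_antipode_comm,
      pair_comul_tmul]
  antipode_left := D.isAntipode_left
  antipode_right := D.isAntipode_right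

theorem isReducedDualHopf :
    IsReducedDualHopf D.Δ D.comp D.one D.counitA D.antipodeA D.toDual where
  injective := D.toDual_injective
  range_eq := D.range_toDual
  mul_mem _ _ _ _ hf hg := D.dual_mul_mem hf hg
  mul_apply p q f g hf hg x _ := by
    rw [D.toDual_mul hf hg, pair_tmul_eq_evalTensor, coprod_eq_coprodComponent]
  one_mem := D.dual_one_mem
  one_apply _ _ := rfl
  comul_mem _ _ hf := D.comul_mem hf
  comul_apply _ f _ x _ y _ := by rw [mul'_map_flip, pair_comul_tmul]
  counit_apply _ _ hf := D.counit_of_mem hf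
  antipode_mem _ _ hf := D.dual_antipode_mem hf
  antipode_apply _ f _ x _ := (D.toDual_antipodeA f x).symm

end CogradedUnital

end

end MultiplierHopf

theorem corollary3p4 {G : Type v} [Group G] {A : Type u} [NonUnitalRing A] [Module ℂ A]
    [IsScalarTower ℂ A A] [SMulCommClass ℂ A A]
    (Δ : A →ₙₐ[ℂ] MultiplierHopf.Multiplier (A ⊗[ℂ] A))
    (hΔ : MultiplierHopf.IsRegularMultiplierHopfAlgebra Δ)
    (𝒜 : G → NonUnitalSubalgebra ℂ A) (h𝒜 : MultiplierHopf.IsCograded Δ 𝒜)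
    (hfin : ∀ p, Module.Finite ℂ (𝒜 p))
    (one : G → A) (hone : ∀ p, one p ∈ 𝒜 p ∧ ∀ a ∈ 𝒜 p, one p * a = a ∧ a * one p = a) :
    -- left and right integrals exist and are unique up to a scalar
    ((∃ φ, MultiplierHopf.IsLeftIntegral Δ φ ∧
        ∀ φ', MultiplierHopf.IsLeftIntegral Δ φ' → ∃ c : ℂ, φ' = c • φ) ∧
      (∃ ψ, MultiplierHopf.IsRightIntegral Δ ψ ∧
        ∀ ψ', MultiplierHopf.IsRightIntegral Δ ψ' → ∃ c : ℂ, ψ' = c • ψ)) ∧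
    -- the space of the dual is the direct sum of the duals of the components
    (iSupIndep (MultiplierHopf.componentDual 𝒜) ∧
      ∀ φ, MultiplierHopf.IsLeftIntegral Δ φ →
        MultiplierHopf.dualSpace φ = MultiplierHopf.reducedDual 𝒜) ∧
    -- the dual is a Hopf algebra, with the explicit structure of the direct sum of the duals
    (∃ (ε : A →ₗ[ℂ] ℂ) (S : A ≃ₗ[ℂ] A),
      MultiplierHopf.IsCounit Δ ε ∧ MultiplierHopf.IsAntipode Δ ε S ∧
      (∀ p, (𝒜 p).toSubmodule.map S.toLinearMap = (𝒜 p⁻¹).toSubmodule) ∧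
      ∃ (H : Type u) (_ : Ring H) (_ : HopfAlgebra ℂ H) (j : H →ₗ[ℂ] Module.Dual ℂ A),
        MultiplierHopf.IsReducedDualHopf Δ 𝒜 one ε S j ∧
        ∀ φ, MultiplierHopf.IsLeftIntegral Δ φ → MultiplierHopf.IsDual Δ φ j) := by
  let D : MultiplierHopf.CogradedUnital G A := ⟨Δ, hΔ, 𝒜, h𝒜, hfin, one, hone⟩
  exact ⟨⟨D.exists_leftIntegral, D.exists_rightIntegral⟩,
    ⟨D.iSupIndep_componentDual, fun _ hφ => D.dualSpace_eq hφ⟩,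
    D.counitA, D.antipodeA, D.isCounit, D.isAntipode, D.map_antipodeA,
    D.RedDual, inferInstance, inferInstance, D.toDual, D.isReducedDualHopf,
    fun _ hφ => D.isDual hφ⟩
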